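/- For $a_1,a_2,a_3,b_1,b_2,c_1,c_2\in\mathbb C$ let $$F_N(a_1,a_2,a_3;b_1,b_2;c_1,c_2;z_1,z_2,z_3)=\sum_{m_1,m_2,m_3\ge 0}\ \prod_{j=1}^3\frac{(a_j)_{m_j}z_j^{m_j}}{m_j!}\cdot\frac{(b_1)_{m_1+m_3}(b_2)_{m_2}}{(c_1)_{m_1}(c_2)_{m_2+m_3}}$$ be the Lauricella--Saran function, write $\theta_j=z_j\partial/\partial z_j$, and let $$\begin{aligned}L_1&=\theta_1(\theta_1+c_1-1)-z_1(\theta_1+a_1)(\theta_1+\theta_3+b_1),\\ L_2&=\theta_2(\theta_2+\theta_3+c_2-1)-z_2(\theta_2+a_2)(\theta_2+b_2),\\ L_3&=\theta_3(\theta_2+\theta_3+c_2-1)-z_3(\theta_3+a_3)(\theta_1+\theta_3+b_1)\end{aligned}$$ be the operators of its Horn system. (0) If neither $c_1$ nor $c_2$ is a non-positive integer, the series converges absolutely near $z=0$ to a holomorphic function, and $L_1F_N=L_2F_N=L_3F_N=0$ near $z=0$. (1) For generic parameters (all parameters outside some proper algebraic subset of $\mathbb C^7$) the system $L_1f=L_2f=L_3f=0$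 has holonomic rank $8$: the quotient of the rational Weyl algebra $\mathbb C(z_1,z_2,z_3)\langle\partial_1,\partial_2,\partial_3\rangle$ by the left ideal generated by $L_1,L_2,L_3$ has dimension $8$ over $\mathbb C(z_1,z_2,z_3)$; moreover there is a nonzero polynomial $D(z)$, which may depend on the parameters, such that at every point $p$ with $D(p)\ne 0$ the complex vector space of germs at $p$ of holomorphic solutions of the system has dimension $8$. (2) For generic parameters (there is a finite set of nonzero linear forms on $\mathbb C^7$ with integer coefficients such that the following holds whenever none of these forms takes an integer value at the parameter vector $J=(a_1,a_2,a_3,b_1,b_2,c_1,c_2)$) and for every $m\in\mathbb Z^7$ there are polynomials $S\neq 0$, $S_0$, $S_i$, $S_{ij}$, $S_{123}$ in $z$ such that, for all $z$ near $0$, $$S\,F_N(J+m;z)=\Big[S_0+\sum_{i=1}^3 S_i\theta_i+\sum_{1\le i<j\le 3}S_{ij}\theta_i\theta_j+S_{123}\theta_1\theta_2\theta_3\Big]F_N(J;z).$$ -/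

import Mathlib

/-! ### Parameters -/

/-- Names of the seven parameters of `F_N(a₁,a₂,a₃;b₁,b₂;c₁,c₂;z₁,z₂,z₃)`. -/
inductive Par : Type
  | a₁ | a₂ | a₃ | b₁ | b₂ | c₁ | c₂
  deriving DecidableEq

instance : Fintype Par where
  elems := {.a₁, .a₂, .a₃, .b₁, .b₂, .c₁, .c₂}
  complete x := by cases x <;> decide

/-! ### The function `F_N` and the Horn system acting on functions

The variables `z₁, z₂, z₃` are the coordinates `z 0, z 1, z 2` of `z : Fin 3 → ℂ`. -/

/-- The Pochhammer symbol `(x)_n = x (x+1) ⋯ (x+n-1)`. -/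
noncomputable def poch (x : ℂ) (n : ℕ) : ℂ := (ascPochhammer ℂ n).eval x

/-- The general term of the Lauricella–Saran series. -/
noncomputable def lauricellaFNTerm (J : Par → ℂ) (z : Fin 3 → ℂ) (m : Fin 3 → ℕ) : ℂ :=
  (poch (J .a₁) (m 0) * (z 0 ^ m 0 / (m 0).factorial)) *
  (poch (J .a₂) (m 1) * (z 1 ^ m 1 / (m 1).factorial)) *
  (poch (J .a₃) (m 2) * (z 2 ^ m 2 / (m 2).factorial)) *
  (poch (J .b₁) (m 0 + m 2) * poch (J .b₂) (m 1) /
    (poch (J .c₁) (m 0) * poch (J .c₂) (m 1 + m 2)))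

/-- The Lauricella–Saran function `F_N` with parameters `J`, near the origin. -/
noncomputable def lauricellaFN (J : Par → ℂ) (z : Fin 3 → ℂ) : ℂ :=
  ∑' m : Fin 3 → ℕ, lauricellaFNTerm J z m

/-- The first order operator `f ↦ (c + ∑_{j ∈ s} θ_j) f`, where `θ_j = z_j ∂/∂z_j`. -/
noncomputable def eulerOp (s : Finset (Fin 3)) (c : ℂ) (f : (Fin 3 → ℂ) → ℂ) :
    (Fin 3 → ℂ) → ℂ :=
  fun z => c * f z + ∑ j ∈ s, z j * fderiv ℂ f z (Pi.single j 1)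

/-- `θ_j = z_j ∂/∂z_j` on functions. -/
noncomputable def thetaOp (j : Fin 3) (f : (Fin 3 → ℂ) → ℂ) : (Fin 3 → ℂ) → ℂ :=
  fun z => z j * fderiv ℂ f z (Pi.single j 1)

/-- The three Horn operators of `F_N`, acting on functions:
`θ₁(θ₁+c₁-1) - z₁(θ₁+a₁)(θ₁+θ₃+b₁)`,
`θ₂(θ₂+θ₃+c₂-1) - z₂(θ₂+a₂)(θ₂+b₂)`,
`θ₃(θ₂+θ₃+c₂-1) - z₃(θ₃+a₃)(θ₁+θ₃+b₁)`. -/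
noncomputable def hornOp (J : Par → ℂ) (j : Fin 3) (f : (Fin 3 → ℂ) → ℂ) :
    (Fin 3 → ℂ) → ℂ :=
  ![fun z => eulerOp {0} 0 (eulerOp {0} (J .c₁ - 1) f) z
      - z 0 * eulerOp {0} (J .a₁) (eulerOp {0, 2} (J .b₁) f) z,
    fun z => eulerOp {1} 0 (eulerOp {1, 2} (J .c₂ - 1) f) z
      - z 1 * eulerOp {1} (J .a₂) (eulerOp {1} (J .b₂) f) z,
    fun z => eulerOp {2} 0 (eulerOp {1, 2} (J .c₂ - 1) f) z
      - z 2 * eulerOp {2} (J .a₃) (eulerOp {0, 2} (J .b₁) f) z] j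

/-! Linearity of these operators on functions analytic at a point. -/

theorem analyticAt_eulerOp {s : Finset (Fin 3)} {c : ℂ} {f : (Fin 3 → ℂ) → ℂ}
    {p : Fin 3 → ℂ} (hf : AnalyticAt ℂ f p) : AnalyticAt ℂ (eulerOp s c f) p := by
  unfold eulerOp
  refine (analyticAt_const.mul hf).add ?_
  refine Finset.analyticAt_fun_sum s fun j _ => ?_
  refine AnalyticAt.mul ?_ ?_
  · exact (ContinuousLinearMap.proj (R := ℂ) (φ := fun _ : Fin 3 => ℂ) j).analyticAt p
  · exact ((ContinuousLinearMap.apply ℂ ℂ (Pi.single j (1 : ℂ) : Fin 3 → ℂ)).analyticAt _).comp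
      hf.fderiv

open Filter Topology in
theorem eulerOp_congr {s : Finset (Fin 3)} {c : ℂ} {f g : (Fin 3 → ℂ) → ℂ}
    {p : Fin 3 → ℂ} (h : f =ᶠ[𝓝 p] g) : eulerOp s c f =ᶠ[𝓝 p] eulerOp s c g := by
  filter_upwards [h, h.fderiv (𝕜 := ℂ)] with z h1 h2
  simp [eulerOp, h1, h2]

open Filter Topology in
theorem eulerOp_lin {s : Finset (Fin 3)} {c : ℂ} {f g : (Fin 3 → ℂ) → ℂ}
    {p : Fin 3 → ℂ} (r : ℂ) (hf : AnalyticAt ℂ f p) (hg : AnalyticAt ℂ g p) :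
    eulerOp s c (f + r • g) =ᶠ[𝓝 p] eulerOp s c f + r • eulerOp s c g := by
  filter_upwards [hf.eventually_analyticAt, hg.eventually_analyticAt] with z h1 h2
  have h3 := h1.differentiableAt
  have h4 := h2.differentiableAt
  simp only [eulerOp, Pi.add_apply, Pi.smul_apply, smul_eq_mul]
  rw [fderiv_add h3 (h4.const_smul r), fderiv_const_smul h4 r]
  simp only [add_apply, smul_apply, smul_eq_mul,
    mul_add, Finset.sum_add_distrib, Finset.mul_sum]
  have : ∀ x ∈ s, z x * (r * fderiv ℂ g z (Pi.single x 1))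
      = r * (z x * fderiv ℂ g z (Pi.single x 1)) := fun x _ => by ring
  rw [Finset.sum_congr rfl this]
  ring

open Filter Topology in
theorem eulerOp_lin₂ {s t : Finset (Fin 3)} {c d : ℂ} {f g : (Fin 3 → ℂ) → ℂ}
    {p : Fin 3 → ℂ} (r : ℂ) (hf : AnalyticAt ℂ f p) (hg : AnalyticAt ℂ g p) :
    eulerOp t d (eulerOp s c (f + r • g)) =ᶠ[𝓝 p]
      eulerOp t d (eulerOp s c f) + r • eulerOp t d (eulerOp s c g) :=
  (eulerOp_congr (eulerOp_lin r hf hg)).trans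
    (eulerOp_lin r (analyticAt_eulerOp hf) (analyticAt_eulerOp hg))

open Filter Topology in
theorem hornOp_lin {J : Par → ℂ} {j : Fin 3} {f g : (Fin 3 → ℂ) → ℂ}
    {p : Fin 3 → ℂ} (r : ℂ) (hf : AnalyticAt ℂ f p) (hg : AnalyticAt ℂ g p) :
    hornOp J j (f + r • g) =ᶠ[𝓝 p] hornOp J j f + r • hornOp J j g := by
  fin_cases j
  · filter_upwards [eulerOp_lin₂ (s := {0}) (t := {0}) (c := J .c₁ - 1) (d := 0) r hf hg,
      eulerOp_lin₂ (s := {0, 2}) (t := {0}) (c := J .b₁) (d := J .a₁) r hf hg] with z h1 h2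
    simp only [Pi.add_apply, Pi.smul_apply, smul_eq_mul] at h1 h2
    simp [hornOp, h1, h2]
    ring
  · filter_upwards [eulerOp_lin₂ (s := {1, 2}) (t := {1}) (c := J .c₂ - 1) (d := 0) r hf hg,
      eulerOp_lin₂ (s := {1}) (t := {1}) (c := J .b₂) (d := J .a₂) r hf hg] with z h1 h2
    simp only [Pi.add_apply, Pi.smul_apply, smul_eq_mul] at h1 h2
    simp [hornOp, h1, h2]
    ring
  · filter_upwards [eulerOp_lin₂ (s := {1, 2}) (t := {2}) (c := J .c₂ - 1) (d := 0) r hf hg,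
      eulerOp_lin₂ (s := {0, 2}) (t := {2}) (c := J .b₁) (d := J .a₃) r hf hg] with z h1 h2
    simp only [Pi.add_apply, Pi.smul_apply, smul_eq_mul] at h1 h2
    simp [hornOp, h1, h2]
    ring

open Filter Topology in
/-- `f` is a holomorphic solution of the Horn system near `p`. -/
def IsLocalSolution (J : Par → ℂ) (p : Fin 3 → ℂ) (f : (Fin 3 → ℂ) → ℂ) : Prop :=
  AnalyticAt ℂ f p ∧ ∀ j : Fin 3, ∀ᶠ z in 𝓝 p, hornOp J j f z = 0

open Filter Topology in
theorem IsLocalSolution.lin {J : Par → ℂ} {p : Fin 3 → ℂ} {f g : (Fin 3 → ℂ) → ℂ} (r : ℂ)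
    (hf : IsLocalSolution J p f) (hg : IsLocalSolution J p g) :
    IsLocalSolution J p (f + r • g) := by
  refine ⟨hf.1.add (analyticAt_const.smul hg.1), fun j => ?_⟩
  filter_upwards [hornOp_lin (J := J) (j := j) r hf.1 hg.1, hf.2 j, hg.2 j] with z h1 h2 h3
  simp [h1, h2, h3]

open Topology in
theorem IsLocalSolution.zero (J : Par → ℂ) (p : Fin 3 → ℂ) :
    IsLocalSolution J p 0 := by
  refine ⟨analyticAt_const, fun j => ?_⟩
  have h := hornOp_lin (J := J) (j := j) (p := p) (f := 0) (g := 0) (-1)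
    analyticAt_const analyticAt_const
  filter_upwards [h] with z hz
  simpa using hz

open Topology in
/-- The space of germs at `p` of holomorphic solutions of the Horn system of `F_N`. -/
def solutionGerms (J : Par → ℂ) (p : Fin 3 → ℂ) : Submodule ℂ (Filter.Germ (𝓝 p) ℂ) where
  carrier := {φ | ∃ f : (Fin 3 → ℂ) → ℂ, IsLocalSolution J p f ∧ (f : Filter.Germ (𝓝 p) ℂ) = φ}
  zero_mem' := ⟨0, IsLocalSolution.zero J p, rfl⟩
  add_mem' := by
    rintro _ _ ⟨f, hf, rfl⟩ ⟨g, hg, rfl⟩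
    refine ⟨f + g, ?_, rfl⟩
    simpa using hf.lin 1 hg
  smul_mem' := by
    rintro r _ ⟨f, hf, rfl⟩
    refine ⟨r • f, ?_, rfl⟩
    simpa using (IsLocalSolution.zero J p).lin r hf

/-! ### The rational Weyl algebra `ℂ(z₁,z₂,z₃)⟨∂₁,∂₂,∂₃⟩` -/

/-- The field `ℂ(z₁,z₂,z₃)` of rational functions. -/
abbrev RatFun₃ : Type := FractionRing (MvPolynomial (Fin 3) ℂ)

/-- The free algebra on the rational functions and the three symbols `∂_i`. -/
abbrev PreWeyl : Type := FreeAlgebra ℂ (RatFun₃ ⊕ Fin 3)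

/-- The relations of the rational Weyl algebra: those of the field `ℂ(z)`, the commutation of the
`∂_i`, and `∂_i p = p ∂_i + ∂p/∂z_i` for polynomials `p`. (The rule for quotients
follows from the one for polynomials, as every nonzero polynomial is invertible.) -/
inductive WeylRel : PreWeyl → PreWeyl → Prop
  | const (c : ℂ) :
      WeylRel (FreeAlgebra.ι ℂ (Sum.inl (algebraMap ℂ RatFun₃ c))) (algebraMap ℂ PreWeyl c)
  | add (f g : RatFun₃) :
      WeylRel (FreeAlgebra.ι ℂ (Sum.inl (f + g)))
        (FreeAlgebra.ι ℂ (Sum.inl f) + FreeAlgebra.ι ℂ (Sum.inl g))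
  | mul (f g : RatFun₃) :
      WeylRel (FreeAlgebra.ι ℂ (Sum.inl (f * g)))
        (FreeAlgebra.ι ℂ (Sum.inl f) * FreeAlgebra.ι ℂ (Sum.inl g))
  | comm (i j : Fin 3) :
      WeylRel (FreeAlgebra.ι ℂ (Sum.inr i) * FreeAlgebra.ι ℂ (Sum.inr j))
        (FreeAlgebra.ι ℂ (Sum.inr j) * FreeAlgebra.ι ℂ (Sum.inr i))
  | leibniz (i : Fin 3) (p : MvPolynomial (Fin 3) ℂ) :
      WeylRel
        (FreeAlgebra.ι ℂ (Sum.inr i) *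
          FreeAlgebra.ι ℂ (Sum.inl (algebraMap (MvPolynomial (Fin 3) ℂ) RatFun₃ p)))
        (FreeAlgebra.ι ℂ (Sum.inl (algebraMap (MvPolynomial (Fin 3) ℂ) RatFun₃ p)) *
            FreeAlgebra.ι ℂ (Sum.inr i) +
          FreeAlgebra.ι ℂ (Sum.inl
            (algebraMap (MvPolynomial (Fin 3) ℂ) RatFun₃ (MvPolynomial.pderiv i p))))

/-- The rational Weyl algebra in three variables. -/
abbrev RatWeyl : Type := RingQuot WeylRel

namespace RatWeyl

/-- The class of a noncommutative polynomial in the rational Weyl algebra. -/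
noncomputable def mk : PreWeyl →ₐ[ℂ] RatWeyl := RingQuot.mkAlgHom ℂ WeylRel

/-- The inclusion of the rational functions. -/
noncomputable def ofRat : RatFun₃ →+* RatWeyl where
  toFun f := mk (FreeAlgebra.ι ℂ (Sum.inl f))
  map_one' := by
    have h := RingQuot.mkAlgHom_rel ℂ (WeylRel.const 1)
    rw [map_one, map_one] at h
    exact h.trans (map_one _)
  map_zero' := by
    have h := RingQuot.mkAlgHom_rel ℂ (WeylRel.const 0)
    rw [map_zero, map_zero] at h
    exact h.trans (map_zero _)
  map_mul' f g := (RingQuot.mkAlgHom_rel ℂ (WeylRel.mul f g)).trans (map_mul _ _ _)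
  map_add' f g := (RingQuot.mkAlgHom_rel ℂ (WeylRel.add f g)).trans (map_add _ _ _)

/-- The generator `∂_i`. -/
noncomputable def del (i : Fin 3) : RatWeyl := mk (FreeAlgebra.ι ℂ (Sum.inr i))

/-- The variable `z_i`. -/
noncomputable def var (i : Fin 3) : RatWeyl :=
  ofRat (algebraMap (MvPolynomial (Fin 3) ℂ) RatFun₃ (MvPolynomial.X i))

/-- `c + ∑_{j ∈ s} θ_j` with `θ_j = z_j ∂_j`. -/
noncomputable def euler (s : Finset (Fin 3)) (c : ℂ) : RatWeyl :=
  algebraMap ℂ RatWeyl c + ∑ j ∈ s, var j * del j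

/-- The three Horn operators of `F_N` as elements of the rational Weyl algebra. -/
noncomputable def horn (J : Par → ℂ) : Fin 3 → RatWeyl :=
  ![euler {0} 0 * euler {0} (J .c₁ - 1)
      - var 0 * (euler {0} (J .a₁) * euler {0, 2} (J .b₁)),
    euler {1} 0 * euler {1, 2} (J .c₂ - 1)
      - var 1 * (euler {1} (J .a₂) * euler {1} (J .b₂)),
    euler {2} 0 * euler {1, 2} (J .c₂ - 1)
      - var 2 * (euler {2} (J .a₃) * euler {0, 2} (J .b₁))]

end RatWeyl

/-- The left ideal generated by the three Horn operators of `F_N`. -/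
noncomputable def hornIdeal (J : Par → ℂ) : Submodule RatWeyl RatWeyl :=
  Submodule.span RatWeyl (Set.range (RatWeyl.horn J))

/-- The quotient of the rational Weyl algebra by the left ideal of the Horn system. -/
abbrev HornModule (J : Par → ℂ) : Type := RatWeyl ⧸ hornIdeal J

/-- `ℂ(z)` acts on the quotient by left multiplication. -/
noncomputable instance instModuleHornModule (J : Par → ℂ) : Module RatFun₃ (HornModule J) :=
  Module.compHom (HornModule J) RatWeyl.ofRat

/-- The holonomic rank of the Horn system of `F_N`: the dimension over `ℂ(z)` of the quotient of
the rational Weyl algebra by the left ideal of the system. -/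
noncomputable def holonomicRank (J : Par → ℂ) : Cardinal :=
  Module.rank RatFun₃ (HornModule J)

/-!
The whole proof takes place on modules over `ℂ[z]` with commuting operators `θ₁, θ₂, θ₃` that
extend the Euler derivations (`EulerAction`), so that it applies at once to the rational Weyl
algebra, to power series and to two-sided Laurent series.

The quadratic principal symbols of the Horn operators form a regular sequence over `ℂ(z)`. Hence,
for every solution `u`, all derivatives of `u` reduce to the eight squarefree monomials `θ^K u`,
with coefficients that are polynomial in `z` and the parameters, up to a denominator that does not
involve the parameters (`Reducible.θ_mono`). This gives connection matrices (`exists_connection`),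
which a priori need not be integrable. The squarefree monomials are in fact free: for parameters
with generic imaginary parts the Horn system has eight formal solutions `z^e ∑ Φ(e+u) z^u`, given
by gamma series with linearly independent leading behaviour, and a relation `∑ r_K θ^K = 0` would
contradict the position of the eight exponents (`eq_zero_of_generic`). As such parameters are
Zariski dense, every relation that is polynomial in the parameters is trivial
(`polyFam_eq_zero_of_sum_mono`). Integrability of the connection and the Horn equations for its
first basis vector are relations of this kind, so they hold for all parameters, and the connection
makes `B⁸` into a module with Euler operators for every suitable `ℂ[z]`-algebra `B`
(`EulerRing.conn`, `EulerRing.conn_isSol`).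

With `B = ℂ(z)` one obtains a module over the rational Weyl algebra, a quotient of the module of
the Horn system, on which the eight generators are independent; thus the holonomic rank is `8`
(`holonomicRank_eq`). With `B = ℂ[[z-p]]`, where `p` avoids the zeros of the denominator and the
coordinate planes, the Taylor map turns functionals on the fibre of the connection at `p` into
formal solutions with arbitrary values of the eight monomials at `p` (`exists_formal_solution`).
Formal solutions satisfy a first order system that is regular at `p`, so they converge and are
determined by these values (`exists_norm_coeff_le_of_system`), and the space of solution germs has
dimension `8` (`rank_solutionGerms`).

The series `F_N` converges because its coefficients grow at most geometrically, and it solves the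
Horn system because of the two-term recurrences of its coefficients (`isSol_fnSeries`).

For the contiguity relations, each parameter shift of `F_N` by one is related to `F_N` by a first
order operator such as `θ₁ + a₁` or `θ₁ + c₁ - 1`. One direction of the relation is then clear.
For the other, one has to see that `F_N(J)` lies in the `ℂ(z)`-span of the derivatives of its
image under such an operator. In the quotient of the power series by (the saturation of) this
span, the class of `F_N(J)` is a solution killed by the operator, and the quotient is
torsion-free. In a torsion-free module multiplication by `z_i` is injective, so for each Horn
equation one of its two sides annihilates a solution if and only if the other does; combining
these statements, a solution killed by a contiguity operator is zero unless a linear form in the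
parameters takes an integral value (`EulerAction.IsSol.eq_zero_of_contiguity`). Hence the span
does not change under integral shifts (`satSpan_fnSeries_add`).
-/

section Algebra

open MvPolynomial

/-! ### Modules with commuting Euler operators -/

/-- The polynomial ring `ℂ[z₁,z₂,z₃]`. -/
abbrev Poly₃ : Type := MvPolynomial (Fin 3) ℂ

/-- The derivation `θ_i = z_i ∂/∂z_i` of the polynomial ring. -/
noncomputable def eulerDer (i : Fin 3) : Derivation ℂ Poly₃ Poly₃ := (X i : Poly₃) • pderiv i

theorem eulerDer_apply (i : Fin 3) (p : Poly₃) : eulerDer i p = X i * pderiv i p := rfl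

@[simp] theorem eulerDer_C (i : Fin 3) (c : ℂ) : eulerDer i (C c) = 0 :=
  (eulerDer i).map_algebraMap c

theorem eulerDer_X (i j : Fin 3) : eulerDer i (X j) = if i = j then X i else 0 := by
  by_cases h : i = j
  · subst h; simp [eulerDer_apply]
  · simp [eulerDer_apply, pderiv_X_of_ne (Ne.symm h), h]

/-- Commuting additive operators `θ₁, θ₂, θ₃` on a `ℂ[z]`-module that satisfy the Leibniz rule
with respect to the Euler derivations. The rational Weyl algebra modulo the Horn ideal, formal
power series at a point, two-sided Laurent series and flat connections over `ℂ(z)` are all of this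
kind. Statements about the Horn system are proved once in this generality. -/
structure EulerAction (M : Type) [AddCommGroup M] [Module Poly₃ M] where
  /-- The operator `θ_i`. -/
  θ : Fin 3 → M →+ M
  leib : ∀ (i : Fin 3) (p : Poly₃) (m : M), θ i (p • m) = p • θ i m + eulerDer i p • m
  comm : ∀ (i j : Fin 3) (m : M), θ i (θ j m) = θ j (θ i m)

namespace EulerAction

variable {M : Type} [AddCommGroup M] [Module Poly₃ M] (T : EulerAction M)

/-- The operator `c + ∑_{j ∈ s} θ_j`. -/
noncomputable def lin (s : Finset (Fin 3)) (c : ℂ) (m : M) : M :=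
  (C c : Poly₃) • m + ∑ j ∈ s, T.θ j m

/-- The three Horn operators of `F_N` on a module with Euler operators. -/
noncomputable def horn (J : Par → ℂ) (m : M) : Fin 3 → M :=
  ![T.lin {0} 0 (T.lin {0} (J .c₁ - 1) m)
      - (X 0 : Poly₃) • T.lin {0} (J .a₁) (T.lin {0, 2} (J .b₁) m),
    T.lin {1} 0 (T.lin {1, 2} (J .c₂ - 1) m)
      - (X 1 : Poly₃) • T.lin {1} (J .a₂) (T.lin {1} (J .b₂) m),
    T.lin {2} 0 (T.lin {1, 2} (J .c₂ - 1) m)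
      - (X 2 : Poly₃) • T.lin {2} (J .a₃) (T.lin {0, 2} (J .b₁) m)]

/-- The vector `m` is annihilated by the Horn operators. -/
def IsSol (J : Par → ℂ) (m : M) : Prop := ∀ j, T.horn J m j = 0

theorem θ_C (i : Fin 3) (c : ℂ) (m : M) :
    T.θ i ((C c : Poly₃) • m) = (C c : Poly₃) • T.θ i m := by
  rw [T.leib, eulerDer_C, zero_smul, add_zero]

theorem θ_X_of_ne {i j : Fin 3} (h : i ≠ j) (m : M) :
    T.θ i ((X j : Poly₃) • m) = (X j : Poly₃) • T.θ i m := by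
  rw [T.leib, eulerDer_X, if_neg h, zero_smul, add_zero]

theorem horn_zero (J : Par → ℂ) (m : M) : T.horn J m 0 =
    T.θ 0 (T.θ 0 m) + (C (J .c₁) - 1 : Poly₃) • T.θ 0 m - (X 0 : Poly₃) •
      (T.θ 0 (T.θ 0 m) + T.θ 0 (T.θ 2 m) + (C (J .a₁) + C (J .b₁) : Poly₃) • T.θ 0 m
        + (C (J .a₁) : Poly₃) • T.θ 2 m + (C (J .a₁) * C (J .b₁) : Poly₃) • m) := by
  simp only [horn, lin, Matrix.cons_val_zero, Finset.sum_singleton, Finset.sum_pair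
    (show (0 : Fin 3) ≠ 2 by decide), map_add, T.θ_C]
  simp only [C_sub, C_1, C_0]
  module

theorem horn_one (J : Par → ℂ) (m : M) : T.horn J m 1 =
    T.θ 1 (T.θ 1 m) + T.θ 1 (T.θ 2 m) + (C (J .c₂) - 1 : Poly₃) • T.θ 1 m - (X 1 : Poly₃) •
      (T.θ 1 (T.θ 1 m) + (C (J .a₂) + C (J .b₂) : Poly₃) • T.θ 1 m
        + (C (J .a₂) * C (J .b₂) : Poly₃) • m) := by
  simp only [horn, lin, Matrix.cons_val_one, Matrix.cons_val_zero, Finset.sum_singleton,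
    Finset.sum_pair (show (1 : Fin 3) ≠ 2 by decide), map_add, T.θ_C]
  simp only [C_sub, C_1, C_0]
  module

theorem horn_two (J : Par → ℂ) (m : M) : T.horn J m 2 =
    T.θ 2 (T.θ 2 m) + T.θ 1 (T.θ 2 m) + (C (J .c₂) - 1 : Poly₃) • T.θ 2 m - (X 2 : Poly₃) •
      (T.θ 2 (T.θ 2 m) + T.θ 0 (T.θ 2 m) + (C (J .a₃) + C (J .b₁) : Poly₃) • T.θ 2 m
        + (C (J .a₃) : Poly₃) • T.θ 0 m + (C (J .a₃) * C (J .b₁) : Poly₃) • m) := by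
  simp only [horn, lin, Matrix.cons_val_two, Matrix.tail_cons, Matrix.head_cons,
    Finset.sum_singleton, Finset.sum_pair (show (1 : Fin 3) ≠ 2 by decide),
    Finset.sum_pair (show (0 : Fin 3) ≠ 2 by decide), map_add, T.θ_C,
    T.comm 2 1, T.comm 2 0]
  simp only [C_sub, C_1, C_0]
  module

/-- The operators `L_i` and `θ_j` commute for `i ≠ j`. -/
theorem horn_θ_of_ne (J : Par → ℂ) {i j : Fin 3} (h : j ≠ i) (m : M) :
    T.horn J (T.θ j m) i = T.θ j (T.horn J m i) := by
  have hC : ∀ (k : Fin 3) (a b : ℂ) (m : M), T.θ k ((C a * C b : Poly₃) • m)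
      = (C a * C b : Poly₃) • T.θ k m := fun k a b m => by rw [← C_mul, T.θ_C]
  have hA : ∀ (k : Fin 3) (a b : ℂ) (m : M), T.θ k ((C a + C b : Poly₃) • m)
      = (C a + C b : Poly₃) • T.θ k m := fun k a b m => by rw [← C_add, T.θ_C]
  have hS : ∀ (k : Fin 3) (a : ℂ) (m : M), T.θ k ((C a - 1 : Poly₃) • m)
      = (C a - 1 : Poly₃) • T.θ k m := fun k a m => by
    rw [← C_1, ← C_sub, T.θ_C]
  fin_cases i
  · change j ≠ 0 at h
    simp only [Fin.zero_eta, horn_zero, map_add, map_sub, T.θ_X_of_ne h, T.θ_C, hC, hA, hS,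
      T.comm j]
  · change j ≠ 1 at h
    simp only [Fin.mk_one, horn_one, map_add, map_sub, T.θ_X_of_ne h, hC, hA, hS,
      T.comm j]
  · change j ≠ 2 at h
    simp only [Fin.reduceFinMk, horn_two, map_add, map_sub, T.θ_X_of_ne h, T.θ_C, hC, hA, hS,
      T.comm j]

end EulerAction

/-- Index set of the eight monomials `θ₁^{k₁}θ₂^{k₂}θ₃^{k₃}`, `k_i ∈ {0,1}`. -/
abbrev Idx : Type := Bool × Bool × Bool

/-- The `i`-th exponent of a squarefree monomial. -/
def Idx.get (K : Idx) : Fin 3 → Bool := ![K.1, K.2.1, K.2.2]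

/-- Multiplication of a squarefree monomial by `θ_i`, for monomials not yet containing `θ_i`. -/
def Idx.ins (K : Idx) : Fin 3 → Idx :=
  ![(true, K.2.1, K.2.2), (K.1, true, K.2.2), (K.1, K.2.1, true)]

namespace EulerAction

variable {M : Type} [AddCommGroup M] [Module Poly₃ M] (T : EulerAction M)

/-- The squarefree monomial `θ^K` applied to `m`. -/
def mono (K : Idx) (m : M) : M :=
  let m₂ := bif K.2.2 then T.θ 2 m else m
  let m₁ := bif K.2.1 then T.θ 1 m₂ else m₂
  bif K.1 then T.θ 0 m₁ else m₁

theorem θ_mono_of_get_eq_false (i : Fin 3) (K : Idx) (h : K.get i = false) (m : M) :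
    T.θ i (T.mono K m) = T.mono (K.ins i) m := by
  obtain ⟨a, b, c⟩ := K
  fin_cases i <;> cases a <;> cases b <;> cases c <;>
    simp_all [mono, Idx.get, Idx.ins, T.comm 1 0, T.comm 2 0, T.comm 2 1]

theorem mono_add (K : Idx) (m n : M) : T.mono K (m + n) = T.mono K m + T.mono K n := by
  obtain ⟨a, b, c⟩ := K
  cases a <;> cases b <;> cases c <;> simp [mono]

theorem mono_C (K : Idx) (c : ℂ) (m : M) :
    T.mono K ((C c : Poly₃) • m) = (C c : Poly₃) • T.mono K m := by
  obtain ⟨a, b, c⟩ := K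
  cases a <;> cases b <;> cases c <;> simp [mono, T.θ_C]

end EulerAction

/-! ### Families depending polynomially on the parameters -/

/-- The families `(p_J)` of polynomials in `z` that depend polynomially on the parameters `J`. -/
noncomputable def polyFam : Subalgebra Poly₃ ((Par → ℂ) → Poly₃) :=
  (aeval (R := Poly₃) (fun (i : Par) (J : Par → ℂ) => (C (J i) : Poly₃))).range

theorem const_mem_polyFam (p : Poly₃) : (fun _ => p) ∈ polyFam :=
  polyFam.algebraMap_mem p

theorem par_mem_polyFam (i : Par) : (fun J : Par → ℂ => (C (J i) : Poly₃)) ∈ polyFam :=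
  ⟨X i, by simp⟩

theorem eulerDer_mem_polyFam (i : Fin 3) {f : (Par → ℂ) → Poly₃} (hf : f ∈ polyFam) :
    (fun J => eulerDer i (f J)) ∈ polyFam := by
  obtain ⟨P, rfl⟩ := hf
  simp only [AlgHom.toRingHom_eq_coe, RingHom.coe_coe]
  induction P using MvPolynomial.induction_on with
  | C a => simpa using const_mem_polyFam (eulerDer i a)
  | add p q hp hq => simp only [map_add, Pi.add_apply]; exact polyFam.add_mem hp hq
  | mul_X p j hp => 
    simp only [map_mul, aeval_X, Pi.mul_apply, Derivation.leibniz, eulerDer_C, smul_eq_mul,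
      mul_zero, zero_add]
    exact polyFam.mul_mem (par_mem_polyFam j) hp

/-! ### Reduction to the eight squarefree monomials -/

/-- A vector attached functorially to every parameter vector `J` and every vector `u` of every
module with Euler operators. -/
abbrev VectorFamily : Type 1 :=
  (J : Par → ℂ) → (M : Type) → [AddCommGroup M] → [Module Poly₃ M] → EulerAction M → M → M

/-- The product of the determinants that are inverted when the Horn system is solved for the
monomials `θ_i θ^K` that are not squarefree. -/
noncomputable def discr : Poly₃ :=
  (1 - X 0) * (1 - X 1) * (1 - X 2) * ((1 - X 0) * (1 - X 2) - X 0 * X 2)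
    * ((1 - X 1) * (1 - X 2) - 1)
    * ((1 - X 0) * (1 - X 1) * (1 - X 2) - X 0 * X 2 * (1 - X 1) - (1 - X 0))

/-- For solutions `u` of the Horn system, the vector `w(u)` is, up to a power of `discr`,
a combination of the squarefree monomials `θ^K u`, with coefficients that are polynomial in `z`
and in the parameters and that do not depend on the module. -/
def Reducible (w : VectorFamily) : Prop :=
  ∃ (n : ℕ) (c : Idx → (Par → ℂ) → Poly₃), (∀ K, c K ∈ polyFam) ∧
    ∀ (J : Par → ℂ) (M : Type) [AddCommGroup M] [Module Poly₃ M] (T : EulerAction M) (u : M),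
      T.IsSol J u → discr ^ n • w J M T u = ∑ K, c K J • T.mono K u

namespace Reducible

theorem congr {w w' : VectorFamily} (h : Reducible w)
    (e : ∀ (J : Par → ℂ) (M : Type) [AddCommGroup M] [Module Poly₃ M] (T : EulerAction M) (u : M),
      T.IsSol J u → w J M T u = w' J M T u) : Reducible w' := by
  obtain ⟨n, c, hc, h⟩ := h
  refine ⟨n, c, hc, fun J M _ _ T u hu => ?_⟩
  rw [← e J M T u hu, h J M T u hu]

theorem mono (K : Idx) : Reducible fun _ _ _ _ T u => T.mono K u := by
  classical
  refine ⟨0, fun L _ => if L = K then 1 else 0, fun L => const_mem_polyFam _, ?_⟩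
  intro J M _ _ T u _
  simp [ite_smul]

theorem add {w w' : VectorFamily} (h : Reducible w) (h' : Reducible w') :
    Reducible fun J M _ _ T u => w J M T u + w' J M T u := by
  obtain ⟨n, c, hc, h⟩ := h
  obtain ⟨n', c', hc', h'⟩ := h'
  refine ⟨n + n', fun K J => discr ^ n' * c K J + discr ^ n * c' K J, fun K =>
    polyFam.add_mem (polyFam.mul_mem (const_mem_polyFam _) (hc K))
      (polyFam.mul_mem (const_mem_polyFam _) (hc' K)), fun J M _ _ T u hu => ?_⟩
  simp only [add_smul, Finset.sum_add_distrib, mul_smul, ← Finset.smul_sum, ← h J M T u hu,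
    ← h' J M T u hu, pow_add]
  module

theorem smul {w : VectorFamily} {a : (Par → ℂ) → Poly₃} (ha : a ∈ polyFam) (h : Reducible w) :
    Reducible fun J M _ _ T u => a J • w J M T u := by
  obtain ⟨n, c, hc, h⟩ := h
  refine ⟨n, fun K J => a J * c K J, fun K => polyFam.mul_mem ha (hc K),
    fun J M _ _ T u hu => ?_⟩
  simp only [mul_smul, ← Finset.smul_sum, ← h J M T u hu]
  rw [smul_comm]

theorem smul_const {w : VectorFamily} (p : Poly₃) (h : Reducible w) :
    Reducible fun J M _ _ T u => p • w J M T u :=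
  smul (const_mem_polyFam p) h

theorem of_smul {w : VectorFamily} {s : Poly₃} (hs : s ∣ discr)
    (h : Reducible fun J M _ _ T u => s • w J M T u) : Reducible w := by
  obtain ⟨t, ht⟩ := hs
  obtain ⟨n, c, hc, h⟩ := h
  refine ⟨n + 1, fun K J => t * c K J, fun K => polyFam.mul_mem (const_mem_polyFam t) (hc K),
    fun J M _ _ T u hu => ?_⟩
  have := h J M T u hu
  simp only [mul_smul, ← Finset.smul_sum, ← h J M T u hu]
  rw [pow_succ, ht]
  module

variable {v : VectorFamily}

/-- The equation `L₁ v = 0`, its terms of order at most one being reducible. -/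
theorem horn_zero (hL : ∀ (J : Par → ℂ) (M : Type) [AddCommGroup M] [Module Poly₃ M]
      (T : EulerAction M) (u : M), T.IsSol J u → T.horn J (v J M T u) 0 = 0)
    (h : Reducible v) (h₀ : Reducible fun J M _ _ T u => T.θ 0 (v J M T u))
    (h₂ : Reducible fun J M _ _ T u => T.θ 2 (v J M T u)) :
    Reducible fun J M _ _ T u => (1 - X 0 : Poly₃) • T.θ 0 (T.θ 0 (v J M T u))
      - (X 0 : Poly₃) • T.θ 0 (T.θ 2 (v J M T u)) := by
  refine congr (((h₀.smul (a := fun J => X 0 * (C (J .a₁) + C (J .b₁)) - (C (J .c₁) - 1)) ?_).add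
    (h₂.smul (a := fun J => X 0 * C (J .a₁)) ?_)).add
    (h.smul (a := fun J => X 0 * (C (J .a₁) * C (J .b₁))) ?_)) ?_
  · exact polyFam.sub_mem (polyFam.mul_mem (const_mem_polyFam _) (polyFam.add_mem
      (par_mem_polyFam _) (par_mem_polyFam _))) (polyFam.sub_mem (par_mem_polyFam _)
        (const_mem_polyFam 1))
  · exact polyFam.mul_mem (const_mem_polyFam _) (par_mem_polyFam _)
  · exact polyFam.mul_mem (const_mem_polyFam _) (polyFam.mul_mem
      (par_mem_polyFam _) (par_mem_polyFam _))
  · intro J M _ _ T u hu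
    have := hL J M T u hu
    rw [T.horn_zero] at this
    linear_combination (norm := module) (-1 : Poly₃) • this

/-- The equation `L₂ v = 0`, its terms of order at most one being reducible. -/
theorem horn_one (hL : ∀ (J : Par → ℂ) (M : Type) [AddCommGroup M] [Module Poly₃ M]
      (T : EulerAction M) (u : M), T.IsSol J u → T.horn J (v J M T u) 1 = 0)
    (h : Reducible v) (h₁ : Reducible fun J M _ _ T u => T.θ 1 (v J M T u)) :
    Reducible fun J M _ _ T u => (1 - X 1 : Poly₃) • T.θ 1 (T.θ 1 (v J M T u))
      + T.θ 1 (T.θ 2 (v J M T u)) := by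
  refine congr ((h₁.smul (a := fun J => X 1 * (C (J .a₂) + C (J .b₂)) - (C (J .c₂) - 1)) ?_).add
    (h.smul (a := fun J => X 1 * (C (J .a₂) * C (J .b₂))) ?_)) ?_
  · exact polyFam.sub_mem (polyFam.mul_mem (const_mem_polyFam _) (polyFam.add_mem
      (par_mem_polyFam _) (par_mem_polyFam _))) (polyFam.sub_mem (par_mem_polyFam _)
        (const_mem_polyFam 1))
  · exact polyFam.mul_mem (const_mem_polyFam _) (polyFam.mul_mem
      (par_mem_polyFam _) (par_mem_polyFam _))
  · intro J M _ _ T u hu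
    have := hL J M T u hu
    rw [T.horn_one] at this
    linear_combination (norm := module) (-1 : Poly₃) • this

/-- The equation `L₃ v = 0`, its terms of order at most one being reducible. -/
theorem horn_two (hL : ∀ (J : Par → ℂ) (M : Type) [AddCommGroup M] [Module Poly₃ M]
      (T : EulerAction M) (u : M), T.IsSol J u → T.horn J (v J M T u) 2 = 0)
    (h : Reducible v) (h₀ : Reducible fun J M _ _ T u => T.θ 0 (v J M T u))
    (h₂ : Reducible fun J M _ _ T u => T.θ 2 (v J M T u)) :
    Reducible fun J M _ _ T u => (1 - X 2 : Poly₃) • T.θ 2 (T.θ 2 (v J M T u))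
      + T.θ 1 (T.θ 2 (v J M T u)) - (X 2 : Poly₃) • T.θ 0 (T.θ 2 (v J M T u)) := by
  refine congr (((h₂.smul (a := fun J => X 2 * (C (J .a₃) + C (J .b₁)) - (C (J .c₂) - 1)) ?_).add
    (h₀.smul (a := fun J => X 2 * C (J .a₃)) ?_)).add
    (h.smul (a := fun J => X 2 * (C (J .a₃) * C (J .b₁))) ?_)) ?_
  · exact polyFam.sub_mem (polyFam.mul_mem (const_mem_polyFam _) (polyFam.add_mem
      (par_mem_polyFam _) (par_mem_polyFam _))) (polyFam.sub_mem (par_mem_polyFam _)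
        (const_mem_polyFam 1))
  · exact polyFam.mul_mem (const_mem_polyFam _) (par_mem_polyFam _)
  · exact polyFam.mul_mem (const_mem_polyFam _) (polyFam.mul_mem
      (par_mem_polyFam _) (par_mem_polyFam _))
  · intro J M _ _ T u hu
    have := hL J M T u hu
    rw [T.horn_two] at this
    linear_combination (norm := module) (-1 : Poly₃) • this

end Reducible

namespace Reducible

theorem one_sub_X_zero_dvd_discr : (1 - X 0 : Poly₃) ∣ discr :=
  (((((dvd_mul_right _ _).mul_right _).mul_right _).mul_right _).mul_right _)

theorem one_sub_X_one_dvd_discr : (1 - X 1 : Poly₃) ∣ discr :=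
  (((((dvd_mul_left _ _).mul_right _).mul_right _).mul_right _).mul_right _)

theorem one_sub_X_two_dvd_discr : (1 - X 2 : Poly₃) ∣ discr :=
  ((((dvd_mul_left _ _).mul_right _).mul_right _).mul_right _)

theorem horn_θ {J : Par → ℂ} {M : Type} [AddCommGroup M] [Module Poly₃ M] {T : EulerAction M}
    {u : M} {i : Fin 3} (h : T.horn J u i = 0) (j : Fin 3) (hj : j ≠ i) :
    T.horn J (T.θ j u) i = 0 := by
  rw [T.horn_θ_of_ne J hj, h, map_zero]

/-- Two linear equations for two vectors, with a determinant that divides `discr`. -/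
theorem of_pair {v w : VectorFamily} {a b c d : Poly₃} (hdvd : a * d - b * c ∣ discr)
    (h : Reducible fun J M _ _ T u => a • v J M T u + b • w J M T u)
    (h' : Reducible fun J M _ _ T u => c • v J M T u + d • w J M T u) :
    Reducible v ∧ Reducible w := by
  constructor
  · refine of_smul hdvd (congr ((h.smul_const d).add (h'.smul_const (-b))) ?_)
    intros; module
  · refine of_smul hdvd (congr ((h.smul_const (-c)).add (h'.smul_const a)) ?_)
    intros; module

/-- The eight squarefree monomials span a space stable under the operators `θ_i`: this is the
normal form of the Horn system. The principal symbols `ξ₁((1-z₁)ξ₁-z₁ξ₃)`, `ξ₂((1-z₂)ξ₂+ξ₃)`,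
`ξ₃(ξ₂+(1-z₃)ξ₃-z₃ξ₁)` of the Horn operators form a regular sequence of quadrics over `ℂ(z)`, and
the squarefree monomials are a basis of the quotient by them. -/
theorem θ_mono (i : Fin 3) (K : Idx) : Reducible fun _ _ _ _ T u => T.θ i (T.mono K u) := by
  -- the squarefree monomials
  have m₀ : Reducible fun _ _ _ _ _ u => u := mono (false, false, false)
  have m0 : Reducible fun _ _ _ _ T u => T.θ 0 u := mono (true, false, false)
  have m1 : Reducible fun _ _ _ _ T u => T.θ 1 u := mono (false, true, false)
  have m2 : Reducible fun _ _ _ _ T u => T.θ 2 u := mono (false, false, true)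
  have m01 : Reducible fun _ _ _ _ T u => T.θ 0 (T.θ 1 u) := mono (true, true, false)
  have m02 : Reducible fun _ _ _ _ T u => T.θ 0 (T.θ 2 u) := mono (true, false, true)
  have m12 : Reducible fun _ _ _ _ T u => T.θ 1 (T.θ 2 u) := mono (false, true, true)
  have m012 : Reducible fun _ _ _ _ T u => T.θ 0 (T.θ 1 (T.θ 2 u)) := mono (true, true, true)
  -- second order: each equation is solved for its own square
  have m00 : Reducible fun _ _ _ _ T u => T.θ 0 (T.θ 0 u) := by
    refine of_smul one_sub_X_zero_dvd_discr (congr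
      ((horn_zero (v := fun _ _ _ _ _ u => u) (fun _ _ _ _ _ _ hu => hu 0) m₀ m0 m2).add
        (m02.smul_const (X 0))) ?_)
    intros; module
  have m11 : Reducible fun _ _ _ _ T u => T.θ 1 (T.θ 1 u) := by
    refine of_smul one_sub_X_one_dvd_discr (congr
      ((horn_one (v := fun _ _ _ _ _ u => u) (fun _ _ _ _ _ _ hu => hu 1) m₀ m1).add
        (m12.smul_const (-1))) ?_)
    intros; module
  have m22 : Reducible fun _ _ _ _ T u => T.θ 2 (T.θ 2 u) := by
    refine of_smul one_sub_X_two_dvd_discr (congr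
      (((horn_two (v := fun _ _ _ _ _ u => u) (fun _ _ _ _ _ _ hu => hu 2) m₀ m0 m2).add
        (m12.smul_const (-1))).add (m02.smul_const (X 2))) ?_)
    intros; module
  -- third order: `θ_j L_i` couples `θ_i² θ_j` with `θ_j² θ_i`, except for `{i, j} = {1, 2}`
  have m001 : Reducible fun _ _ _ _ T u => T.θ 0 (T.θ 0 (T.θ 1 u)) := by
    refine of_smul one_sub_X_zero_dvd_discr (congr
      ((horn_zero (v := fun _ _ _ _ T u => T.θ 1 u)
        (fun _ _ _ _ _ _ hu => horn_θ (hu 0) 1 (by decide)) m1 m01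
        (m12.congr fun _ _ _ _ T u _ => T.comm _ _ _)).add (m012.smul_const (X 0))) ?_)
    intro J M _ _ T u _
    rw [T.comm 2 1]
    module
  have m110 : Reducible fun _ _ _ _ T u => T.θ 1 (T.θ 1 (T.θ 0 u)) := by
    refine of_smul one_sub_X_one_dvd_discr (congr
      ((horn_one (v := fun _ _ _ _ T u => T.θ 0 u)
        (fun _ _ _ _ _ _ hu => horn_θ (hu 1) 0 (by decide)) m0
        (m01.congr fun _ _ _ _ T u _ => T.comm _ _ _)).add (m012.smul_const (-1))) ?_)
    intro J M _ _ T u _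
    rw [T.comm 2 0, T.comm 1 0 (T.θ 2 u)]
    module
  obtain ⟨m002, m220⟩ : Reducible (fun _ _ _ _ T u => T.θ 0 (T.θ 0 (T.θ 2 u))) ∧
      Reducible (fun _ _ _ _ T u => T.θ 2 (T.θ 2 (T.θ 0 u))) := by
    refine of_pair (a := 1 - X 0) (b := - X 0) (c := - X 2) (d := 1 - X 2)
      ⟨(1 - X 0) * (1 - X 1) * (1 - X 2) * ((1 - X 1) * (1 - X 2) - 1)
        * ((1 - X 0) * (1 - X 1) * (1 - X 2) - X 0 * X 2 * (1 - X 1) - (1 - X 0)),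
        by rw [discr]; ring⟩
      (congr (horn_zero (v := fun _ _ _ _ T u => T.θ 2 u)
        (fun _ _ _ _ _ _ hu => horn_θ (hu 0) 2 (by decide)) m2 m02 m22) ?_)
      (congr ((horn_two (v := fun _ _ _ _ T u => T.θ 0 u)
        (fun _ _ _ _ _ _ hu => horn_θ (hu 2) 0 (by decide)) m0 m00
        (m02.congr fun _ _ _ _ T u _ => T.comm _ _ _)).add (m012.smul_const (-1))) ?_)
    · intro J M _ _ T u _
      rw [T.comm 2 0 u, T.comm 2 0 (T.θ 2 u)]
      module
    · intro J M _ _ T u _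
      rw [T.comm 2 0 u, T.comm 1 0]
      module
  obtain ⟨m112, m221⟩ : Reducible (fun _ _ _ _ T u => T.θ 1 (T.θ 1 (T.θ 2 u))) ∧
      Reducible (fun _ _ _ _ T u => T.θ 2 (T.θ 2 (T.θ 1 u))) := by
    refine of_pair (a := 1 - X 1) (b := 1) (c := 1) (d := 1 - X 2)
      ⟨(1 - X 0) * (1 - X 1) * (1 - X 2) * ((1 - X 0) * (1 - X 2) - X 0 * X 2)
        * ((1 - X 0) * (1 - X 1) * (1 - X 2) - X 0 * X 2 * (1 - X 1) - (1 - X 0)),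
        by rw [discr]; ring⟩
      (congr (horn_one (v := fun _ _ _ _ T u => T.θ 2 u)
        (fun _ _ _ _ _ _ hu => horn_θ (hu 1) 2 (by decide)) m2 m12) ?_)
      (congr ((horn_two (v := fun _ _ _ _ T u => T.θ 1 u)
        (fun _ _ _ _ _ _ hu => horn_θ (hu 2) 1 (by decide)) m1 m01
        (m12.congr fun _ _ _ _ T u _ => T.comm _ _ _)).add (m012.smul_const (X 2))) ?_)
    · intro J M _ _ T u _
      rw [T.comm 2 1 u, T.comm 2 1 (T.θ 2 u)]
      module
    · intro J M _ _ T u _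
      rw [T.comm 2 1 u]
      module
  -- fourth order: three equations for the three vectors `θ_i θ₁θ₂θ₃ u`
  have e0 : Reducible fun _ _ _ _ T u => (1 - X 0 : Poly₃) • T.θ 0 (T.θ 0 (T.θ 1 (T.θ 2 u)))
      - (X 0 : Poly₃) • T.θ 2 (T.θ 0 (T.θ 1 (T.θ 2 u))) := by
    refine congr (horn_zero (v := fun _ _ _ _ T u => T.θ 1 (T.θ 2 u))
        (fun _ _ _ _ _ _ hu => horn_θ (horn_θ (hu 0) 2 (by decide)) 1 (by decide)) m12 m012
        (m221.congr fun _ _ _ _ T u _ => by rw [T.comm 2 1 u])) ?_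
    intro J M _ _ T u _
    rw [T.comm 2 0]
  have e1 : Reducible fun _ _ _ _ T u => (1 - X 1 : Poly₃) • T.θ 1 (T.θ 0 (T.θ 1 (T.θ 2 u)))
      + T.θ 2 (T.θ 0 (T.θ 1 (T.θ 2 u))) := by
    refine congr (horn_one (v := fun _ _ _ _ T u => T.θ 0 (T.θ 2 u))
        (fun _ _ _ _ _ _ hu => horn_θ (horn_θ (hu 1) 2 (by decide)) 0 (by decide)) m02
        (m012.congr fun _ _ _ _ T u _ => by rw [T.comm 1 0])) ?_
    intro J M _ _ T u _
    rw [T.comm 1 2 (T.θ 0 (T.θ 2 u)), T.comm 1 0 (T.θ 2 u)]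
  have e2 : Reducible fun _ _ _ _ T u => (1 - X 2 : Poly₃) • T.θ 2 (T.θ 0 (T.θ 1 (T.θ 2 u)))
      + T.θ 1 (T.θ 0 (T.θ 1 (T.θ 2 u))) - (X 2 : Poly₃) • T.θ 0 (T.θ 0 (T.θ 1 (T.θ 2 u))) := by
    refine congr (horn_two (v := fun _ _ _ _ T u => T.θ 0 (T.θ 1 u))
        (fun _ _ _ _ _ _ hu => horn_θ (horn_θ (hu 2) 1 (by decide)) 0 (by decide)) m01 m001
        (m012.congr fun _ _ _ _ T u _ => by rw [T.comm 1 2, T.comm 0 2])) ?_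
    intro J M _ _ T u _
    rw [T.comm 2 0 (T.θ 1 u), T.comm 2 1 u]
  have hdet : (1 - X 0) * (1 - X 1) * (1 - X 2) - X 0 * X 2 * (1 - X 1) - (1 - X 0 : Poly₃)
      ∣ discr := dvd_mul_left _ _
  have m2012 : Reducible fun _ _ _ _ T u => T.θ 2 (T.θ 0 (T.θ 1 (T.θ 2 u))) := by
    refine of_smul hdet (congr (((e2.smul_const ((1 - X 0) * (1 - X 1))).add
      (e0.smul_const ((1 - X 1) * X 2))).add (e1.smul_const (-(1 - X 0)))) ?_)
    intros; module
  have m1012 : Reducible fun _ _ _ _ T u => T.θ 1 (T.θ 0 (T.θ 1 (T.θ 2 u))) := by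
    refine of_smul one_sub_X_one_dvd_discr
      (congr (e1.add (m2012.smul_const (-1))) ?_)
    intros; module
  have m0012 : Reducible fun _ _ _ _ T u => T.θ 0 (T.θ 0 (T.θ 1 (T.θ 2 u))) := by
    refine of_smul one_sub_X_zero_dvd_discr
      (congr (e0.add (m2012.smul_const (X 0))) ?_)
    intros; module
  by_cases hK : K.get i = false
  · exact (mono (K.ins i)).congr fun J M _ _ T u _ => (T.θ_mono_of_get_eq_false i K hK u).symm
  · obtain ⟨a, b, c⟩ := K
    fin_cases i <;> cases a <;> cases b <;> cases c <;> simp [Idx.get] at hK <;>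
      simp only [EulerAction.mono, cond_true, cond_false, Fin.zero_eta, Fin.mk_one,
        Fin.reduceFinMk]
    · exact m00
    · exact m002
    · exact m001
    · exact m0012
    · exact m11
    · exact m112
    · exact m110.congr fun _ _ _ _ T u _ => by rw [T.comm 0 1]
    · exact m1012
    · exact m22
    · exact m221.congr fun _ _ _ _ T u _ => by rw [T.comm 2 1]
    · exact m220.congr fun _ _ _ _ T u _ => by rw [T.comm 2 0 u]
    · exact m2012

end Reducible

theorem discr_ne_zero : discr ≠ 0 := by
  intro h
  have := congrArg (eval ![0, 2, 3]) h
  simp [discr] at this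
  norm_num at this

/-- A common denominator `E`, powers of `discr`, and the connection matrices `A_i(J)`, polynomial
in `z` and `J`: one has `E θ_i θ^K u = ∑_L A_i(J)_{K,L} θ^L u` for every solution `u`. Where
`θ_i θ^K` is squarefree the trivial expression is chosen. -/
theorem exists_connection : ∃ (E : Poly₃) (A : Fin 3 → Idx → Idx → (Par → ℂ) → Poly₃), E ≠ 0 ∧
    (∀ i K L, A i K L ∈ polyFam) ∧
    (∀ i K L J, K.get i = false → A i K L J = if L = K.ins i then E else 0) ∧
    ∀ (J : Par → ℂ) (M : Type) [AddCommGroup M] [Module Poly₃ M] (T : EulerAction M) (u : M),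
      T.IsSol J u → ∀ i K, E • T.θ i (T.mono K u) = ∑ L, A i K L J • T.mono L u := by
  choose n c hc h using Reducible.θ_mono
  let N := ∑ i, ∑ K, n i K
  have hN : ∀ i K, n i K ≤ N := fun i K =>
    (Finset.single_le_sum (f := fun K => n i K) (fun _ _ => zero_le) (Finset.mem_univ K)).trans
      (Finset.single_le_sum (f := fun i => ∑ K, n i K) (fun _ _ => zero_le)
        (Finset.mem_univ i))
  refine ⟨discr ^ N, fun i K L J => if K.get i = false then (if L = K.ins i then discr ^ N else 0)
    else discr ^ (N - n i K) * c i K L J, pow_ne_zero _ discr_ne_zero, ?_, ?_, ?_⟩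
  · intro i K L
    by_cases hK : K.get i = false
    · simp only [hK, if_true]
      exact const_mem_polyFam _
    · simp only [if_neg hK]
      exact polyFam.mul_mem (const_mem_polyFam _) (hc i K L)
  · intro i K L J hK
    simp [hK]
  · intro J M _ _ T u hu i K
    by_cases hK : K.get i = false
    · simp [hK, ite_smul, T.θ_mono_of_get_eq_false i K hK u]
    · simp only [if_neg hK, mul_smul, ← Finset.smul_sum, ← h i K J M T u hu]
      rw [← mul_smul, ← pow_add, Nat.sub_add_cancel (hN i K)]

/-! ### Two-sided Laurent series -/

/-- Two-sided formal series `∑_{u ∈ ℤ³} f(u) z^u`, a module over the polynomial ring. -/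
def LaurentFun : Type := (Fin 3 → ℤ) → ℂ

namespace LaurentFun

noncomputable instance : AddCommGroup LaurentFun := inferInstanceAs (AddCommGroup ((Fin 3 → ℤ) → ℂ))
noncomputable instance : Module ℂ LaurentFun := inferInstanceAs (Module ℂ ((Fin 3 → ℤ) → ℂ))

/-- Multiplication by the monomial `z^ν`. -/
noncomputable def shift : Multiplicative (Fin 3 →₀ ℕ) →* Module.End ℂ LaurentFun where
  toFun ν :=
    { toFun := fun f u => f (fun i => u i - ν.toAdd i)
      map_add' := fun _ _ => rfl
      map_smul' := fun _ _ => rfl }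
  map_one' := by
    ext f
    funext u
    change f (fun i => u i - ((0 : Fin 3 →₀ ℕ) i : ℕ)) = f u
    simp
  map_mul' ν ν' := by
    ext f
    funext u
    change f (fun i => u i - ((ν.toAdd + ν'.toAdd) i : ℕ)) =
      f (fun i => u i - (ν.toAdd i : ℕ) - (ν'.toAdd i : ℕ))
    congr 1
    funext i
    simp only [Finsupp.add_apply]
    push_cast
    ring

noncomputable instance : Module Poly₃ LaurentFun :=
  Module.compHom LaurentFun
    (AddMonoidAlgebra.lift ℂ (Module.End ℂ LaurentFun) (Fin 3 →₀ ℕ) shift).toRingHom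

theorem monomial_smul_apply (ν : Fin 3 →₀ ℕ) (c : ℂ) (f : LaurentFun) (u : Fin 3 → ℤ) :
    ((monomial ν c : Poly₃) • f) u = c * f (fun i => u i - ν i) := by
  change (AddMonoidAlgebra.lift ℂ (Module.End ℂ LaurentFun) (Fin 3 →₀ ℕ) shift
    (AddMonoidAlgebra.single ν c) f) u = _
  rw [AddMonoidAlgebra.lift_single]
  rfl

end LaurentFun

namespace LaurentFun

theorem add_apply (f g : LaurentFun) (u : Fin 3 → ℤ) : (f + g) u = f u + g u := rfl

theorem sub_apply (f g : LaurentFun) (u : Fin 3 → ℤ) : (f - g) u = f u - g u := rfl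

theorem zero_apply (u : Fin 3 → ℤ) : (0 : LaurentFun) u = 0 := rfl

theorem sum_apply {ι : Type} (s : Finset ι) (f : ι → LaurentFun) (u : Fin 3 → ℤ) :
    (∑ i ∈ s, f i) u = ∑ i ∈ s, f i u := by
  classical
  induction s using Finset.induction_on with
  | empty => rfl
  | insert a s ha ih => rw [Finset.sum_insert ha, Finset.sum_insert ha, add_apply, ih]

theorem smul_apply (p : Poly₃) (f : LaurentFun) (u : Fin 3 → ℤ) :
    (p • f) u = ∑ ν ∈ p.support, coeff ν p * f (fun i => u i - ν i) := by
  conv_lhs => rw [p.as_sum, Finset.sum_smul, sum_apply]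
  simp only [monomial_smul_apply]

theorem C_smul_apply (c : ℂ) (f : LaurentFun) (u : Fin 3 → ℤ) :
    ((C c : Poly₃) • f) u = c * f u := by
  rw [C_apply, monomial_smul_apply]
  simp

theorem X_smul_apply (i : Fin 3) (f : LaurentFun) (u : Fin 3 → ℤ) :
    ((X i : Poly₃) • f) u = f (fun j => u j - (Finsupp.single i 1 : Fin 3 →₀ ℕ) j) := by
  rw [X, monomial_smul_apply, one_mul]

theorem eulerDer_monomial (i : Fin 3) (ν : Fin 3 →₀ ℕ) (c : ℂ) :
    eulerDer i (monomial ν c) = monomial ν (c * ν i) := by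
  rw [eulerDer_apply, pderiv_monomial]
  by_cases h : ν i = 0
  · simp [h]
  · have hν : (Finsupp.single i 1 : Fin 3 →₀ ℕ) + (ν - Finsupp.single i 1) = ν := by
      ext j
      by_cases hj : i = j
      · subst hj; simp; omega
      · simp [hj]
    rw [X, monomial_mul, one_mul, hν]

/-- The Euler operators on series with exponents in `e + ℤ³`, the common factor `z^e` being
suppressed. -/
noncomputable def euler (e : Fin 3 → ℂ) : EulerAction LaurentFun where
  θ i :=
    { toFun := fun f u => (e i + u i) * f u
      map_zero' := by funext u; exact mul_zero _
      map_add' := fun f g => by funext u; exact mul_add _ _ _ }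
  leib i p f := by
    induction p using MvPolynomial.induction_on' with
    | monomial ν c =>
      funext u
      rw [eulerDer_monomial, add_apply, monomial_smul_apply, monomial_smul_apply]
      change (e i + u i) * ((monomial ν c : Poly₃) • f) u =
        c * ((e i + ((u i - ν i : ℤ) : ℂ)) * _) + _
      rw [monomial_smul_apply]
      push_cast
      ring
    | add p q hp hq =>
      rw [add_smul, map_add, hp, hq, map_add, add_smul, add_smul]
      abel
  comm i j f := by
    funext u
    exact mul_left_comm _ _ _

theorem euler_θ_apply (e : Fin 3 → ℂ) (i : Fin 3) (f : LaurentFun) (u : Fin 3 → ℤ) :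
    (euler e).θ i f u = (e i + u i) * f u := rfl

end LaurentFun

/-- The value of the squarefree monomial `θ^K` on `z^e`. -/
def Idx.pow (K : Idx) (e : Fin 3 → ℂ) : ℂ :=
  (bif K.1 then e 0 else 1) * ((bif K.2.1 then e 1 else 1) * (bif K.2.2 then e 2 else 1))

theorem LaurentFun.euler_mono_apply (e : Fin 3 → ℂ) (K : Idx) (f : LaurentFun) (u : Fin 3 → ℤ) :
    (LaurentFun.euler e).mono K f u = K.pow (fun i => e i + u i) * f u := by
  obtain ⟨a, b, c⟩ := K
  cases a <;> cases b <;> cases c <;>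
    simp [EulerAction.mono, Idx.pow, LaurentFun.euler_θ_apply, mul_assoc]

/-! ### Gamma series -/

/-- The entire function `1/Γ`. -/
noncomputable def rGamma (s : ℂ) : ℂ := (Complex.Gamma s)⁻¹

theorem rGamma_eq (s : ℂ) : rGamma s = s * rGamma (s + 1) :=
  Complex.one_div_Gamma_eq_self_mul_one_div_Gamma_add_one s

theorem rGamma_one : rGamma 1 = 1 := by simp [rGamma]

theorem rGamma_ne_zero_of_im {s : ℂ} (h : s.im ≠ 0) : rGamma s ≠ 0 :=
  inv_ne_zero (Complex.Gamma_ne_zero fun m hm => h (by simp [hm]))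

theorem pos_of_rGamma_intCast_ne_zero {n : ℤ} (h : rGamma n ≠ 0) : 0 < n := by
  by_contra hn
  obtain ⟨m, rfl⟩ : ∃ m : ℕ, n = -m := ⟨n.natAbs, by omega⟩
  exact h (by simp [rGamma, Complex.Gamma_neg_nat_eq_zero])

/-- The coefficient of `z₁^x z₂^y z₃^z` in the formal solutions of the Horn system. All gamma
factors are written as `1/Γ`, so that the recurrences hold for all exponents, and so that
the support of the series is cut out by the zeros of `1/Γ`. -/
noncomputable def gammaCoeff (J : Par → ℂ) (x y z : ℂ) : ℂ :=
  rGamma (x + 1) * rGamma (x + J .c₁) * rGamma (y + 1) * rGamma (z + 1) * rGamma (y + z + J .c₂) *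
    (rGamma (1 - x - J .a₁) * rGamma (1 - x - z - J .b₁) * rGamma (1 - y - J .a₂) *
      rGamma (1 - y - J .b₂) * rGamma (1 - z - J .a₃))

theorem gammaCoeff_rec_zero (J : Par → ℂ) (x y z : ℂ) :
    x * (x + J .c₁ - 1) * gammaCoeff J x y z =
      (x - 1 + J .a₁) * (x - 1 + z + J .b₁) * gammaCoeff J (x - 1) y z := by
  rw [gammaCoeff, gammaCoeff, sub_add_cancel, rGamma_eq x, rGamma_eq (x - 1 + J .c₁),
    rGamma_eq (1 - x - J .a₁), rGamma_eq (1 - x - z - J .b₁)]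
  ring_nf

theorem gammaCoeff_rec_one (J : Par → ℂ) (x y z : ℂ) :
    y * (y + z + J .c₂ - 1) * gammaCoeff J x y z =
      (y - 1 + J .a₂) * (y - 1 + J .b₂) * gammaCoeff J x (y - 1) z := by
  rw [gammaCoeff, gammaCoeff, sub_add_cancel, rGamma_eq y, rGamma_eq (y - 1 + z + J .c₂),
    rGamma_eq (1 - y - J .a₂), rGamma_eq (1 - y - J .b₂)]
  ring_nf

theorem gammaCoeff_rec_two (J : Par → ℂ) (x y z : ℂ) :
    z * (y + z + J .c₂ - 1) * gammaCoeff J x y z =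
      (z - 1 + J .a₃) * (x + (z - 1) + J .b₁) * gammaCoeff J x y (z - 1) := by
  rw [gammaCoeff, gammaCoeff, sub_add_cancel, rGamma_eq z, rGamma_eq (y + (z - 1) + J .c₂),
    rGamma_eq (1 - z - J .a₃), rGamma_eq (1 - x - z - J .b₁)]
  ring_nf

/-- The gamma series with exponents in `e + ℤ³`. -/
noncomputable def gammaSeries (J : Par → ℂ) (e : Fin 3 → ℂ) : LaurentFun :=
  fun u => gammaCoeff J (e 0 + u 0) (e 1 + u 1) (e 2 + u 2)

theorem isSol_gammaSeries (J : Par → ℂ) (e : Fin 3 → ℂ) :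
    (LaurentFun.euler e).IsSol J (gammaSeries J e) := by
  have hc : ∀ (a b : ℂ) (f : LaurentFun) (u), ((C a * C b : Poly₃) • f) u = a * b * f u :=
    fun a b f u => by rw [← C_mul, LaurentFun.C_smul_apply]
  have ha : ∀ (a b : ℂ) (f : LaurentFun) (u), ((C a + C b : Poly₃) • f) u = (a + b) * f u :=
    fun a b f u => by rw [← C_add, LaurentFun.C_smul_apply]
  have hs : ∀ (a : ℂ) (f : LaurentFun) (u), ((C a - 1 : Poly₃) • f) u = (a - 1) * f u :=
    fun a f u => by rw [← C_1, ← C_sub, LaurentFun.C_smul_apply]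
  have h01 : ∀ u : ℤ, ((u - 1 : ℤ) : ℂ) = u - 1 := fun u => by push_cast; ring
  intro j
  fin_cases j
  · simp only [Fin.zero_eta, EulerAction.horn_zero]
    funext u
    have := gammaCoeff_rec_zero J (e 0 + u 0) (e 1 + u 1) (e 2 + u 2)
    simp only [LaurentFun.add_apply, LaurentFun.sub_apply, LaurentFun.X_smul_apply, hc, ha, hs,
      LaurentFun.C_smul_apply, LaurentFun.euler_θ_apply, gammaSeries]
    simp [LaurentFun.zero_apply]
    simp only [add_sub_assoc] at this ⊢
    linear_combination this
  · simp only [Fin.mk_one, EulerAction.horn_one]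
    funext u
    have := gammaCoeff_rec_one J (e 0 + u 0) (e 1 + u 1) (e 2 + u 2)
    simp only [LaurentFun.add_apply, LaurentFun.sub_apply, LaurentFun.X_smul_apply, hc, ha, hs,
      LaurentFun.euler_θ_apply, gammaSeries]
    simp [LaurentFun.zero_apply]
    simp only [add_sub_assoc] at this ⊢
    linear_combination this
  · simp only [Fin.reduceFinMk, EulerAction.horn_two]
    funext u
    have := gammaCoeff_rec_two J (e 0 + u 0) (e 1 + u 1) (e 2 + u 2)
    simp only [LaurentFun.add_apply, LaurentFun.sub_apply, LaurentFun.X_smul_apply, hc, ha, hs,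
      LaurentFun.C_smul_apply, LaurentFun.euler_θ_apply, gammaSeries]
    simp [LaurentFun.zero_apply]
    simp only [add_sub_assoc] at this ⊢
    linear_combination this

/-! ### Freeness over the squarefree monomials -/

/-- A series is supported in the cone `u₁ ≥ 0`, `u₂ ≥ 0`, `u₂ + u₃ ≥ 0`. -/
def LaurentFun.InCone (f : LaurentFun) : Prop :=
  ∀ u : Fin 3 → ℤ, f u ≠ 0 → 0 ≤ u 0 ∧ 0 ≤ u 1 ∧ 0 ≤ u 1 + u 2

/-- The weight `ν₁ + 2ν₂ + ν₃`. It is positive on the nonzero elements of the cone, which is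
generated by `(1,0,0)`, `(0,1,-1)` and `(0,0,1)`. -/
def coneWeight (ν : Fin 3 →₀ ℕ) : ℕ := ν 0 + 2 * ν 1 + ν 2

/-- The leading coefficient of a relation among the `θ^K f`, where `f = z^e(1 + ⋯)`: the
initial form, for a weight that is positive on the cone, vanishes at the exponent `e`. -/
theorem sum_coeff_mul_pow_eq_zero {e : Fin 3 → ℂ} {f : LaurentFun} (hf : f.InCone)
    (h0 : f 0 ≠ 0) {r : Idx → Poly₃} (hr : ∑ K, r K • (LaurentFun.euler e).mono K f = 0)
    {μ : Fin 3 →₀ ℕ} (hμ : ∀ K, ∀ ν ∈ (r K).support, coneWeight μ ≤ coneWeight ν) :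
    ∑ K, coeff μ (r K) * K.pow e = 0 := by
  have h := congrFun hr (fun i => (μ i : ℤ))
  rw [LaurentFun.sum_apply] at h
  have key : ∀ K, (r K • (LaurentFun.euler e).mono K f) (fun i => (μ i : ℤ)) =
      coeff μ (r K) * K.pow e * f 0 := by
    intro K
    rw [LaurentFun.smul_apply]
    rw [Finset.sum_eq_single μ]
    · rw [LaurentFun.euler_mono_apply]
      simp only [sub_self, Int.cast_zero, add_zero]
      rw [mul_assoc]
      rfl
    · intro ν hν hne
      rw [LaurentFun.euler_mono_apply]
      suffices f (fun i => (μ i : ℤ) - ν i) = 0 by rw [this, mul_zero, mul_zero]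
      by_contra hfu
      obtain ⟨h₀, h₁, h₂⟩ := hf _ hfu
      have hw := hμ K ν hν
      simp only [coneWeight] at hw
      refine hne (Finsupp.ext fun i => ?_)
      fin_cases i <;> simp only [Fin.zero_eta, Fin.mk_one, Fin.reduceFinMk] <;> omega
    · intro hν
      rw [notMem_support_iff.mp hν, zero_mul]
  simp only [key, ← Finset.sum_mul] at h
  exact (mul_eq_zero.mp h).resolve_right h0

/-- A bilinear polynomial vanishing at `(0,0)`, `(0,s)`, `(s+a,-a)`, `(s+b,-b)` is zero. -/
theorem bilinear_eq_zero {α β γ δ s a b : ℂ} (hs : s ≠ 0) (ha : s + a ≠ 0) (hb : s + b ≠ 0)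
    (hab : a ≠ b) (h1 : α = 0) (h2 : α + γ * s = 0)
    (h3 : α + β * (s + a) + γ * (-a) + δ * ((s + a) * (-a)) = 0)
    (h4 : α + β * (s + b) + γ * (-b) + δ * ((s + b) * (-b)) = 0) :
    α = 0 ∧ β = 0 ∧ γ = 0 ∧ δ = 0 := by
  subst h1
  obtain rfl : γ = 0 := by simpa [hs] using h2
  have h3' : β - δ * a = 0 := mul_left_cancel₀ ha (by linear_combination h3)
  have h4' : β - δ * b = 0 := mul_left_cancel₀ hb (by linear_combination h4)
  have hδ : δ = 0 := mul_right_cancel₀ (sub_ne_zero.mpr hab) (by linear_combination h4' - h3')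
  subst hδ
  exact ⟨rfl, by simpa using h3', rfl, rfl⟩

theorem affine_eq_zero {α β s : ℂ} (hs : s ≠ 0) (h1 : α = 0) (h2 : α + β * s = 0) :
    α = 0 ∧ β = 0 := by
  subst h1
  exact ⟨rfl, by simpa [hs] using h2⟩

/-- Imaginary parts of the parameters for which the arguments of the gamma functions at the eight
exponents are not real, unless they are equal to `1`, and the eight exponents are in general
position. Prescribing imaginary parts leaves a Zariski dense set of parameters. -/
def genericIm : Par → ℝ
  | .a₁ => 1
  | .a₂ => 10
  | .a₃ => 100
  | .b₁ => 1000
  | .b₂ => 10000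
  | .c₁ => 100000
  | .c₂ => 1000000

section Generic

variable {J : Par → ℂ}

theorem pos_of_rGamma_ne_zero {s : ℂ} {n : ℤ} (h : rGamma s ≠ 0) (e : s = n) : 0 < n :=
  pos_of_rGamma_intCast_ne_zero (e ▸ h)

/-- The four series with a given first exponent `x ∈ {0, 1-c₁}` are supported in the cone. -/
theorem inCone_gammaSeries {e : Fin 3 → ℂ} (hx : e 0 = 0 ∨ e 0 = 1 - J .c₁)
    (he : (e 1 = 0 ∧ e 2 = 0) ∨ (e 1 = 0 ∧ e 2 = 1 - J .c₂) ∨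
      (e 1 + e 2 = 1 - J .c₂ ∧ e 2 = - J .a₃) ∨ (e 1 + e 2 = 1 - J .c₂ ∧ e 0 + e 2 = - J .b₁)) :
    (gammaSeries J e).InCone := by
  intro u hu
  simp only [gammaSeries, gammaCoeff, ne_eq, mul_eq_zero, not_or] at hu
  obtain ⟨⟨⟨⟨⟨g1, g2⟩, g3⟩, g4⟩, g5⟩, ⟨⟨⟨g6, g7⟩, g8⟩, g9⟩, g10⟩ := hu
  have h0 : 0 ≤ u 0 := by
    rcases hx with hx | hx
    · have := pos_of_rGamma_ne_zero (n := u 0 + 1) g1 (by rw [hx]; push_cast; ring)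
      omega
    · have := pos_of_rGamma_ne_zero (n := u 0 + 1) g2 (by rw [hx]; push_cast; ring)
      omega
  rcases he with ⟨h1, h2⟩ | ⟨h1, h2⟩ | ⟨h1, h2⟩ | ⟨h1, h2⟩
  · have := pos_of_rGamma_ne_zero (n := u 1 + 1) g3 (by rw [h1]; push_cast; ring)
    have := pos_of_rGamma_ne_zero (n := u 2 + 1) g4 (by rw [h2]; push_cast; ring)
    omega
  · have := pos_of_rGamma_ne_zero (n := u 1 + 1) g3 (by rw [h1]; push_cast; ring)
    have := pos_of_rGamma_ne_zero (n := u 1 + u 2 + 1) g5 (by rw [h1, h2]; push_cast; ring)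
    omega
  · have := pos_of_rGamma_ne_zero (n := u 1 + u 2 + 1) g5
      (by push_cast; linear_combination h1)
    have := pos_of_rGamma_ne_zero (n := 1 - u 2) g10 (by rw [h2]; push_cast; ring)
    omega
  · have := pos_of_rGamma_ne_zero (n := u 1 + u 2 + 1) g5
      (by push_cast; linear_combination h1)
    have := pos_of_rGamma_ne_zero (n := 1 - u 0 - u 2) g7
      (by push_cast; linear_combination -h2)
    omega

/-- The eight exponents, for each of the two choices `x ∈ {0, 1-c₁}` of the first one. -/
def exponents (J : Par → ℂ) (x : ℂ) : Fin 4 → Fin 3 → ℂ :=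
  ![![x, 0, 0], ![x, 0, 1 - J .c₂], ![x, 1 - J .c₂ + J .a₃, - J .a₃],
    ![x, 1 - J .c₂ + (J .b₁ + x), - (J .b₁ + x)]]

theorem gammaSeries_exponents_ne_zero (hJ : ∀ i, (J i).im = genericIm i) {x : ℂ}
    (hx : x = 0 ∨ x = 1 - J .c₁) (k : Fin 4) : gammaSeries J (exponents J x k) 0 ≠ 0 := by
  have aux : ∀ s : ℂ, s.im ≠ 0 ∨ s = 1 → rGamma s ≠ 0 := by
    rintro s (h | rfl)
    · exact rGamma_ne_zero_of_im h
    · rw [rGamma_one]; exact one_ne_zero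
  have h0 : ∀ i, (((0 : Fin 3 → ℤ) i : ℤ) : ℂ) = 0 := fun i => by simp
  simp only [gammaSeries, gammaCoeff, h0, add_zero]
  rcases hx with rfl | rfl <;> fin_cases k <;>
    simp only [exponents, Fin.zero_eta, Fin.mk_one, Fin.reduceFinMk, Matrix.cons_val_zero,
      Matrix.cons_val_one, Matrix.cons_val] <;>
    refine mul_ne_zero (mul_ne_zero (mul_ne_zero (mul_ne_zero (mul_ne_zero ?_ ?_) ?_) ?_) ?_)
      (mul_ne_zero (mul_ne_zero (mul_ne_zero (mul_ne_zero ?_ ?_) ?_) ?_) ?_) <;>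
    refine aux _ ?_ <;>
    first
    | (right; ring1)
    | (left; norm_num [hJ, genericIm])

/-- For parameters with generic imaginary parts the squarefree monomials are independent
over the polynomials, as operators on the eight gamma series. -/
theorem eq_zero_of_generic (hJ : ∀ i, (J i).im = genericIm i) {r : Idx → Poly₃}
    (h : ∀ (M : Type) [AddCommGroup M] [Module Poly₃ M] (T : EulerAction M) (u : M),
      T.IsSol J u → ∑ K, r K • T.mono K u = 0) : r = 0 := by
  classical
  by_contra hr
  obtain ⟨K₀, hK₀⟩ : ∃ K, r K ≠ 0 := by
    by_contra hc
    push Not at hc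
    exact hr (funext hc)
  let S : Finset (Fin 3 →₀ ℕ) := Finset.univ.biUnion fun K => (r K).support
  have hS : S.Nonempty := by
    obtain ⟨ν, hν⟩ := support_nonempty.mpr hK₀
    exact ⟨ν, Finset.mem_biUnion.mpr ⟨K₀, Finset.mem_univ _, hν⟩⟩
  -- an exponent of minimal weight in the coefficients of the relation
  obtain ⟨μ, hμS, hμ⟩ := S.exists_min_image coneWeight hS
  have hμ' : ∀ K, ∀ ν ∈ (r K).support, coneWeight μ ≤ coneWeight ν := fun K ν hν =>
    hμ ν (Finset.mem_biUnion.mpr ⟨K, Finset.mem_univ _, hν⟩)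
  obtain ⟨K₁, -, hK₁⟩ := Finset.mem_biUnion.mp hμS
  have him : ∀ s : ℂ, s.im ≠ 0 → s ≠ 0 := fun s hs h => hs (by simp [h])
  have hs2 : (1 - J .c₂) ≠ 0 := him _ (by simp [hJ, genericIm])
  have hs1 : (1 - J .c₁) ≠ 0 := him _ (by simp [hJ, genericIm])
  -- the coefficients of `z^μ` form a polynomial of degree at most one in each of the three
  -- exponents, which vanishes at all eight exponents
  have key : ∀ x, (x = 0 ∨ x = 1 - J .c₁) →
      coeff μ (r (false, false, false)) + coeff μ (r (true, false, false)) * x = 0 ∧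
      coeff μ (r (false, true, false)) + coeff μ (r (true, true, false)) * x = 0 ∧
      coeff μ (r (false, false, true)) + coeff μ (r (true, false, true)) * x = 0 ∧
      coeff μ (r (false, true, true)) + coeff μ (r (true, true, true)) * x = 0 := by
    intro x hx
    have hk : ∀ k, ∑ K, coeff μ (r K) * K.pow (exponents J x k) = 0 := by
      intro k
      refine sum_coeff_mul_pow_eq_zero (inCone_gammaSeries (J := J) ?_ ?_)
        (gammaSeries_exponents_ne_zero hJ hx k)
        (h _ _ _ (isSol_gammaSeries J _)) hμ'
      · fin_cases k <;> exact hx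
      · fin_cases k
        · exact Or.inl ⟨rfl, rfl⟩
        · exact Or.inr (Or.inl ⟨rfl, rfl⟩)
        · exact Or.inr (Or.inr (Or.inl ⟨by simp [exponents], rfl⟩))
        · exact Or.inr (Or.inr (Or.inr ⟨by simp [exponents]; ring,
            by simp [exponents]⟩))
    simp only [Fintype.sum_prod_type, Fintype.sum_bool, Idx.pow, cond_true, cond_false] at hk
    have k0 := hk 0
    have k1 := hk 1
    have k2 := hk 2
    have k3 := hk 3
    simp only [exponents, Matrix.cons_val_zero, Matrix.cons_val_one, Matrix.cons_val] at k0 k1 k2 k3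
    refine bilinear_eq_zero (s := 1 - J .c₂) (a := J .a₃) (b := J .b₁ + x) hs2 ?_ ?_ ?_ ?_ ?_ ?_ ?_
    · exact him _ (by simp [hJ, genericIm]; norm_num)
    · rcases hx with rfl | rfl <;> exact him _ (by simp [hJ, genericIm]; norm_num)
    · refine sub_ne_zero.mp (him _ ?_)
      rcases hx with rfl | rfl <;> simp [hJ, genericIm] <;> norm_num
    · linear_combination k0
    · linear_combination k1
    · linear_combination k2
    · linear_combination k3
  obtain ⟨p1, p2, p3, p4⟩ := key 0 (Or.inl rfl)
  obtain ⟨q1, q2, q3, q4⟩ := key _ (Or.inr rfl)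
  rw [mul_zero, add_zero] at p1 p2 p3 p4
  have z1 := affine_eq_zero hs1 p1 q1
  have z2 := affine_eq_zero hs1 p2 q2
  have z3 := affine_eq_zero hs1 p3 q3
  have z4 := affine_eq_zero hs1 p4 q4
  refine mem_support_iff.mp hK₁ ?_
  obtain ⟨a, b, c⟩ := K₁
  cases a <;> cases b <;> cases c
  · exact z1.1
  · exact z3.1
  · exact z2.1
  · exact z4.1
  · exact z1.2
  · exact z3.2
  · exact z2.2
  · exact z4.2

end Generic

/-- A polynomial family that vanishes on the parameters with generic imaginary parts vanishes. -/
theorem polyFam_eq_zero {f : (Par → ℂ) → Poly₃} (hf : f ∈ polyFam)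
    (h : ∀ J : Par → ℂ, (∀ i, (J i).im = genericIm i) → f J = 0) : f = 0 := by
  obtain ⟨P, rfl⟩ := hf
  have hev : ∀ J : Par → ℂ, (aeval (R := Poly₃)
      (fun (i : Par) (J : Par → ℂ) => (C (J i) : Poly₃)) P : (Par → ℂ) → Poly₃) J
      = eval (fun i => (C (J i) : Poly₃)) P := by
    intro J
    clear h
    induction P using MvPolynomial.induction_on with
    | C a => simp
    | add p q hp hq => simp [hp, hq]
    | mul_X p j hp => simp [hp]
  have hP : P = 0 := by
    refine MvPolynomial.funext_set (fun i => C '' {s : ℂ | s.im = genericIm i}) (fun i => ?_) ?_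
    · refine Set.Infinite.image (C_injective _ _).injOn ?_
      refine Set.infinite_of_injective_forall_mem (f := fun n : ℕ =>
        (⟨n, genericIm i⟩ : ℂ)) (fun m n hmn => ?_) (fun n => rfl)
      exact Nat.cast_injective (R := ℝ) (Complex.ext_iff.mp hmn).1
    · intro x hx
      choose J hJ hJx using fun i => hx i (Set.mem_univ i)
      obtain rfl : (fun i => C (J i)) = x := funext hJx
      rw [map_zero, ← hev]
      exact h J hJ
  simp [hP]

/-- The squarefree monomials are free generators of the universal solution of the Horn system: a
relation `∑_K G_K(J) θ^K u = 0` that is polynomial in `J` and holds for all solutions in all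
modules is trivial. It is enough to test it on gamma series for generic `J`. -/
theorem polyFam_eq_zero_of_sum_mono {G : Idx → (Par → ℂ) → Poly₃} (hG : ∀ K, G K ∈ polyFam)
    (h : ∀ (J : Par → ℂ) (M : Type) [AddCommGroup M] [Module Poly₃ M] (T : EulerAction M) (u : M),
      T.IsSol J u → ∑ K, G K J • T.mono K u = 0) (K : Idx) (J : Par → ℂ) : G K J = 0 := by
  have : G K = 0 := polyFam_eq_zero (hG K) fun J hJ =>
    congrFun (eq_zero_of_generic hJ (r := fun K => G K J) (h J)) K
  rw [this, Pi.zero_apply]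

/-! ### The connection attached to the Horn system -/

/-- A common denominator of the connection matrices. -/
noncomputable def connDen : Poly₃ := exists_connection.choose

/-- The connection matrices: `connDen • θ_i θ^K u = ∑_L connMat i K L J • θ^L u`. -/
noncomputable def connMat : Fin 3 → Idx → Idx → (Par → ℂ) → Poly₃ :=
  exists_connection.choose_spec.choose

theorem connDen_ne_zero : connDen ≠ 0 := exists_connection.choose_spec.choose_spec.1

theorem connMat_mem (i : Fin 3) (K L : Idx) : connMat i K L ∈ polyFam :=
  exists_connection.choose_spec.choose_spec.2.1 i K L

theorem connMat_of_get_eq_false {i : Fin 3} {K : Idx} (h : K.get i = false) (L : Idx)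
    (J : Par → ℂ) : connMat i K L J = if L = K.ins i then connDen else 0 :=
  exists_connection.choose_spec.choose_spec.2.2.1 i K L J h

theorem connDen_smul_θ_mono {J : Par → ℂ} {M : Type} [AddCommGroup M] [Module Poly₃ M]
    {T : EulerAction M} {u : M} (hu : T.IsSol J u) (i : Fin 3) (K : Idx) :
    connDen • T.θ i (T.mono K u) = ∑ L, connMat i K L J • T.mono L u :=
  exists_connection.choose_spec.choose_spec.2.2.2 J M T u hu i K

/-- The coefficients of `connDen² θ_i θ_j θ^K u`. -/
noncomputable def curvCoeff (i j : Fin 3) (K N : Idx) (J : Par → ℂ) : Poly₃ :=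
  connDen * eulerDer i (connMat j K N J) + ∑ L, connMat j K L J * connMat i L N J
    - eulerDer i connDen * connMat j K N J

theorem curvCoeff_mem (i j : Fin 3) (K N : Idx) : curvCoeff i j K N ∈ polyFam := by
  have h : curvCoeff i j K N = (fun _ => connDen) * (fun J => eulerDer i (connMat j K N J))
      + ∑ L, connMat j K L * connMat i L N - (fun _ => eulerDer i connDen) * connMat j K N := by
    funext J
    simp [curvCoeff]
  rw [h]
  exact polyFam.sub_mem (polyFam.add_mem (polyFam.mul_mem (const_mem_polyFam _)
    (eulerDer_mem_polyFam i (connMat_mem j K N)))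
    (polyFam.sum_mem fun L _ => polyFam.mul_mem (connMat_mem j K L) (connMat_mem i L N)))
    (polyFam.mul_mem (const_mem_polyFam _) (connMat_mem j K N))

theorem sum_curvCoeff_smul_mono {J : Par → ℂ} {M : Type} [AddCommGroup M] [Module Poly₃ M]
    {T : EulerAction M} {u : M} (hu : T.IsSol J u) (i j : Fin 3) (K : Idx) :
    ∑ N, curvCoeff i j K N J • T.mono N u
      = (connDen * connDen) • T.θ i (T.θ j (T.mono K u)) := by
  have h1 : T.θ i (connDen • T.θ j (T.mono K u)) = _ :=
    congrArg (T.θ i) (connDen_smul_θ_mono hu j K)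
  rw [T.leib, map_sum] at h1
  simp only [T.leib] at h1
  have h2 := congrArg (fun m => connDen • m) h1
  simp only [smul_add, Finset.smul_sum, Finset.sum_add_distrib] at h2
  have h3 : ∀ L, connDen • connMat j K L J • T.θ i (T.mono L u)
      = ∑ N, (connMat j K L J * connMat i L N J) • T.mono N u := by
    intro L
    rw [smul_comm, connDen_smul_θ_mono hu, Finset.smul_sum]
    simp only [mul_smul]
  simp only [h3] at h2
  rw [Finset.sum_comm] at h2
  have h4 : connDen • eulerDer i connDen • T.θ j (T.mono K u)
      = ∑ N, (eulerDer i connDen * connMat j K N J) • T.mono N u := by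
    rw [smul_comm, connDen_smul_θ_mono hu, Finset.smul_sum]
    simp only [mul_smul]
  rw [h4] at h2
  simp only [curvCoeff, sub_smul, add_smul, Finset.sum_sub_distrib, Finset.sum_add_distrib,
    Finset.sum_smul, mul_smul] at h2 ⊢
  rw [← sub_eq_zero] at h2 ⊢
  rw [← neg_eq_zero, ← h2]
  abel

/-- Integrability of the connection, for all parameters: `θ_i` and `θ_j` commute on every solution,
and the squarefree monomials are free. -/
theorem curvCoeff_comm (i j : Fin 3) (K N : Idx) (J : Par → ℂ) :
    curvCoeff i j K N J = curvCoeff j i K N J := by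
  refine sub_eq_zero.mp (polyFam_eq_zero_of_sum_mono
    (G := fun N J => curvCoeff i j K N J - curvCoeff j i K N J)
    (fun N => polyFam.sub_mem (curvCoeff_mem i j K N) (curvCoeff_mem j i K N)) ?_ N J)
  intro J M _ _ T u hu
  simp only [sub_smul, Finset.sum_sub_distrib, sum_curvCoeff_smul_mono hu, T.comm i j, sub_self]

/-- The coefficients of `connDen • L_j u`, for a vector `u` on which the `θ_i` act through the
connection matrices. -/
noncomputable def hornCoeff (j : Fin 3) (N : Idx) (J : Par → ℂ) : Poly₃ :=
  ![(1 - X 0) * connMat 0 (true, false, false) N J + connDen *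
      ((if N = (true, false, false) then C (J .c₁) - 1 - X 0 * (C (J .a₁) + C (J .b₁)) else 0)
        - (if N = (true, false, true) then X 0 else 0)
        - (if N = (false, false, true) then X 0 * C (J .a₁) else 0)
        - (if N = (false, false, false) then X 0 * (C (J .a₁) * C (J .b₁)) else 0)),
    (1 - X 1) * connMat 1 (false, true, false) N J + connDen *
      ((if N = (false, true, false) then C (J .c₂) - 1 - X 1 * (C (J .a₂) + C (J .b₂)) else 0)
        + (if N = (false, true, true) then 1 else 0)
        - (if N = (false, false, false) then X 1 * (C (J .a₂) * C (J .b₂)) else 0)),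
    (1 - X 2) * connMat 2 (false, false, true) N J + connDen *
      ((if N = (false, false, true) then C (J .c₂) - 1 - X 2 * (C (J .a₃) + C (J .b₁)) else 0)
        + (if N = (false, true, true) then 1 else 0)
        - (if N = (true, false, true) then X 2 else 0)
        - (if N = (true, false, false) then X 2 * C (J .a₃) else 0)
        - (if N = (false, false, false) then X 2 * (C (J .a₃) * C (J .b₁)) else 0))] j

theorem hornCoeff_mem (j : Fin 3) (N : Idx) : hornCoeff j N ∈ polyFam := by
  have hc : ∀ p : Poly₃, (fun _ : Par → ℂ => p) ∈ polyFam := const_mem_polyFam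
  have hite : ∀ (P : Prop) [Decidable P] {f : (Par → ℂ) → Poly₃}, f ∈ polyFam →
      (fun J => if P then f J else 0) ∈ polyFam := by
    intro P _ f hf
    by_cases h : P
    · simpa only [if_pos h] using hf
    · simp only [if_neg h]
      exact polyFam.zero_mem
  have hadd : ∀ {f g : (Par → ℂ) → Poly₃}, f ∈ polyFam → g ∈ polyFam →
      (fun J => f J + g J) ∈ polyFam := fun hf hg => polyFam.add_mem hf hg
  have hsub : ∀ {f g : (Par → ℂ) → Poly₃}, f ∈ polyFam → g ∈ polyFam →
      (fun J => f J - g J) ∈ polyFam := fun hf hg => polyFam.sub_mem hf hg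
  have hmul : ∀ {f g : (Par → ℂ) → Poly₃}, f ∈ polyFam → g ∈ polyFam →
      (fun J => f J * g J) ∈ polyFam := fun hf hg => polyFam.mul_mem hf hg
  fin_cases j
  · exact hadd (hmul (hc _) (connMat_mem _ _ _)) (hmul (hc _) (hsub (hsub (hsub
      (hite _ (hsub (hsub (par_mem_polyFam _) (hc 1)) (hmul (hc _)
        (hadd (par_mem_polyFam _) (par_mem_polyFam _)))))
      (hite _ (hc _))) (hite _ (hmul (hc _) (par_mem_polyFam _))))
      (hite _ (hmul (hc _) (hmul (par_mem_polyFam _) (par_mem_polyFam _))))))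
  · exact hadd (hmul (hc _) (connMat_mem _ _ _)) (hmul (hc _) (hsub (hadd
      (hite _ (hsub (hsub (par_mem_polyFam _) (hc 1)) (hmul (hc _)
        (hadd (par_mem_polyFam _) (par_mem_polyFam _)))))
      (hite _ (hc 1))) (hite _ (hmul (hc _) (hmul (par_mem_polyFam _) (par_mem_polyFam _))))))
  · exact hadd (hmul (hc _) (connMat_mem _ _ _)) (hmul (hc _) (hsub (hsub (hsub (hadd
      (hite _ (hsub (hsub (par_mem_polyFam _) (hc 1)) (hmul (hc _)
        (hadd (par_mem_polyFam _) (par_mem_polyFam _)))))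
      (hite _ (hc 1))) (hite _ (hc _))) (hite _ (hmul (hc _) (par_mem_polyFam _))))
      (hite _ (hmul (hc _) (hmul (par_mem_polyFam _) (par_mem_polyFam _))))))

/-- The connection matrices satisfy the Horn equations identically, for all parameters. -/
theorem hornCoeff_eq_zero (j : Fin 3) (N : Idx) (J : Par → ℂ) : hornCoeff j N J = 0 := by
  refine polyFam_eq_zero_of_sum_mono (G := hornCoeff j) (hornCoeff_mem j) ?_ N J
  intro J M _ _ T u hu
  have hm : ∀ (N₀ : Idx) (p : Poly₃),
      ∑ N, (if N = N₀ then p else 0) • T.mono N u = p • T.mono N₀ u := by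
    intro N₀ p
    simp [ite_smul]
  fin_cases j
  · have h := hu 0
    have h0 := connDen_smul_θ_mono hu 0 (true, false, false)
    rw [T.horn_zero] at h
    simp only [hornCoeff, Fin.zero_eta, Matrix.cons_val_zero, add_smul, mul_smul, sub_smul,
      Finset.sum_add_distrib, Finset.sum_sub_distrib, ← Finset.smul_sum, hm, ← h0, one_smul]
    simp only [EulerAction.mono, cond_true, cond_false]
    linear_combination (norm := module) connDen • h
  · have h := hu 1
    have h0 := connDen_smul_θ_mono hu 1 (false, true, false)
    rw [T.horn_one] at h
    simp only [hornCoeff, Fin.mk_one, Matrix.cons_val_one, Matrix.cons_val_zero, add_smul, mul_smul,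
      sub_smul, Finset.sum_add_distrib, Finset.sum_sub_distrib, ← Finset.smul_sum, hm, ← h0,
      one_smul]
    simp only [EulerAction.mono, cond_true, cond_false]
    linear_combination (norm := module) connDen • h
  · have h := hu 2
    have h0 := connDen_smul_θ_mono hu 2 (false, false, true)
    rw [T.horn_two] at h
    simp only [hornCoeff, Fin.reduceFinMk, Matrix.cons_val, add_smul, mul_smul,
      sub_smul, Finset.sum_add_distrib, Finset.sum_sub_distrib, ← Finset.smul_sum, hm, ← h0,
      one_smul]
    simp only [EulerAction.mono, cond_true, cond_false]
    linear_combination (norm := module) connDen • h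

/-- Commuting extensions of the Euler derivations to a `ℂ[z]`-algebra. -/
structure EulerRing (B : Type) [CommRing B] [Algebra Poly₃ B] where
  /-- The extension of `θ_i`. -/
  d : Fin 3 → B →+ B
  leib : ∀ (i : Fin 3) (a b : B), d i (a * b) = a * d i b + d i a * b
  d_algebraMap : ∀ (i : Fin 3) (p : Poly₃), d i (algebraMap Poly₃ B p)
    = algebraMap Poly₃ B (eulerDer i p)
  comm : ∀ (i j : Fin 3) (a : B), d i (d j a) = d j (d i a)

namespace EulerRing

variable {B : Type} [CommRing B] [Algebra Poly₃ B] (R : EulerRing B)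

theorem d_one (i : Fin 3) : R.d i 1 = 0 := by
  have := R.leib i 1 1
  simpa using this

/-- The connection on the free module `B⁸`, when the denominator of the connection matrices has
an inverse `e` in `B`. Its flatness is the integrability of the Horn system. -/
noncomputable def conn (J : Par → ℂ) {e : B} (he : algebraMap Poly₃ B connDen * e = 1) :
    EulerAction (Idx → B) where
  θ i :=
    { toFun := fun v N => R.d i (v N) + e * ∑ L, v L * algebraMap Poly₃ B (connMat i L N J)
      map_zero' := by funext N; simp
      map_add' := fun v w => by
        funext N
        simp only [Pi.add_apply, map_add, add_mul, Finset.sum_add_distrib]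
        ring }
  leib i p v := by
    funext N
    simp only [AddMonoidHom.coe_mk, ZeroHom.coe_mk, Pi.smul_apply, Pi.add_apply]
    simp only [Algebra.smul_def, R.leib, R.d_algebraMap, mul_assoc, ← Finset.mul_sum]
    ring
  comm i j v := by
    have hd : ∀ i, R.d i e = - (e * e * algebraMap Poly₃ B (eulerDer i connDen)) := by
      intro i
      have h := congrArg (R.d i) he
      rw [R.leib, R.d_algebraMap, R.d_one] at h
      linear_combination e * h - R.d i e * he
    have key : ∀ (i j : Fin 3) (N : Idx),
        R.d i (R.d j (v N) + e * ∑ L, v L * algebraMap Poly₃ B (connMat j L N J)) +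
          e * ∑ L, (R.d j (v L) + e * ∑ K, v K * algebraMap Poly₃ B (connMat j K L J))
            * algebraMap Poly₃ B (connMat i L N J)
        = R.d i (R.d j (v N)) + e * (∑ L, R.d i (v L) * algebraMap Poly₃ B (connMat j L N J)
            + ∑ L, R.d j (v L) * algebraMap Poly₃ B (connMat i L N J))
          + e * e * ∑ K, v K * algebraMap Poly₃ B (curvCoeff i j K N J) := by
      intro i j N
      have hc : ∀ K, v K * algebraMap Poly₃ B (curvCoeff i j K N J) =
          algebraMap Poly₃ B connDen * (v K * algebraMap Poly₃ B (eulerDer i (connMat j K N J)))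
          + ∑ L, v K * algebraMap Poly₃ B (connMat j K L J) * algebraMap Poly₃ B (connMat i L N J)
          - algebraMap Poly₃ B (eulerDer i connDen) *
            (v K * algebraMap Poly₃ B (connMat j K N J)) := by
        intro K
        simp only [curvCoeff, map_sub, map_add, map_mul, map_sum, mul_sub, mul_add,
          Finset.mul_sum]
        ring_nf
      have hsw : ∑ L, (∑ K, v K * algebraMap Poly₃ B (connMat j K L J))
            * algebraMap Poly₃ B (connMat i L N J)
          = ∑ K, ∑ L, v K * algebraMap Poly₃ B (connMat j K L J)
            * algebraMap Poly₃ B (connMat i L N J) := by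
        simp only [Finset.sum_mul]
        exact Finset.sum_comm
      simp only [hc, Finset.sum_add_distrib, Finset.sum_sub_distrib, map_add, R.leib, hd, map_sum,
        R.d_algebraMap, add_mul, mul_assoc e, ← Finset.mul_sum, hsw]
      linear_combination (-e * ∑ K, v K * algebraMap Poly₃ B (eulerDer i (connMat j K N J))) * he
    funext N
    simp only [AddMonoidHom.coe_mk, ZeroHom.coe_mk]
    rw [key i j N, key j i N, R.comm i j]
    simp only [curvCoeff_comm i j]
    ring

variable (J : Par → ℂ) {e : B} (he : algebraMap Poly₃ B connDen * e = 1)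

theorem conn_θ_single (i : Fin 3) (K : Idx) :
    (R.conn J he).θ i (Pi.single K 1) = fun N => e * algebraMap Poly₃ B (connMat i K N J) := by
  funext N
  change R.d i ((Pi.single K 1 : Idx → B) N) + e * ∑ L, _ = _
  have h0 : R.d i ((Pi.single K 1 : Idx → B) N) = 0 := by
    by_cases h : N = K
    · subst h; rw [Pi.single_eq_same, R.d_one]
    · rw [Pi.single_eq_of_ne h, map_zero]
  rw [h0, zero_add, Finset.sum_eq_single K]
  · rw [Pi.single_eq_same, one_mul]
  · intro L _ hL
    rw [Pi.single_eq_of_ne hL, zero_mul]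
  · simp

theorem conn_θ_single_of_get_eq_false {i : Fin 3} {K : Idx} (h : K.get i = false) :
    (R.conn J he).θ i (Pi.single K 1) = Pi.single (K.ins i) 1 := by
  rw [conn_θ_single]
  funext N
  rw [connMat_of_get_eq_false h]
  by_cases hN : N = K.ins i
  · rw [if_pos hN, hN, Pi.single_eq_same, mul_comm, he]
  · rw [if_neg hN, Pi.single_eq_of_ne hN, map_zero, mul_zero]

/-- The basis vectors of `B⁸` are the squarefree monomials applied to the first one. -/
theorem conn_mono (K : Idx) :
    (R.conn J he).mono K (Pi.single (false, false, false) 1) = Pi.single K 1 := by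
  obtain ⟨a, b, c⟩ := K
  have h := fun (i : Fin 3) (K : Idx) (h : K.get i = false) =>
    R.conn_θ_single_of_get_eq_false J he h
  cases a <;> cases b <;> cases c <;> simp only [EulerAction.mono, cond_true, cond_false] <;>
    (try rw [h 2 _ rfl]) <;> (try rw [h 1 _ rfl]) <;> (try rw [h 0 _ rfl]) <;> rfl

/-- The first basis vector of `B⁸` is a solution of the Horn system. -/
theorem conn_isSol : (R.conn J he).IsSol J (Pi.single (false, false, false) 1) := by
  have h := fun (i : Fin 3) (K : Idx) (h : K.get i = false) =>
    R.conn_θ_single_of_get_eq_false J he h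
  have hz : ∀ (j : Fin 3) (N : Idx), e * algebraMap Poly₃ B (hornCoeff j N J) = 0 := fun j N => by
    rw [hornCoeff_eq_zero, map_zero, mul_zero]
  have hif : ∀ (N N₀ : Idx) (p : Poly₃), algebraMap Poly₃ B (if N = N₀ then p else 0)
      = algebraMap Poly₃ B p * (Pi.single N₀ 1 : Idx → B) N := by
    intro N N₀ p
    by_cases hN : N = N₀
    · subst hN; simp
    · simp [hN]
  have aux : ∀ a s : B, e * (a + algebraMap Poly₃ B connDen * s) = 0 → e * a + s = 0 :=
    fun a s h => by linear_combination h - s * he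
  intro j
  fin_cases j
  · simp only [Fin.zero_eta, EulerAction.horn_zero, h 0 (false, false, false) rfl,
      h 2 (false, false, false) rfl, conn_θ_single, h 0 (false, false, true) rfl, Idx.ins,
      Matrix.cons_val_zero, Matrix.cons_val]
    funext N
    have := hz 0 N
    simp only [hornCoeff, Matrix.cons_val_zero, map_add, map_sub, map_mul, hif, map_one] at this
    simp only [Pi.add_apply, Pi.sub_apply, Pi.smul_apply, Pi.zero_apply]
    simp only [Algebra.smul_def, map_add, map_sub, map_mul, map_one]
    linear_combination aux _ _ this
  · simp only [Fin.mk_one, EulerAction.horn_one, h 1 (false, false, false) rfl,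
      h 2 (false, false, false) rfl, conn_θ_single, h 1 (false, false, true) rfl, Idx.ins,
      Matrix.cons_val]
    funext N
    have := hz 1 N
    simp only [hornCoeff, Matrix.cons_val_one, Matrix.cons_val_zero, map_add, map_sub, map_mul,
      hif, map_one] at this
    simp only [Pi.add_apply, Pi.sub_apply, Pi.smul_apply, Pi.zero_apply]
    simp only [Algebra.smul_def, map_add, map_sub, map_mul, map_one]
    linear_combination aux _ _ this
  · simp only [Fin.reduceFinMk, EulerAction.horn_two, h 0 (false, false, false) rfl,
      h 2 (false, false, false) rfl, conn_θ_single, h 1 (false, false, true) rfl,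
      h 0 (false, false, true) rfl, Idx.ins, Matrix.cons_val_zero, Matrix.cons_val]
    funext N
    have := hz 2 N
    simp only [hornCoeff, Matrix.cons_val, map_add, map_sub, map_mul, hif, map_one] at this
    simp only [Pi.add_apply, Pi.sub_apply, Pi.smul_apply, Pi.zero_apply]
    simp only [Algebra.smul_def, map_add, map_sub, map_mul, map_one]
    linear_combination aux _ _ this

end EulerRing

/-! ### Rational functions as a differential field -/

section FractionDerivation

variable {R : Type} [CommRing R] [Algebra ℂ R] (D : Derivation ℂ R R)

/-- A derivation as a ring homomorphism to the dual numbers over the fraction field. -/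
noncomputable def derivationToDual : R →+* TrivSqZeroExt (FractionRing R) (FractionRing R) where
  toFun a := (algebraMap R (FractionRing R) a, algebraMap R (FractionRing R) (D a))
  map_one' := by
    ext <;> simp [TrivSqZeroExt.fst, TrivSqZeroExt.snd] <;> rfl
  map_zero' := by
    ext <;> simp [TrivSqZeroExt.fst, TrivSqZeroExt.snd] <;> rfl
  map_mul' a b := by
    ext
    · exact map_mul _ a b
    · change algebraMap R (FractionRing R) (D (a * b)) =
        algebraMap R (FractionRing R) a * algebraMap R (FractionRing R) (D b) +
          algebraMap R (FractionRing R) (D a) * algebraMap R (FractionRing R) b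
      rw [D.leibniz, smul_eq_mul, smul_eq_mul, map_add, map_mul, map_mul]
      ring
  map_add' a b := by
    ext
    · exact map_add _ a b
    · change algebraMap R (FractionRing R) (D (a + b)) = _
      rw [map_add, map_add]
      rfl

/-- The extension of `derivationToDual` to the fraction field; its second component is
the quotient rule. -/
noncomputable def fractionToDual :
    FractionRing R →+* TrivSqZeroExt (FractionRing R) (FractionRing R) :=
  IsLocalization.lift (M := nonZeroDivisors R) (g := derivationToDual D) fun y =>
    TrivSqZeroExt.isUnit_iff_isUnit_fst.mpr
      (IsLocalization.map_units (FractionRing R) y)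

theorem fractionToDual_algebraMap (a : R) :
    fractionToDual D (algebraMap R (FractionRing R) a) = derivationToDual D a :=
  IsLocalization.lift_eq _ a

theorem fst_fractionToDual (x : FractionRing R) : (fractionToDual D x).fst = x := by
  have : ((TrivSqZeroExt.fstHom (FractionRing R) (FractionRing R) (FractionRing R)).toRingHom.comp
      (fractionToDual D)) = RingHom.id _ := by
    refine IsLocalization.ringHom_ext (nonZeroDivisors R) (RingHom.ext fun a => ?_)
    change (fractionToDual D (algebraMap R (FractionRing R) a)).fst = _
    rw [fractionToDual_algebraMap]
    rfl
  exact congrArg (fun f : FractionRing R →+* FractionRing R => f x) this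

/-- The extension of a derivation to the fraction field. -/
noncomputable def fractionDer : FractionRing R →+ FractionRing R where
  toFun x := (fractionToDual D x).snd
  map_zero' := by simp
  map_add' x y := by simp

theorem fractionDer_algebraMap (a : R) :
    fractionDer D (algebraMap R (FractionRing R) a) = algebraMap R (FractionRing R) (D a) := by
  change (fractionToDual D (algebraMap R (FractionRing R) a)).snd = _
  rw [fractionToDual_algebraMap]
  rfl

theorem fractionDer_mul (x y : FractionRing R) :
    fractionDer D (x * y) = x * fractionDer D y + fractionDer D x * y := by
  change (fractionToDual D (x * y)).snd = _
  rw [map_mul, TrivSqZeroExt.snd_mul, fst_fractionToDual, fst_fractionToDual]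
  rfl

end FractionDerivation

theorem eulerDer_comm (i j : Fin 3) (p : Poly₃) :
    eulerDer i (eulerDer j p) = eulerDer j (eulerDer i p) := by
  induction p using MvPolynomial.induction_on' with
  | monomial ν c => simp only [LaurentFun.eulerDer_monomial]; congr 1; ring
  | add p q hp hq => simp only [map_add, hp, hq]

/-- The Euler derivations of the field of rational functions. -/
noncomputable def ratEuler : EulerRing RatFun₃ where
  d i := fractionDer (eulerDer i)
  leib i := fractionDer_mul (eulerDer i)
  d_algebraMap i := fractionDer_algebraMap (eulerDer i)
  comm i j x := by
    obtain ⟨a, s, hs, rfl⟩ := IsFractionRing.div_surjective (A := Poly₃) x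
    have hs0 : algebraMap Poly₃ RatFun₃ s ≠ 0 := by
      simpa using nonZeroDivisors.ne_zero hs
    set x := algebraMap Poly₃ RatFun₃ a / algebraMap Poly₃ RatFun₃ s with hx
    have hsx : algebraMap Poly₃ RatFun₃ s * x = algebraMap Poly₃ RatFun₃ a := by
      rw [hx]; field_simp
    have h1 := congrArg (fun y => fractionDer (eulerDer i) (fractionDer (eulerDer j) y)) hsx
    have h2 := congrArg (fun y => fractionDer (eulerDer j) (fractionDer (eulerDer i) y)) hsx
    simp only [fractionDer_mul, map_add, fractionDer_algebraMap] at h1 h2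
    rw [eulerDer_comm i j s, eulerDer_comm i j a] at h1
    refine mul_left_cancel₀ hs0 ?_
    linear_combination h1 - h2

/-! ### The rational Weyl algebra acting on modules -/

namespace RatWeyl

theorem algebraMap_X_ne_zero (i : Fin 3) : algebraMap Poly₃ RatFun₃ (X i) ≠ 0 := by
  simp

theorem del_mul_ofRat_algebraMap (i : Fin 3) (p : Poly₃) :
    del i * ofRat (algebraMap Poly₃ RatFun₃ p) = ofRat (algebraMap Poly₃ RatFun₃ p) * del i
      + ofRat (algebraMap Poly₃ RatFun₃ (pderiv i p)) := by
  have h := RingQuot.mkAlgHom_rel ℂ (WeylRel.leibniz i p)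
  rw [map_add, map_mul, map_mul] at h
  exact h

theorem del_comm (i j : Fin 3) : del i * del j = del j * del i := by
  have h := RingQuot.mkAlgHom_rel ℂ (WeylRel.comm i j)
  rw [map_mul, map_mul] at h
  exact h

theorem ofRat_C (c : ℂ) : ofRat (algebraMap Poly₃ RatFun₃ (C c)) = algebraMap ℂ RatWeyl c := by
  have h := RingQuot.mkAlgHom_rel ℂ (WeylRel.const c)
  rw [AlgHom.commutes] at h
  rw [← h, ← MvPolynomial.algebraMap_eq, ← IsScalarTower.algebraMap_apply]
  rfl

theorem ofRat_mul_comm (x y : RatFun₃) : ofRat x * ofRat y = ofRat y * ofRat x := by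
  rw [← map_mul, mul_comm, map_mul]

/-- The quotient rule in the rational Weyl algebra. -/
theorem del_mul_ofRat (i : Fin 3) (x : RatFun₃) : ∃ y, del i * ofRat x
    = ofRat x * del i + ofRat y := by
  obtain ⟨a, s, hs, rfl⟩ := IsFractionRing.div_surjective (A := Poly₃) x
  have hs0 : algebraMap Poly₃ RatFun₃ s ≠ 0 := by simpa using nonZeroDivisors.ne_zero hs
  set x := algebraMap Poly₃ RatFun₃ a / algebraMap Poly₃ RatFun₃ s with hx
  have hsx : algebraMap Poly₃ RatFun₃ s * x = algebraMap Poly₃ RatFun₃ a := by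
    rw [hx]; field_simp
  refine ⟨(algebraMap Poly₃ RatFun₃ s)⁻¹ * (algebraMap Poly₃ RatFun₃ (pderiv i a)
    - algebraMap Poly₃ RatFun₃ (pderiv i s) * x), ?_⟩
  have h := del_mul_ofRat_algebraMap i a
  rw [← hsx, map_mul, ← mul_assoc, del_mul_ofRat_algebraMap, add_mul, ← map_mul ofRat] at h
  have h2 : ofRat (algebraMap Poly₃ RatFun₃ s)⁻¹ * ofRat (algebraMap Poly₃ RatFun₃ s) = 1 := by
    rw [← map_mul, inv_mul_cancel₀ hs0, map_one]
  have h3 : ofRat (algebraMap Poly₃ RatFun₃ s) * (del i * ofRat x) =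
      ofRat (algebraMap Poly₃ RatFun₃ s) * (ofRat x * del i)
      + ofRat (algebraMap Poly₃ RatFun₃ (pderiv i a)
        - algebraMap Poly₃ RatFun₃ (pderiv i s) * x) := by
    rw [map_sub, ← mul_assoc, ← mul_assoc]
    rw [eq_sub_of_add_eq h, ← map_mul ofRat]
    abel
  have h4 := congrArg (fun w => ofRat (algebraMap Poly₃ RatFun₃ s)⁻¹ * w) h3
  simp only [mul_add, ← mul_assoc, h2, one_mul] at h4
  rw [map_mul]
  simpa only [mul_assoc] using h4

/-- The Euler operator `θ_i = z_i ∂_i`. -/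
noncomputable def theta (i : Fin 3) : RatWeyl := var i * del i

theorem theta_mul_ofRat (i : Fin 3) (p : Poly₃) :
    theta i * ofRat (algebraMap Poly₃ RatFun₃ p) = ofRat (algebraMap Poly₃ RatFun₃ p) * theta i
      + ofRat (algebraMap Poly₃ RatFun₃ (eulerDer i p)) := by
  rw [theta, mul_assoc, del_mul_ofRat_algebraMap, mul_add, ← mul_assoc, var, ofRat_mul_comm,
    mul_assoc, eulerDer_apply, map_mul, map_mul]

theorem theta_comm (i j : Fin 3) : theta i * theta j = theta j * theta i := by
  by_cases h : i = j
  · rw [h]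
  have key : ∀ {i j : Fin 3}, i ≠ j → theta i * theta j = var i * var j * (del i * del j) := by
    intro i j hij
    have : del i * var j = var j * del i := by
      rw [var, del_mul_ofRat_algebraMap, pderiv_X_of_ne (Ne.symm hij), map_zero, map_zero, add_zero]
    rw [theta, theta, mul_assoc, ← mul_assoc (del i), this]
    simp only [mul_assoc]
  rw [key h, key (Ne.symm h), del_comm, var, var, ofRat_mul_comm]

/-- The Horn operators of the Weyl algebra act by the Horn operators of the underlying
action of the Euler operators. -/
theorem horn_smul {M : Type} [AddCommGroup M] [Module RatWeyl M] [Module Poly₃ M]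
    (T : EulerAction M)
    (hp : ∀ (p : Poly₃) (m : M), p • m = ofRat (algebraMap Poly₃ RatFun₃ p) • m)
    (hθ : ∀ (i : Fin 3) (m : M), T.θ i m = theta i • m) (J : Par → ℂ) (j : Fin 3) (m : M) :
    T.horn J m j = horn J j • m := by
  have hl : ∀ (s : Finset (Fin 3)) (c : ℂ) (m : M), T.lin s c m = euler s c • m := by
    intro s c m
    rw [EulerAction.lin, euler, add_smul, Finset.sum_smul, hp, ofRat_C]
    simp only [hθ, theta]
  fin_cases j
  · simp only [Fin.zero_eta, EulerAction.horn, horn, Matrix.cons_val_zero, hl, hp, sub_smul,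
      mul_smul, var]
  · simp only [Fin.mk_one, EulerAction.horn, horn, Matrix.cons_val_one, Matrix.cons_val_zero, hl,
      hp, sub_smul, mul_smul, var]
  · simp only [Fin.reduceFinMk, EulerAction.horn, horn, Matrix.cons_val, hl, hp, sub_smul,
      mul_smul, var]

/-- The algebra generators of the rational Weyl algebra. -/
theorem induction {P : RatWeyl → Prop} (hr : ∀ r, P (ofRat r)) (hd : ∀ i, P (del i))
    (ha : ∀ a b, P a → P b → P (a + b)) (hm : ∀ a b, P a → P b → P (a * b)) (a : RatWeyl) :
    P a := by
  obtain ⟨w, rfl⟩ := RingQuot.mkAlgHom_surjective ℂ WeylRel a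
  induction w using FreeAlgebra.induction with
  | grade0 c =>
    rw [AlgHom.commutes, ← ofRat_C]
    exact hr _
  | grade1 x =>
    rcases x with r | i
    · exact hr r
    · exact hd i
  | mul a b h1 h2 => rw [map_mul]; exact hm _ _ h1 h2
  | add a b h1 h2 => rw [map_add]; exact ha _ _ h1 h2

end RatWeyl

/-! ### The holonomic rank -/

section Rank

open RatWeyl

noncomputable instance instModulePolyHornModule (J : Par → ℂ) : Module Poly₃ (HornModule J) :=
  Module.compHom (HornModule J) (ofRat.comp (algebraMap Poly₃ RatFun₃))

/-- The Euler operators on the module of the Horn system. -/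
noncomputable def hornModuleAction (J : Par → ℂ) : EulerAction (HornModule J) where
  θ i := DistribSMul.toAddMonoidHom (HornModule J) (theta i)
  leib i p m := by
    change theta i • (ofRat (algebraMap Poly₃ RatFun₃ p) • m) =
      ofRat (algebraMap Poly₃ RatFun₃ p) • (theta i • m)
        + ofRat (algebraMap Poly₃ RatFun₃ (eulerDer i p)) • m
    rw [← mul_smul, theta_mul_ofRat, add_smul, mul_smul]
  comm i j m := by
    change theta i • theta j • m = theta j • theta i • m
    rw [← mul_smul, theta_comm, mul_smul]

/-- The class of `1` in the module of the Horn system. -/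
noncomputable def hornOne (J : Par → ℂ) : HornModule J := (hornIdeal J).mkQ 1

theorem isSol_hornOne (J : Par → ℂ) : (hornModuleAction J).IsSol J (hornOne J) := by
  intro j
  rw [horn_smul (hornModuleAction J) (fun _ _ => rfl) (fun _ _ => rfl), hornOne, ← map_smul,
    smul_eq_mul, mul_one]
  exact (Submodule.Quotient.mk_eq_zero _).mpr (Submodule.subset_span ⟨j, rfl⟩)

theorem ratFun_smul (J : Par → ℂ) (r : RatFun₃) (m : HornModule J) : r • m = ofRat r • m := rfl

theorem poly_smul (J : Par → ℂ) (p : Poly₃) (m : HornModule J) :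
    p • m = algebraMap Poly₃ RatFun₃ p • m := rfl

theorem algebraMap_connDen_ne_zero : algebraMap Poly₃ RatFun₃ connDen ≠ 0 := by
  simpa using connDen_ne_zero

theorem span_mono_hornOne (J : Par → ℂ) :
    Submodule.span RatFun₃ (Set.range fun K => (hornModuleAction J).mono K (hornOne J)) = ⊤ := by
  set T := hornModuleAction J with hT
  set S := Submodule.span RatFun₃ (Set.range fun K => T.mono K (hornOne J)) with hS
  have hK : ∀ K, T.mono K (hornOne J) ∈ S := fun K => Submodule.subset_span ⟨K, rfl⟩
  have hθ : ∀ i K, theta i • T.mono K (hornOne J) ∈ S := by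
    intro i K
    have h := connDen_smul_θ_mono (isSol_hornOne J) i K
    have h' : theta i • T.mono K (hornOne J) = (algebraMap Poly₃ RatFun₃ connDen)⁻¹ •
        ∑ L, connMat i K L J • T.mono L (hornOne J) := by
      rw [← h, poly_smul, smul_smul, inv_mul_cancel₀ algebraMap_connDen_ne_zero, one_smul]
      rfl
    rw [h']
    refine S.smul_mem _ (S.sum_mem fun L _ => ?_)
    rw [poly_smul]
    exact S.smul_mem _ (hK L)
  have hdel : ∀ i K, del i • T.mono K (hornOne J) ∈ S := by
    intro i K
    have : del i = ofRat (algebraMap Poly₃ RatFun₃ (X i))⁻¹ * theta i := by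
      rw [theta, var, ← mul_assoc, ← map_mul, inv_mul_cancel₀ (algebraMap_X_ne_zero i), map_one,
        one_mul]
    rw [this, mul_smul]
    exact S.smul_mem _ (hθ i K)
  have key : ∀ a : RatWeyl, ∀ m ∈ S, a • m ∈ S := by
    intro a
    induction a using RatWeyl.induction with
    | hr r => exact fun m hm => S.smul_mem r hm
    | hd i =>
      intro m hm
      induction hm using Submodule.span_induction with
      | mem x hx => obtain ⟨K, rfl⟩ := hx; exact hdel i K
      | zero => rw [smul_zero]; exact S.zero_mem
      | add x y _ _ hx hy => rw [smul_add]; exact S.add_mem hx hy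
      | smul r x hx h =>
        obtain ⟨y, hy⟩ := del_mul_ofRat i r
        rw [ratFun_smul, ← mul_smul, hy, add_smul, mul_smul]
        exact S.add_mem (S.smul_mem r h) (S.smul_mem y hx)
    | ha a b h1 h2 =>
      intro m hm
      rw [add_smul]
      exact S.add_mem (h1 m hm) (h2 m hm)
    | hm a b h1 h2 =>
      intro m hm
      rw [mul_smul]
      exact h1 _ (h2 m hm)
  refine eq_top_iff.mpr fun m _ => ?_
  obtain ⟨a, rfl⟩ := (hornIdeal J).mkQ_surjective m
  have h := key a (hornOne J) (hK (false, false, false))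
  rwa [hornOne, ← map_smul, smul_eq_mul, mul_one] at h

theorem connDen_mul_inv_ratFun : algebraMap Poly₃ RatFun₃ connDen *
    (algebraMap Poly₃ RatFun₃ connDen)⁻¹ = 1 :=
  mul_inv_cancel₀ algebraMap_connDen_ne_zero

theorem EulerRing.conn_leib {B : Type} [CommRing B] [Algebra Poly₃ B] (R : EulerRing B)
    (J : Par → ℂ) {e : B} (he : algebraMap Poly₃ B connDen * e = 1) (i : Fin 3) (b : B)
    (v : Idx → B) :
    (R.conn J he).θ i (b • v) = b • (R.conn J he).θ i v + R.d i b • v := by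
  funext N
  change R.d i (b * v N) + e * ∑ L, b * v L * _ = b * (R.d i (v N) + e * ∑ L, v L * _)
    + R.d i b * v N
  simp only [R.leib, mul_assoc, ← Finset.mul_sum]
  ring

/-- The connection on `ℂ(z)⁸`. -/
noncomputable abbrev ratConn (J : Par → ℂ) : EulerAction (Idx → RatFun₃) :=
  ratEuler.conn J connDen_mul_inv_ratFun

theorem ratConn_smul_complex (J : Par → ℂ) (i : Fin 3) (c : ℂ) (v : Idx → RatFun₃) :
    (ratConn J).θ i (c • v) = c • (ratConn J).θ i v := by
  have h : ∀ v : Idx → RatFun₃, c • v = (C c : Poly₃) • v := fun v => by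
    rw [← MvPolynomial.algebraMap_eq, algebraMap_smul]
  rw [h, h, EulerAction.θ_C]

/-- The generators of the rational Weyl algebra acting on `ℂ(z)⁸` through the connection. -/
noncomputable def ratConnGen (J : Par → ℂ) : RatFun₃ ⊕ Fin 3 → Module.End ℂ (Idx → RatFun₃)
  | .inl r => LinearMap.lsmul RatFun₃ (Idx → RatFun₃) r |>.restrictScalars ℂ
  | .inr i =>
    { toFun := fun v => (algebraMap Poly₃ RatFun₃ (X i))⁻¹ • (ratConn J).θ i v
      map_add' := fun v w => by rw [map_add, smul_add]
      map_smul' := fun c v => by rw [ratConn_smul_complex, smul_comm, RingHom.id_apply] }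

theorem ratEuler_d_inv_X {i j : Fin 3} (h : i ≠ j) :
    ratEuler.d i (algebraMap Poly₃ RatFun₃ (X j))⁻¹ = 0 := by
  have h1 := congrArg (ratEuler.d i) (mul_inv_cancel₀ (algebraMap_X_ne_zero j))
  rw [ratEuler.leib, ratEuler.d_algebraMap, eulerDer_X, if_neg h, map_zero, zero_mul, add_zero,
    ratEuler.d_one] at h1
  exact (mul_eq_zero.mp h1).resolve_left (algebraMap_X_ne_zero j)

/-- The action of the rational Weyl algebra on `ℂ(z)⁸` through the connection. -/
noncomputable def ratConnRep (J : Par → ℂ) : RatWeyl →ₐ[ℂ] Module.End ℂ (Idx → RatFun₃) :=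
  RingQuot.liftAlgHom ℂ ⟨FreeAlgebra.lift ℂ (ratConnGen J), by
    intro x y h
    induction h with
    | const c =>
      rw [FreeAlgebra.lift_ι_apply, AlgHom.commutes]
      refine LinearMap.ext fun v => ?_
      change algebraMap ℂ RatFun₃ c • v = c • v
      rw [algebraMap_smul]
    | add f g =>
      simp only [map_add, FreeAlgebra.lift_ι_apply]
      refine LinearMap.ext fun v => ?_
      exact add_smul f g v
    | mul f g =>
      simp only [map_mul, FreeAlgebra.lift_ι_apply]
      refine LinearMap.ext fun v => ?_
      exact mul_smul f g v
    | comm i j =>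
      simp only [map_mul, FreeAlgebra.lift_ι_apply]
      by_cases hij : i = j
      · rw [hij]
      refine LinearMap.ext fun v => ?_
      change (algebraMap Poly₃ RatFun₃ (X i))⁻¹ • (ratConn J).θ i
          ((algebraMap Poly₃ RatFun₃ (X j))⁻¹ • (ratConn J).θ j v)
        = (algebraMap Poly₃ RatFun₃ (X j))⁻¹ • (ratConn J).θ j
          ((algebraMap Poly₃ RatFun₃ (X i))⁻¹ • (ratConn J).θ i v)
      rw [ratEuler.conn_leib, ratEuler.conn_leib, ratEuler_d_inv_X hij,
        ratEuler_d_inv_X (Ne.symm hij), zero_smul, zero_smul, add_zero, add_zero,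
        (ratConn J).comm i j, smul_comm]
    | leibniz i p =>
      simp only [map_mul, map_add, FreeAlgebra.lift_ι_apply]
      refine LinearMap.ext fun v => ?_
      change (algebraMap Poly₃ RatFun₃ (X i))⁻¹ • (ratConn J).θ i (algebraMap Poly₃ RatFun₃ p • v)
        = algebraMap Poly₃ RatFun₃ p • ((algebraMap Poly₃ RatFun₃ (X i))⁻¹ • (ratConn J).θ i v)
          + algebraMap Poly₃ RatFun₃ (pderiv i p) • v
      rw [ratEuler.conn_leib, smul_add, ratEuler.d_algebraMap, eulerDer_apply, map_mul, smul_smul,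
        smul_smul, smul_smul, inv_mul_cancel_left₀ (algebraMap_X_ne_zero i), mul_comm]⟩

theorem ratConnRep_mk_ι (J : Par → ℂ) (x : RatFun₃ ⊕ Fin 3) :
    ratConnRep J (RatWeyl.mk (FreeAlgebra.ι ℂ x)) = ratConnGen J x := by
  rw [ratConnRep, RatWeyl.mk, RingQuot.liftAlgHom_mkAlgHom_apply, FreeAlgebra.lift_ι_apply]

/-- The map from the module of the Horn system to `ℂ(z)⁸` that sends the class of `1` to the first
basis vector sends the squarefree monomials to the basis. -/
theorem linearIndependent_mono_hornOne (J : Par → ℂ) :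
    LinearIndependent RatFun₃ fun K => (hornModuleAction J).mono K (hornOne J) := by
  let _ : Module RatWeyl (Idx → RatFun₃) :=
    Module.compHom (Idx → RatFun₃) (ratConnRep J).toRingHom
  have hr : ∀ (r : RatFun₃) (v : Idx → RatFun₃), ofRat r • v = r • v := fun r v =>
    congrArg (fun f : Module.End ℂ (Idx → RatFun₃) => f v) (ratConnRep_mk_ι J (Sum.inl r))
  have hd : ∀ (i : Fin 3) (v : Idx → RatFun₃),
      del i • v = (algebraMap Poly₃ RatFun₃ (X i))⁻¹ • (ratConn J).θ i v := fun i v =>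
    congrArg (fun f : Module.End ℂ (Idx → RatFun₃) => f v) (ratConnRep_mk_ι J (Sum.inr i))
  have hθ : ∀ (i : Fin 3) (v : Idx → RatFun₃), (ratConn J).θ i v = theta i • v := by
    intro i v
    rw [theta, mul_smul, hd, var, hr, smul_smul, mul_inv_cancel₀ (algebraMap_X_ne_zero i),
      one_smul]
  have hp : ∀ (p : Poly₃) (v : Idx → RatFun₃),
      p • v = ofRat (algebraMap Poly₃ RatFun₃ p) • v := by
    intro p v
    rw [hr, algebraMap_smul]
  let e₀ : Idx → RatFun₃ := Pi.single (false, false, false) 1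
  have hker : hornIdeal J ≤ LinearMap.ker (LinearMap.toSpanSingleton RatWeyl _ e₀) := by
    refine Submodule.span_le.mpr ?_
    rintro _ ⟨j, rfl⟩
    rw [SetLike.mem_coe, LinearMap.mem_ker, LinearMap.toSpanSingleton_apply,
      ← horn_smul (ratConn J) hp hθ]
    exact ratEuler.conn_isSol J connDen_mul_inv_ratFun j
  let F : HornModule J →ₗ[RatWeyl] (Idx → RatFun₃) := (hornIdeal J).liftQ _ hker
  have hF1 : F (hornOne J) = e₀ := by
    change LinearMap.toSpanSingleton RatWeyl _ e₀ 1 = e₀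
    rw [LinearMap.toSpanSingleton_apply, one_smul]
  have hFθ : ∀ i m, F ((hornModuleAction J).θ i m) = (ratConn J).θ i (F m) := by
    intro i m
    rw [hθ, ← map_smul]
    rfl
  have hFm : ∀ K, F ((hornModuleAction J).mono K (hornOne J)) = Pi.single K 1 := by
    intro K
    rw [← ratEuler.conn_mono J connDen_mul_inv_ratFun K]
    change _ = (ratConn J).mono K e₀
    rw [← hF1]
    obtain ⟨a, b, c⟩ := K
    cases a <;> cases b <;> cases c <;>
      simp only [EulerAction.mono, cond_true, cond_false, hFθ]
  refine Fintype.linearIndependent_iff.mpr fun g hg K => ?_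
  have h := congrArg F hg
  rw [map_sum, map_zero] at h
  have h2 : ∀ L, F (g L • (hornModuleAction J).mono L (hornOne J)) =
      g L • (Pi.single L 1 : Idx → RatFun₃) := by
    intro L
    rw [ratFun_smul, map_smul, hr, hFm]
  simp only [h2] at h
  have h3 := congrFun h K
  rw [Finset.sum_apply, Finset.sum_eq_single K] at h3
  · simpa using h3
  · intro L _ hL
    rw [Pi.smul_apply, Pi.single_eq_of_ne (Ne.symm hL), smul_zero]
  · simp

theorem holonomicRank_eq (J : Par → ℂ) : holonomicRank J = 8 := by
  rw [holonomicRank, rank_eq_card_basis (Module.Basis.mk (linearIndependent_mono_hornOne J)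
    (span_mono_hornOne J).ge)]
  rfl

end Rank

end Algebra

/-! ### Convergent power series in three variables -/

/-- Formal power series in three variables. -/
abbrev Series₃ : Type := MvPowerSeries (Fin 3) ℂ

/-- The total degree of an exponent. -/
def tdeg (n : Fin 3 →₀ ℕ) : ℕ := n 0 + n 1 + n 2

theorem tdeg_add (m n : Fin 3 →₀ ℕ) : tdeg (m + n) = tdeg m + tdeg n := by
  simp only [tdeg, Finsupp.add_apply]; ring

theorem tdeg_single (i : Fin 3) : tdeg (Finsupp.single i 1) = 1 := by
  fin_cases i <;> simp [tdeg]

/-- The monomial `w^n`. -/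
noncomputable def mon (n : Fin 3 →₀ ℕ) (w : Fin 3 → ℂ) : ℂ := w 0 ^ n 0 * w 1 ^ n 1 * w 2 ^ n 2

theorem mon_zero (w : Fin 3 → ℂ) : mon 0 w = 1 := by simp [mon]

theorem mon_add (m n : Fin 3 →₀ ℕ) (w : Fin 3 → ℂ) : mon (m + n) w = mon m w * mon n w := by
  simp only [mon, Finsupp.add_apply, pow_add]; ring

theorem mon_single (i : Fin 3) (w : Fin 3 → ℂ) : mon (Finsupp.single i 1) w = w i := by
  fin_cases i <;> simp [mon]

theorem norm_mon_le {w : Fin 3 → ℂ} {r : ℝ} (hw : ∀ i, ‖w i‖ ≤ r) (n : Fin 3 →₀ ℕ) :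
    ‖mon n w‖ ≤ r ^ tdeg n := by
  have hr : 0 ≤ r := (norm_nonneg _).trans (hw 0)
  simp only [mon, norm_mul, norm_pow, tdeg, pow_add]
  have h := fun i => pow_le_pow_left₀ (norm_nonneg _) (hw i) (n i)
  exact mul_le_mul (mul_le_mul (h 0) (h 1) (by positivity) (by positivity)) (h 2) (by positivity)
    (by positivity)

theorem summable_half_pow_tdeg : Summable fun n : Fin 3 →₀ ℕ => ((1 : ℝ) / 2) ^ tdeg n := by
  have hg : Summable fun k : ℕ => ((1 : ℝ) / 2) ^ k := summable_geometric_two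
  have h3 := hg.mul_of_nonneg (hg.mul_of_nonneg hg (fun _ => by positivity)
    (fun _ => by positivity)) (fun _ => by positivity) (fun _ => by positivity)
  refine (h3.comp_injective (i := fun n : Fin 3 →₀ ℕ => (n 0, n 1, n 2)) ?_).congr ?_
  · intro m n h
    simp only [Prod.mk.injEq] at h
    ext i
    fin_cases i
    · exact h.1
    · exact h.2.1
    · exact h.2.2
  · intro n
    simp only [Function.comp_apply, tdeg, pow_add]
    ring

/-- The coefficients of `f` grow at most geometrically. -/
def GeomBdd (f : Series₃) : Prop :=
  ∃ K R : ℝ, 0 ≤ K ∧ 1 ≤ R ∧ ∀ n, ‖MvPowerSeries.coeff n f‖ ≤ K * R ^ tdeg n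

namespace GeomBdd

open MvPowerSeries

theorem add {f g : Series₃} (hf : GeomBdd f) (hg : GeomBdd g) : GeomBdd (f + g) := by
  obtain ⟨K, R, hK, hR, hf⟩ := hf
  obtain ⟨K', R', hK', hR', hg⟩ := hg
  refine ⟨K + K', max R R', by positivity, le_max_of_le_left hR, fun n => ?_⟩
  rw [map_add, add_mul]
  refine (norm_add_le _ _).trans (add_le_add ((hf n).trans ?_) ((hg n).trans ?_))
  · gcongr; exact le_max_left _ _
  · gcongr; exact le_max_right _ _

theorem const_mul {f : Series₃} (hf : GeomBdd f) (c : ℂ) :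
    GeomBdd (C c * f) := by
  obtain ⟨K, R, hK, hR, hf⟩ := hf
  refine ⟨‖c‖ * K, R, by positivity, hR, fun n => ?_⟩
  rw [coeff_C_mul, norm_mul, mul_assoc]
  gcongr
  exact hf n

theorem coeff_X_mul (i : Fin 3) (f : Series₃) (n : Fin 3 →₀ ℕ) : coeff n (X i * f)
    = if Finsupp.single i 1 ≤ n then coeff (n - Finsupp.single i 1) f else 0 := by
  rw [X_def, coeff_monomial_mul, one_mul]

theorem X_mul {f : Series₃} (hf : GeomBdd f) (i : Fin 3) : GeomBdd (X i * f) := by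
  obtain ⟨K, R, hK, hR, hf⟩ := hf
  refine ⟨K, R, hK, hR, fun n => ?_⟩
  rw [coeff_X_mul]
  split_ifs with h
  · refine (hf _).trans ?_
    gcongr
    have := congrArg tdeg (tsub_add_cancel_of_le h)
    rw [tdeg_add] at this
    omega
  · rw [norm_zero]; positivity

theorem pderiv {f : Series₃} (hf : GeomBdd f) (i : Fin 3) : GeomBdd (pderiv ℂ i f) := by
  obtain ⟨K, R, hK, hR, hf⟩ := hf
  refine ⟨K * R, 2 * R, by positivity, by linarith, fun n => ?_⟩
  rw [coeff_pderiv, norm_mul]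
  have h1 : ‖((n i : ℂ) + 1)‖ ≤ 2 ^ tdeg n := by
    have h2 : n i + 1 ≤ 2 ^ tdeg n := by
      have h3 : n i ≤ tdeg n := by fin_cases i <;> simp [tdeg] <;> omega
      have h4 : tdeg n < 2 ^ tdeg n := Nat.lt_two_pow_self
      omega
    have h5 : ((n i : ℂ) + 1) = ((n i + 1 : ℕ) : ℂ) := by push_cast; rfl
    rw [h5, Complex.norm_natCast]
    exact_mod_cast h2
  have h2 := hf (n + Finsupp.single i 1)
  rw [tdeg_add, tdeg_single, pow_succ] at h2
  calc _ ≤ (K * (R ^ tdeg n * R)) * 2 ^ tdeg n := by gcongr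
    _ = K * R * (2 * R) ^ tdeg n := by rw [mul_pow]; ring

/-- A radius on which the series is dominated by a geometric one. -/
theorem exists_radius {f : Series₃} (hf : GeomBdd f) : ∃ K r : ℝ, 0 ≤ K ∧ 0 < r ∧
    ∀ n, ‖coeff n f‖ * r ^ tdeg n ≤ K * (1 / 2) ^ tdeg n := by
  obtain ⟨K, R, hK, hR, hf⟩ := hf
  have hR0 : 0 < R := by linarith
  refine ⟨K, 1 / (2 * R), hK, by positivity, fun n => ?_⟩
  calc _ ≤ (K * R ^ tdeg n) * (1 / (2 * R)) ^ tdeg n := by gcongr; exact hf n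
    _ = K * (1 / 2) ^ tdeg n := by
      rw [mul_assoc, ← mul_pow]
      congr 2
      field_simp

end GeomBdd

open MvPowerSeries in
/-- The sum of a power series in `z - p`. -/
noncomputable def psum (p : Fin 3 → ℂ) (f : Series₃) (z : Fin 3 → ℂ) : ℂ :=
  ∑' n : Fin 3 →₀ ℕ, coeff n f * mon n (z - p)

section Sum

open MvPowerSeries Filter Topology

variable {p : Fin 3 → ℂ} {f g : Series₃}

theorem norm_coeff_mul_mon_le {K r : ℝ}
    (h : ∀ n, ‖coeff n f‖ * r ^ tdeg n ≤ K * (1 / 2) ^ tdeg n) {w : Fin 3 → ℂ}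
    (hw : ∀ i, ‖w i‖ ≤ r) (n : Fin 3 →₀ ℕ) : ‖coeff n f * mon n w‖ ≤ K * (1 / 2) ^ tdeg n := by
  rw [norm_mul]
  exact (mul_le_mul_of_nonneg_left (norm_mon_le hw n) (norm_nonneg _)).trans (h n)

theorem summable_of_radius {K r : ℝ}
    (h : ∀ n, ‖coeff n f‖ * r ^ tdeg n ≤ K * (1 / 2) ^ tdeg n) {w : Fin 3 → ℂ}
    (hw : ∀ i, ‖w i‖ ≤ r) : Summable fun n => coeff n f * mon n w :=
  Summable.of_norm_bounded (summable_half_pow_tdeg.mul_left K) (norm_coeff_mul_mon_le h hw)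

theorem eventually_norm_sub_le {r : ℝ} (hr : 0 < r) (p : Fin 3 → ℂ) :
    ∀ᶠ z in 𝓝 p, ∀ i, ‖(z - p) i‖ ≤ r := by
  filter_upwards [Metric.ball_mem_nhds p hr] with z hz i
  rw [Metric.mem_ball, dist_eq_norm] at hz
  exact (norm_le_pi_norm (z - p) i).trans hz.le

theorem eventually_summable (hf : GeomBdd f) (p : Fin 3 → ℂ) :
    ∀ᶠ z in 𝓝 p, Summable fun n => coeff n f * mon n (z - p) := by
  obtain ⟨K, r, hK, hr, h⟩ := hf.exists_radius
  filter_upwards [eventually_norm_sub_le hr p] with z hz using summable_of_radius h hz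

theorem psum_add (hf : GeomBdd f) (hg : GeomBdd g) (p : Fin 3 → ℂ) :
    ∀ᶠ z in 𝓝 p, psum p (f + g) z = psum p f z + psum p g z := by
  filter_upwards [eventually_summable hf p, eventually_summable hg p] with z h1 h2
  rw [psum, psum, psum, ← h1.tsum_add h2]
  simp only [map_add, add_mul]

theorem psum_C_mul (c : ℂ) (f : Series₃) (p z : Fin 3 → ℂ) :
    psum p (C c * f) z = c * psum p f z := by
  rw [psum, psum, ← tsum_mul_left]
  simp only [coeff_C_mul, mul_assoc]

theorem psum_X_mul (i : Fin 3) (f : Series₃) (p z : Fin 3 → ℂ) :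
    psum p (X i * f) z = (z - p) i * psum p f z := by
  rw [psum, psum, ← tsum_mul_left]
  have hinj : Function.Injective fun n : Fin 3 →₀ ℕ => n + Finsupp.single i 1 :=
    add_left_injective _
  rw [← hinj.tsum_eq]
  · refine tsum_congr fun n => ?_
    rw [GeomBdd.coeff_X_mul, if_pos (le_add_left le_rfl), add_tsub_cancel_right, mon_add,
      mon_single]
    ring
  · intro n hn
    rw [Function.mem_support, GeomBdd.coeff_X_mul] at hn
    split_ifs at hn with h
    · exact ⟨n - Finsupp.single i 1, tsub_add_cancel_of_le h⟩
    · simp at hn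

theorem psum_self (p : Fin 3 → ℂ) (f : Series₃) : psum p f p = constantCoeff f := by
  rw [psum, tsum_eq_single 0]
  · simp [mon_zero]
  · intro n hn
    rw [sub_self]
    have : ∃ i, n i ≠ 0 := by
      by_contra hc
      push Not at hc
      exact hn (Finsupp.ext hc)
    obtain ⟨i, hi⟩ := this
    have : mon n 0 = 0 := by fin_cases i <;> simp_all [mon]
    rw [this, mul_zero]

/-- The index list of a monomial, used to write it as a multilinear map on the diagonal. -/
def monList (n : Fin 3 →₀ ℕ) : List (Fin 3) :=
  List.replicate (n 0) 0 ++ List.replicate (n 1) 1 ++ List.replicate (n 2) 2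

theorem length_monList (n : Fin 3 →₀ ℕ) : (monList n).length = tdeg n := by
  simp [monList, tdeg, add_assoc]

theorem prod_map_monList (n : Fin 3 →₀ ℕ) (w : Fin 3 → ℂ) :
    ((monList n).map w).prod = mon n w := by
  simp [monList, mon, mul_assoc]

/-- A multilinear map of degree `m` that restricts to `w^n` on the diagonal if `|n| = m`. -/
noncomputable def monMultilinear (m : ℕ) (n : Fin 3 →₀ ℕ) :
    ContinuousMultilinearMap ℂ (fun _ : Fin m => Fin 3 → ℂ) ℂ :=
  (ContinuousMultilinearMap.mkPiAlgebraFin ℂ m ℂ).compContinuousLinearMap fun k =>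
    ContinuousLinearMap.proj (R := ℂ) (φ := fun _ : Fin 3 => ℂ) ((monList n).getD k 0)

theorem monMultilinear_apply (n : Fin 3 →₀ ℕ) (m : ℕ) (h : tdeg n = m) (w : Fin 3 → ℂ) :
    monMultilinear m n (fun _ => w) = mon n w := by
  rw [monMultilinear, ContinuousMultilinearMap.compContinuousLinearMap_apply,
    ContinuousMultilinearMap.mkPiAlgebraFin_apply, ← prod_map_monList]
  congr 1
  refine List.ext_getElem ?_ ?_
  · simp [length_monList, h]
  · intro k h1 h2
    have h3 : k < (monList n).length := by simpa using h2
    simp [List.getElem_map, List.getD_eq_getElem?_getD, h3]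

theorem norm_monMultilinear_le (m : ℕ) (n : Fin 3 →₀ ℕ) : ‖monMultilinear m n‖ ≤ 1 := by
  refine (ContinuousMultilinearMap.norm_compContinuousLinearMap_le _ _).trans ?_
  rw [ContinuousMultilinearMap.norm_mkPiAlgebraFin, one_mul]
  refine Finset.prod_le_one (fun _ _ => norm_nonneg _) fun k _ => ?_
  refine ContinuousLinearMap.opNorm_le_bound _ zero_le_one fun w => ?_
  rw [one_mul]
  exact norm_le_pi_norm w _

/-- The exponents of total degree `m`. -/
noncomputable def degFinset (m : ℕ) : Finset (Fin 3 →₀ ℕ) :=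
  Finset.finsuppAntidiag Finset.univ m

theorem mem_degFinset {m : ℕ} {n : Fin 3 →₀ ℕ} : n ∈ degFinset m ↔ tdeg n = m := by
  simp [degFinset, tdeg, Fin.sum_univ_three]

/-- A formal power series as a formal multilinear series. -/
noncomputable def toMultilinearSeries (f : Series₃) :
    FormalMultilinearSeries ℂ (Fin 3 → ℂ) ℂ :=
  fun m => ∑ n ∈ degFinset m, coeff n f • monMultilinear m n

theorem hasFPowerSeries_psum (hf : GeomBdd f) (p : Fin 3 → ℂ) :
    HasFPowerSeriesAt (psum p f) (toMultilinearSeries f) p := by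
  obtain ⟨K, r, hK, hr, h⟩ := hf.exists_radius
  lift r to NNReal using hr.le
  refine ⟨(r : ENNReal), ?_, ENNReal.coe_pos.mpr (by exact_mod_cast hr), ?_⟩
  · refine FormalMultilinearSeries.le_radius_of_bound _
      (K * ∑' n : Fin 3 →₀ ℕ, ((1 : ℝ) / 2) ^ tdeg n) fun m => ?_
    have h1 : ‖toMultilinearSeries f m‖ ≤ ∑ n ∈ degFinset m, ‖coeff n f‖ := by
      refine (norm_sum_le _ _).trans (Finset.sum_le_sum fun n _ => ?_)
      rw [norm_smul]
      exact mul_le_of_le_one_right (norm_nonneg _) (norm_monMultilinear_le m n)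
    calc ‖toMultilinearSeries f m‖ * r ^ m ≤ (∑ n ∈ degFinset m, ‖coeff n f‖) * r ^ m := by gcongr
      _ = ∑ n ∈ degFinset m, ‖coeff n f‖ * r ^ tdeg n := by
        rw [Finset.sum_mul]
        exact Finset.sum_congr rfl fun n hn => by rw [mem_degFinset.mp hn]
      _ ≤ ∑ n ∈ degFinset m, K * (1 / 2) ^ tdeg n := Finset.sum_le_sum fun n _ => h n
      _ = K * ∑ n ∈ degFinset m, ((1 : ℝ) / 2) ^ tdeg n := by rw [Finset.mul_sum]
      _ ≤ _ := by
        gcongr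
        exact summable_half_pow_tdeg.sum_le_tsum _ fun _ _ => by positivity
  · intro y hy
    have hy' : ∀ i, ‖y i‖ ≤ r := fun i => by
      rw [Metric.mem_eball, edist_zero_right, enorm_eq_nnnorm, ENNReal.coe_lt_coe] at hy
      exact (norm_le_pi_norm y i).trans (le_of_lt hy)
    have hs : HasSum (fun n => coeff n f * mon n y) (psum p f (p + y)) := by
      rw [psum, add_sub_cancel_left]
      exact (summable_of_radius h hy').hasSum
    have h2 := hs.tsum_fiberwise tdeg
    refine h2.congr_fun fun m => ?_
    have h3 : tdeg ⁻¹' {m} = ((degFinset m : Finset (Fin 3 →₀ ℕ)) : Set (Fin 3 →₀ ℕ)) := by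
      ext n
      simp [mem_degFinset]
    rw [h3, Finset.tsum_subtype' (degFinset m) (fun n => coeff n f * mon n y),
      toMultilinearSeries, sum_apply]
    refine Finset.sum_congr rfl fun n hn => ?_
    rw [smul_apply, monMultilinear_apply n m (mem_degFinset.mp hn), smul_eq_mul]

theorem analyticAt_psum (hf : GeomBdd f) (p : Fin 3 → ℂ) : AnalyticAt ℂ (psum p f) p :=
  ⟨_, hasFPowerSeries_psum hf p⟩

end Sum

section Deriv

open MvPowerSeries Filter Topology

variable {p : Fin 3 → ℂ} {f : Series₃}

theorem hasDerivAt_mon (i : Fin 3) (n : Fin 3 →₀ ℕ) (w : Fin 3 → ℂ) (t : ℂ) :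
    HasDerivAt (fun t : ℂ => mon n (w + t • Pi.single i 1))
      (n i * mon (n - Finsupp.single i 1) (w + t • Pi.single i 1)) t := by
  have h : ∀ (i : Fin 3) (k : ℕ),
      HasDerivAt (fun t : ℂ => (w i + t) ^ k) (k * (w i + t) ^ (k - 1)) t := fun i k => by
    have := ((hasDerivAt_id' t).const_add (w i)).pow k
    rw [mul_one] at this
    exact this
  fin_cases i
  · have := ((h 0 (n 0)).mul_const (w 1 ^ n 1)).mul_const (w 2 ^ n 2)
    simpa [mon, mul_assoc] using this
  · have := ((h 1 (n 1)).const_mul (w 0 ^ n 0)).mul_const (w 2 ^ n 2)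
    simpa [mon, mul_left_comm, mul_assoc] using this
  · have := (h 2 (n 2)).const_mul (w 0 ^ n 0 * w 1 ^ n 1)
    simpa [mon, mul_left_comm, mul_assoc] using this

/-- Power series may be differentiated termwise. -/
theorem fderiv_psum (hf : GeomBdd f) (p : Fin 3 → ℂ) (i : Fin 3) :
    ∀ᶠ z in 𝓝 p, fderiv ℂ (psum p f) z (Pi.single i 1) = psum p (pderiv ℂ i f) z := by
  obtain ⟨K₀, r₀, hK₀, hr₀, h₀⟩ := hf.exists_radius
  obtain ⟨K, r, hK, hr, h⟩ := (hf.pderiv i).exists_radius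
  filter_upwards [(analyticAt_psum hf p).eventually_analyticAt,
    eventually_norm_sub_le (half_pos hr) p, eventually_norm_sub_le hr₀ p] with z hz hzr hzr₀
  have hl := hz.differentiableAt.hasFDerivAt.hasLineDerivAt (Pi.single i 1)
  refine HasDerivAt.unique hl ?_
  have hb : ∀ y ∈ Metric.ball (0 : ℂ) (r / 2), ∀ j,
      ‖(z - p + y • (Pi.single i 1 : Fin 3 → ℂ)) j‖ ≤ r := by
    intro y hy j
    rw [mem_ball_zero_iff] at hy
    refine (norm_add_le _ _).trans ?_
    have h1 : ‖(y • (Pi.single i 1 : Fin 3 → ℂ)) j‖ ≤ ‖y‖ := by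
      by_cases hij : j = i
      · subst hij; simp
      · simp [Pi.single_eq_of_ne hij]
    linarith [hzr j]
  -- the derivative of the `n`-th term, indexed by the exponent before differentiation
  have hterm : ∀ n w, coeff n f * (n i * mon (n - Finsupp.single i 1) w)
      = if Finsupp.single i 1 ≤ n then coeff (n - Finsupp.single i 1) (pderiv ℂ i f)
          * mon (n - Finsupp.single i 1) w else 0 := by
    intro n w
    split_ifs with hn
    · rw [coeff_pderiv, tsub_add_cancel_of_le hn]
      have h1 : 1 ≤ n i := by simpa using hn i
      have h2 : (((n - Finsupp.single i 1 : Fin 3 →₀ ℕ) i : ℕ) : ℂ) + 1 = n i := by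
        rw [Finsupp.tsub_apply, Finsupp.single_eq_same]
        exact_mod_cast Nat.sub_add_cancel h1
      rw [h2]; ring
    · have h1 : n i = 0 := by
        by_contra hc
        exact hn (Finsupp.single_le_iff.mpr (Nat.one_le_iff_ne_zero.mpr hc))
      simp [h1]
  have key := hasDerivAt_tsum_of_isPreconnected (𝕜 := ℂ)
    (g := fun (n : Fin 3 →₀ ℕ) (t : ℂ) => coeff n f * mon n (z - p + t • Pi.single i 1))
    (g' := fun n t => coeff n f *
      (n i * mon (n - Finsupp.single i 1) (z - p + t • Pi.single i 1)))
    (u := fun n => 2 * K * (1 / 2) ^ tdeg n) (t := Metric.ball 0 (r / 2)) (y₀ := 0) (y := 0)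
    (summable_half_pow_tdeg.mul_left _) Metric.isOpen_ball
    (convex_ball 0 (r / 2)).isPreconnected
    (fun n y _ => (hasDerivAt_mon i n _ y).const_mul _) ?_ (by simp [hr]) ?_ (by simp [hr])
  · have e1 : (fun t : ℂ => psum p f (z + t • Pi.single i 1))
        = fun t => ∑' n, coeff n f * mon n (z - p + t • Pi.single i 1) := by
      funext t
      rw [psum, add_sub_right_comm]
    rw [e1]
    convert! key using 1
    have hinj : Function.Injective fun n : Fin 3 →₀ ℕ => n + Finsupp.single i 1 :=
      add_left_injective _
    rw [psum]
    symm
    rw [← hinj.tsum_eq]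
    · refine tsum_congr fun n => ?_
      rw [hterm, if_pos (le_add_left le_rfl), add_tsub_cancel_right, zero_smul, add_zero]
    · intro n hn
      rw [Function.mem_support, hterm] at hn
      split_ifs at hn with hle
      · exact ⟨n - Finsupp.single i 1, tsub_add_cancel_of_le hle⟩
      · simp at hn
  · intro n y hy
    rw [hterm]
    split_ifs with hle
    · refine (norm_coeff_mul_mon_le h (hb y hy) _).trans (le_of_eq ?_)
      have h1 := congrArg tdeg (tsub_add_cancel_of_le hle)
      rw [tdeg_add, tdeg_single] at h1
      rw [← h1, pow_succ]
      ring
    · rw [norm_zero]; positivity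
  · simpa using summable_of_radius h₀ hzr₀

/-- A property of power series that is inherited by the partial derivatives and that forces the
constant coefficient to vanish only holds for zero. -/
theorem eq_zero_of_pderiv_closed {P : Series₃ → Prop} (h0 : ∀ f, P f → constantCoeff f = 0)
    (hd : ∀ f i, P f → P (pderiv ℂ i f)) {f : Series₃} (hf : P f) : f = 0 := by
  have hc : ∀ (k : ℕ) (n : Fin 3 →₀ ℕ), tdeg n = k → ∀ f, P f → coeff n f = 0 := by
    intro k
    induction k with
    | zero =>
      intro n hn f hf
      have : n = 0 := by
        simp only [tdeg] at hn
        ext i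
        fin_cases i <;> simp <;> omega
      rw [this, coeff_zero_eq_constantCoeff_apply, h0 f hf]
    | succ k ih =>
      intro n hn f hf
      obtain ⟨i, hi⟩ : ∃ i, n i ≠ 0 := by
        by_contra hc
        push Not at hc
        simp [tdeg, hc] at hn
      have hle : Finsupp.single i 1 ≤ n :=
        Finsupp.single_le_iff.mpr (Nat.one_le_iff_ne_zero.mpr hi)
      have h1 := congrArg tdeg (tsub_add_cancel_of_le hle)
      rw [tdeg_add, tdeg_single] at h1
      have h2 := ih (n - Finsupp.single i 1) (by omega) _ (hd f i hf)
      rw [coeff_pderiv, tsub_add_cancel_of_le hle] at h2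
      exact (mul_eq_zero.mp h2).resolve_right (Nat.cast_add_one_ne_zero _)
  ext n
  exact hc _ n rfl f hf

/-- The coefficients of a power series are determined by its sum. -/
theorem eq_zero_of_psum_eventuallyEq_zero (hf : GeomBdd f) (h : psum p f =ᶠ[𝓝 p] 0) : f = 0 := by
  refine eq_zero_of_pderiv_closed (P := fun f => GeomBdd f ∧ psum p f =ᶠ[𝓝 p] 0)
    (fun f hf => ?_) (fun f i hf => ⟨hf.1.pderiv i, ?_⟩) ⟨hf, h⟩
  · rw [← psum_self p]
    exact hf.2.eq_of_nhds
  · filter_upwards [fderiv_psum hf.1 p i, hf.2.fderiv (𝕜 := ℂ)] with z h1 h2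
    rw [← h1, h2]
    simp

end Deriv

/-! ### Power series at a point as a ring with Euler derivations -/

/-- Formal power series in `z - p`. As an algebra over `ℂ[z]` it depends on `p`, which is why it
is not reducible to `Series₃`. -/
def PSAt (_p : Fin 3 → ℂ) : Type := Series₃

noncomputable instance (p : Fin 3 → ℂ) : CommRing (PSAt p) := inferInstanceAs (CommRing Series₃)

/-- The expansion of a polynomial at `p`. -/
noncomputable def polyAt (p : Fin 3 → ℂ) : Poly₃ →+* Series₃ :=
  MvPolynomial.coeToMvPowerSeries.ringHom.comp
    (MvPolynomial.aeval (R := ℂ) fun i : Fin 3 => (MvPolynomial.X i + MvPolynomial.C (p i) :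
      MvPolynomial (Fin 3) ℂ)).toRingHom

noncomputable instance (p : Fin 3 → ℂ) : Algebra Poly₃ (PSAt p) := (polyAt p).toAlgebra

section PolyAt

open MvPowerSeries

variable (p : Fin 3 → ℂ)

theorem polyAt_C (c : ℂ) : polyAt p (MvPolynomial.C c) = C c := by
  simp [polyAt]

theorem polyAt_X (i : Fin 3) : polyAt p (MvPolynomial.X i) = X i + C (p i) := by
  simp [polyAt]

theorem constantCoeff_polyAt (q : Poly₃) :
    constantCoeff (polyAt p q) = MvPolynomial.eval p q := by
  have : (constantCoeff (σ := Fin 3) (R := ℂ)).comp (polyAt p) = MvPolynomial.eval p := by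
    refine MvPolynomial.ringHom_ext (fun c => ?_) fun i => ?_
    · rw [RingHom.comp_apply, polyAt_C]; simp
    · rw [RingHom.comp_apply, polyAt_X]; simp
  exact congrArg (fun φ => φ q) this

theorem pderiv_comm (i j : Fin 3) (f : Series₃) :
    pderiv ℂ i (pderiv ℂ j f) = pderiv ℂ j (pderiv ℂ i f) := by
  ext n
  simp only [coeff_pderiv]
  by_cases h : i = j
  · subst h; rfl
  · have h' := Ne.symm h
    simp only [Finsupp.add_apply, Finsupp.single_eq_of_ne h, Finsupp.single_eq_of_ne h', add_zero,
      add_right_comm n]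
    ring

theorem pderiv_polyAt (i : Fin 3) (q : Poly₃) :
    pderiv ℂ i (polyAt p q) = polyAt p (MvPolynomial.pderiv i q) := by
  induction q using MvPolynomial.induction_on with
  | C a => rw [polyAt_C, pderiv_C, MvPolynomial.pderiv_C, map_zero]
  | add q r hq hr => rw [map_add, map_add, map_add, map_add, hq, hr]
  | mul_X q j hq =>
    have hX : pderiv ℂ i (X j + C (p j)) = polyAt p (MvPolynomial.pderiv i (MvPolynomial.X j)) := by
      rw [map_add, pderiv_C, add_zero, MvPolynomial.pderiv_X, pderiv_X]
      by_cases h : i = j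
      · subst h; simp
      · simp [Ne.symm h]
    rw [map_mul, polyAt_X, Derivation.leibniz, Derivation.leibniz, hq, hX, map_add, smul_eq_mul,
      smul_eq_mul, smul_eq_mul, smul_eq_mul, map_mul, map_mul, polyAt_X]

theorem summable_norm_coeff_polyAt (q : Poly₃) :
    Summable fun n => ‖coeff n (polyAt p q)‖ := by
  set r : MvPolynomial (Fin 3) ℂ := (MvPolynomial.aeval (R := ℂ) fun i : Fin 3 =>
    (MvPolynomial.X i + MvPolynomial.C (p i) : MvPolynomial (Fin 3) ℂ)) q with hr
  have hq : polyAt p q = (r : Series₃) := rfl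
  refine summable_of_hasFiniteSupport (r.support.finite_toSet.subset fun n hn => ?_)
  rw [Function.mem_support, norm_ne_zero_iff, hq, MvPolynomial.coeff_coe] at hn
  simpa using hn

variable {p}

/-- The underlying power series. -/
noncomputable def PSAt.ser : PSAt p ≃+* Series₃ := RingEquiv.refl Series₃

namespace PSAt

theorem ser_algebraMap (q : Poly₃) : ser (algebraMap Poly₃ (PSAt p) q) = polyAt p q := rfl

theorem ser_smul (q : Poly₃) (f : PSAt p) : ser (q • f) = polyAt p q * ser f := by
  rw [Algebra.smul_def, map_mul, ser_algebraMap]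

/-- The operator `z_i ∂/∂z_i` on `ℂ[[z - p]]`. -/
noncomputable def eulerHom (i : Fin 3) : PSAt p →+ PSAt p :=
  ser.symm.toAddMonoidHom.comp ((AddMonoidHom.mulLeft (X i + C (p i) : Series₃)).comp
    ((pderiv ℂ i).toLinearMap.toAddMonoidHom.comp ser.toAddMonoidHom))

theorem ser_eulerHom (i : Fin 3) (f : PSAt p) :
    ser (eulerHom i f) = (X i + C (p i)) * pderiv ℂ i (ser f) := rfl

variable (p) in
/-- The Euler derivations of `ℂ[[z - p]]`. -/
noncomputable def euler : EulerRing (PSAt p) where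
  d := eulerHom
  leib i a b := by
    refine ser.injective ?_
    rw [ser_eulerHom, map_add, map_mul ser, map_mul ser, map_mul ser, ser_eulerHom, ser_eulerHom,
      Derivation.leibniz, smul_eq_mul, smul_eq_mul]
    ring
  d_algebraMap i q := by
    refine ser.injective ?_
    rw [ser_eulerHom, ser_algebraMap, ser_algebraMap, pderiv_polyAt, eulerDer_apply, map_mul,
      polyAt_X]
  comm i j a := by
    refine ser.injective ?_
    simp only [ser_eulerHom]
    by_cases hij : i = j
    · rw [hij]
    · simp only [Derivation.leibniz, map_add, pderiv_C, pderiv_X_of_ne hij,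
        pderiv_X_of_ne (Ne.symm hij), smul_eq_mul, pderiv_comm i j]
      ring

end PSAt

end PolyAt

/-- A ring with Euler derivations as a module over itself. -/
def EulerRing.self {B : Type} [CommRing B] [Algebra Poly₃ B] (R : EulerRing B) :
    EulerAction B where
  θ := R.d
  leib i q m := by rw [Algebra.smul_def, R.leib, R.d_algebraMap, Algebra.smul_def, Algebra.smul_def]
  comm := R.comm

/-- The Euler operators on `ℂ[[z - p]]`. -/
noncomputable def serAction (p : Fin 3 → ℂ) : EulerAction (PSAt p) := (PSAt.euler p).self

section Transfer

open MvPowerSeries Filter Topology PSAt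

variable {p : Fin 3 → ℂ} {f g : PSAt p}

theorem ser_θ (i : Fin 3) (f : PSAt p) :
    ser ((serAction p).θ i f) = (X i + C (p i)) * pderiv ℂ i (ser f) := rfl

namespace GeomBdd

theorem zero : GeomBdd 0 := ⟨0, 1, le_rfl, le_rfl, fun n => by simp⟩

theorem linear_mul {f : Series₃} (hf : GeomBdd f) (i : Fin 3) (c : ℂ) :
    GeomBdd ((X i + C c) * f) := by
  rw [add_mul]
  exact (hf.X_mul i).add (hf.const_mul c)

theorem polyAt_mul {f : Series₃} (hf : GeomBdd f) (q : Poly₃) : GeomBdd (polyAt p q * f) := by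
  induction q using MvPolynomial.induction_on with
  | C a => rw [polyAt_C]; exact hf.const_mul a
  | add q r hq hr => rw [map_add, add_mul]; exact hq.add hr
  | mul_X q i hq =>
    rw [mul_comm q, map_mul, polyAt_X, mul_assoc]
    exact hq.linear_mul i _

theorem smul (hf : GeomBdd (ser f)) (q : Poly₃) : GeomBdd (ser (q • f)) := by
  rw [ser_smul]
  exact hf.polyAt_mul q

theorem sub {f g : Series₃} (hf : GeomBdd f) (hg : GeomBdd g) : GeomBdd (f - g) := by
  have : f - g = f + C (-1) * g := by rw [map_neg, map_one, neg_one_mul, sub_eq_add_neg]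
  rw [this]
  exact hf.add (hg.const_mul _)

theorem θ (hf : GeomBdd (ser f)) (i : Fin 3) : GeomBdd (ser ((serAction p).θ i f)) :=
  (hf.pderiv i).linear_mul i _

theorem sum {ι : Type} (s : Finset ι) {f : ι → Series₃} (hf : ∀ i ∈ s, GeomBdd (f i)) :
    GeomBdd (∑ i ∈ s, f i) :=
  Finset.sum_induction f GeomBdd (fun _ _ h h' => h.add h') GeomBdd.zero hf

theorem lin (hf : GeomBdd (ser f)) (s : Finset (Fin 3)) (c : ℂ) :
    GeomBdd (ser ((serAction p).lin s c f)) := by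
  rw [EulerAction.lin, map_add, map_sum]
  exact (hf.smul _).add (GeomBdd.sum s fun j _ => hf.θ j)

theorem mono (hf : GeomBdd (ser f)) (K : Idx) : GeomBdd (ser ((serAction p).mono K f)) := by
  obtain ⟨a, b, c⟩ := K
  cases a <;> cases b <;> cases c <;> simp only [EulerAction.mono, cond_true, cond_false] <;>
    repeat' first | exact hf | apply GeomBdd.θ

theorem lin_sub_smul_lin (hf : GeomBdd (ser f)) (i : Fin 3) (s t s' t' : Finset (Fin 3))
    (c d c' d' : ℂ) : GeomBdd (ser ((serAction p).lin s c ((serAction p).lin t d f)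
      - (MvPolynomial.X i : Poly₃) • (serAction p).lin s' c' ((serAction p).lin t' d' f))) := by
  rw [map_sub]
  exact ((hf.lin _ _).lin _ _).sub (((hf.lin _ _).lin _ _).smul _)

theorem horn (hf : GeomBdd (ser f)) (J : Par → ℂ) (j : Fin 3) :
    GeomBdd (ser ((serAction p).horn J f j)) := by
  fin_cases j <;> exact hf.lin_sub_smul_lin _ _ _ _ _ _ _ _ _

end GeomBdd

theorem psum_zero (p z : Fin 3 → ℂ) : psum p 0 z = 0 := by simp [psum]

theorem psum_sub {f g : Series₃} (hf : GeomBdd f) (hg : GeomBdd g) (p : Fin 3 → ℂ) :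
    ∀ᶠ z in 𝓝 p, psum p (f - g) z = psum p f z - psum p g z := by
  have h1 : f - g = f + C (-1) * g := by rw [map_neg, map_one, neg_one_mul, sub_eq_add_neg]
  filter_upwards [psum_add hf (hg.const_mul (-1)) p] with z h2
  rw [h1, h2, psum_C_mul]
  ring

theorem psum_sum {ι : Type} (s : Finset ι) {f : ι → Series₃} (hf : ∀ i ∈ s, GeomBdd (f i))
    (p : Fin 3 → ℂ) : ∀ᶠ z in 𝓝 p, psum p (∑ i ∈ s, f i) z = ∑ i ∈ s, psum p (f i) z := by
  classical
  induction s using Finset.induction_on with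
  | empty => exact Eventually.of_forall fun z => by simp [psum_zero]
  | insert i s hi ih =>
    have h1 : ∀ j ∈ s, GeomBdd (f j) := fun j hj => hf j (Finset.mem_insert_of_mem hj)
    filter_upwards [ih h1, psum_add (hf i (Finset.mem_insert_self i s)) (GeomBdd.sum s h1) p]
      with z h2 h3
    rw [Finset.sum_insert hi, Finset.sum_insert hi, h3, h2]

theorem psum_linear_mul {f : Series₃} (hf : GeomBdd f) (i : Fin 3) (p : Fin 3 → ℂ) :
    ∀ᶠ z in 𝓝 p, psum p ((X i + C (p i)) * f) z = z i * psum p f z := by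
  filter_upwards [psum_add (hf.X_mul i) (hf.const_mul (p i)) p] with z hz
  rw [add_mul, hz, psum_X_mul, psum_C_mul, Pi.sub_apply]
  ring

theorem psum_smul (hf : GeomBdd (ser f)) (q : Poly₃) :
    ∀ᶠ z in 𝓝 p, psum p (ser (q • f)) z = MvPolynomial.eval z q * psum p (ser f) z := by
  induction q using MvPolynomial.induction_on with
  | C a =>
    refine Eventually.of_forall fun z => ?_
    rw [ser_smul, polyAt_C, psum_C_mul, MvPolynomial.eval_C]
  | add q r hq hr =>
    filter_upwards [hq, hr, psum_add (hf.smul q) (hf.smul r) p] with z h1 h2 h3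
    rw [add_smul, map_add, h3, h1, h2, map_add, add_mul]
  | mul_X q i hq =>
    filter_upwards [hq, psum_linear_mul (hf.smul q) i p] with z h1 h2
    rw [mul_comm, mul_smul, ser_smul, polyAt_X, h2, h1, map_mul, MvPolynomial.eval_X, mul_assoc]

theorem thetaOp_psum (hf : GeomBdd (ser f)) (i : Fin 3) :
    thetaOp i (psum p (ser f)) =ᶠ[𝓝 p] psum p (ser ((serAction p).θ i f)) := by
  filter_upwards [fderiv_psum hf p i, psum_linear_mul (hf.pderiv i) i p] with z h1 h2
  rw [thetaOp, h1, ser_θ, h2]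

theorem eulerOp_psum (hf : GeomBdd (ser f)) (s : Finset (Fin 3)) (c : ℂ) :
    eulerOp s c (psum p (ser f)) =ᶠ[𝓝 p] psum p (ser ((serAction p).lin s c f)) := by
  filter_upwards [psum_add (hf.smul (MvPolynomial.C c)) (GeomBdd.sum s fun j _ => hf.θ j) p,
    psum_sum s (fun j _ => hf.θ j) p, psum_smul hf (MvPolynomial.C c),
    (eventually_all (l := 𝓝 p)).mpr fun i => thetaOp_psum hf i] with z h1 h2 h3 h4
  rw [EulerAction.lin, map_add, map_sum, h1, h2, h3, MvPolynomial.eval_C, eulerOp]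
  congr 1
  exact Finset.sum_congr rfl fun j _ => h4 j

theorem hornOp_psum (hf : GeomBdd (ser f)) (J : Par → ℂ) (j : Fin 3) :
    hornOp J j (psum p (ser f)) =ᶠ[𝓝 p] psum p (ser ((serAction p).horn J f j)) := by
  have h2 : ∀ s t c d, eulerOp s c (eulerOp t d (psum p (ser f))) =ᶠ[𝓝 p]
      psum p (ser ((serAction p).lin s c ((serAction p).lin t d f))) := fun s t c d =>
    (eulerOp_congr (eulerOp_psum hf t d)).trans (eulerOp_psum (hf.lin t d) s c)
  have h3 : ∀ (i : Fin 3) s t c d s' t' c' d',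
      (fun z => eulerOp s c (eulerOp t d (psum p (ser f))) z
        - z i * eulerOp s' c' (eulerOp t' d' (psum p (ser f))) z) =ᶠ[𝓝 p]
      psum p (ser ((serAction p).lin s c ((serAction p).lin t d f) - (MvPolynomial.X i : Poly₃) •
        (serAction p).lin s' c' ((serAction p).lin t' d' f))) := by
    intro i s t c d s' t' c' d'
    filter_upwards [h2 s t c d, h2 s' t' c' d', psum_smul ((hf.lin t' d').lin s' c')
      (MvPolynomial.X i), psum_sub ((hf.lin t d).lin s c)
      (((hf.lin t' d').lin s' c').smul (MvPolynomial.X i)) p] with z h4 h5 h6 h7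
    rw [map_sub, h7, h6, h4, h5, MvPolynomial.eval_X]
  fin_cases j <;> exact h3 _ _ _ _ _ _ _ _ _

/-- Near `p`, a convergent power series solves the Horn system if and only if it does so
formally. -/
theorem isLocalSolution_psum_iff (hf : GeomBdd (ser f)) (J : Par → ℂ) :
    IsLocalSolution J p (psum p (ser f)) ↔ (serAction p).IsSol J f := by
  constructor
  · intro h j
    refine ser.injective ?_
    rw [map_zero]
    exact eq_zero_of_psum_eventuallyEq_zero (hf.horn J j) ((hornOp_psum hf J j).symm.trans (h.2 j))
  · intro h
    refine ⟨analyticAt_psum hf p, fun j => ?_⟩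
    filter_upwards [hornOp_psum hf J j] with z hz
    rw [hz, h j, map_zero, psum_zero]

theorem IsLocalSolution.congr {J : Par → ℂ} {g h : (Fin 3 → ℂ) → ℂ} (hg : IsLocalSolution J p g)
    (e : g =ᶠ[𝓝 p] h) : IsLocalSolution J p h := by
  refine ⟨hg.1.congr e, fun j => ?_⟩
  have h2 : ∀ s t c d, eulerOp s c (eulerOp t d g) =ᶠ[𝓝 p] eulerOp s c (eulerOp t d h) :=
    fun s t c d => eulerOp_congr (eulerOp_congr e)
  have h3 : ∀ (i : Fin 3) s t c d s' t' c' d', (fun z => eulerOp s c (eulerOp t d g) z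
      - z i * eulerOp s' c' (eulerOp t' d' g) z) =ᶠ[𝓝 p] fun z => eulerOp s c (eulerOp t d h) z
      - z i * eulerOp s' c' (eulerOp t' d' h) z := by
    intro i s t c d s' t' c' d'
    filter_upwards [h2 s t c d, h2 s' t' c' d'] with z h4 h5
    rw [h4, h5]
  have h4 : hornOp J j g =ᶠ[𝓝 p] hornOp J j h := by
    fin_cases j <;> exact h3 _ _ _ _ _ _ _ _ _
  exact h4.symm.trans (hg.2 j)

end Transfer

/-! ### Convergence of formal solutions of first order systems -/

section Convergence

open MvPowerSeries Filter Topology Finset.HasAntidiagonal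

theorem tdeg_eq_zero {n : Fin 3 →₀ ℕ} (h : tdeg n = 0) : n = 0 := by
  simp only [tdeg] at h
  ext i
  fin_cases i <;> simp <;> omega

theorem coeff_sum_X_mul_pderiv (f : Series₃) (n : Fin 3 →₀ ℕ) :
    coeff n (∑ i, X i * pderiv ℂ i f) = tdeg n * coeff n f := by
  have h : ∀ i, coeff n (X i * pderiv ℂ i f) = n i * coeff n f := by
    intro i
    rw [GeomBdd.coeff_X_mul]
    split_ifs with hn
    · have h1 : 1 ≤ n i := by simpa using hn i
      rw [coeff_pderiv, tsub_add_cancel_of_le hn, Finsupp.tsub_apply, Finsupp.single_eq_same,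
        Nat.cast_sub h1]
      push_cast
      ring
    · have h1 : n i = 0 := by
        by_contra hc
        exact hn (Finsupp.single_le_iff.mpr (Nat.one_le_iff_ne_zero.mpr hc))
      simp [h1]
  rw [map_sum, Fin.sum_univ_three, h, h, h, tdeg]
  push_cast
  ring

theorem norm_sum_antidiagonal_erase_le {g : Series₃} (hg : Summable fun n => ‖coeff n g‖)
    {n : Fin 3 →₀ ℕ} {b : (Fin 3 →₀ ℕ) → ℂ} {B : ℝ} (hB : 0 ≤ B)
    (hb : ∀ m, tdeg m < tdeg n → ‖b m‖ ≤ B) :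
    ‖∑ x ∈ (antidiagonal n).erase (0, n), coeff x.1 g * b x.2‖
      ≤ (∑' m, ‖coeff m g‖) * B := by
  have hinj : Set.InjOn Prod.fst
      (((antidiagonal n).erase (0, n) : Finset _) : Set ((Fin 3 →₀ ℕ) × (Fin 3 →₀ ℕ))) := by
    intro x hx y hy hxy
    simp only [Finset.coe_erase, Set.mem_sdiff, Finset.mem_coe, mem_antidiagonal] at hx hy
    refine Prod.ext hxy ?_
    have := hx.1.trans hy.1.symm
    rw [hxy] at this
    exact add_left_cancel this
  calc _ ≤ ∑ x ∈ (antidiagonal n).erase (0, n), ‖coeff x.1 g‖ * B := by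
        refine (norm_sum_le _ _).trans (Finset.sum_le_sum fun x hx => ?_)
        rw [norm_mul]
        refine mul_le_mul_of_nonneg_left (hb _ ?_) (norm_nonneg _)
        obtain ⟨h0, h1⟩ := Finset.mem_erase.mp hx
        rw [mem_antidiagonal] at h1
        have h2 : tdeg x.1 ≠ 0 := fun h => h0 (by
          have h3 := tdeg_eq_zero h
          rw [h3, zero_add] at h1
          exact Prod.ext h3 h1)
        rw [← h1, tdeg_add]
        omega
    _ = (∑ m ∈ ((antidiagonal n).erase (0, n)).image Prod.fst, ‖coeff m g‖) * B := by
        rw [Finset.sum_mul, Finset.sum_image hinj]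
    _ ≤ _ := by
        gcongr
        exact hg.sum_le_tsum _ fun _ _ => norm_nonneg _

theorem coeff_mul_eq_add_erase (f g : Series₃) (n : Fin 3 →₀ ℕ) : coeff n (f * g) =
    constantCoeff f * coeff n g
      + ∑ x ∈ (antidiagonal n).erase (0, n), coeff x.1 f * coeff x.2 g := by
  classical
  rw [coeff_mul, ← Finset.add_sum_erase _ _ (show ((0 : Fin 3 →₀ ℕ), n) ∈ antidiagonal n by
    simp), coeff_zero_eq_constantCoeff_apply]

/-- Formal solutions of a first order system `G ∑ x_i ∂_i F_I = ∑_K Q_{IK} F_K` with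
`G(0) ≠ 0` and `Q_{IK}(0) = 0` converge, with bounds governed by the constant terms.
In particular they vanish if all the constant terms do. The coefficient of `x^n` in the equation
expresses `|n| G(0)` times the coefficient of `F_I` by coefficients of lower degree, each with a
factor that is at most `|n|`; induction on `|n|` gives the bound. -/
theorem exists_norm_coeff_le_of_system {ι : Type} [Fintype ι] {F : ι → Series₃} {G : Series₃}
    {Q : ι → ι → Series₃} (hG : Summable fun n => ‖coeff n G‖)
    (hQ : ∀ I K, Summable fun n => ‖coeff n (Q I K)‖) (hG0 : constantCoeff G ≠ 0)
    (hQ0 : ∀ I K, constantCoeff (Q I K) = 0)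
    (h : ∀ I, G * ∑ i, X i * pderiv ℂ i (F I) = ∑ K, Q I K * F K) :
    ∃ σ : ℝ, 1 ≤ σ ∧ ∀ M, 0 ≤ M → (∀ I, ‖constantCoeff (F I)‖ ≤ M) →
      ∀ I n, ‖coeff n (F I)‖ ≤ M * σ ^ tdeg n := by
  set S : ℝ := (∑' m, ‖coeff m G‖) + ∑ I, ∑ K, ∑' m, ‖coeff m (Q I K)‖ with hS
  have hG1 : 0 < ‖constantCoeff G‖ := norm_pos_iff.mpr hG0
  refine ⟨max 1 (S / ‖constantCoeff G‖), le_max_left _ _, fun M hM h0 => ?_⟩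
  set σ : ℝ := max 1 (S / ‖constantCoeff G‖) with hσ
  have hσ1 : 1 ≤ σ := le_max_left _ _
  have hσS : S ≤ σ * ‖constantCoeff G‖ := (div_le_iff₀ hG1).mp (le_max_right _ _)
  have key : ∀ (k : ℕ) (n : Fin 3 →₀ ℕ), tdeg n = k → ∀ I, ‖coeff n (F I)‖ ≤ M * σ ^ k := by
    intro k
    induction k using Nat.strong_induction_on with
    | _ k ih =>
    intro n hn I
    rcases Nat.eq_zero_or_pos k with hk | hk
    · rw [hk] at hn ⊢
      rw [tdeg_eq_zero hn, pow_zero, mul_one, coeff_zero_eq_constantCoeff_apply]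
      exact h0 I
    obtain ⟨l, rfl⟩ : ∃ l, k = l + 1 := ⟨k - 1, by omega⟩
    have hB : 0 ≤ M * σ ^ l := by positivity
    have ih' : ∀ m, tdeg m < tdeg n → ∀ K, ‖coeff m (F K)‖ ≤ M * σ ^ l := by
      intro m hm K
      refine (ih (tdeg m) (by omega) m rfl K).trans ?_
      gcongr
      omega
    have hd : (1 : ℝ) ≤ tdeg n := by rw [hn]; exact_mod_cast hk
    have e := congrArg (coeff n) (h I)
    rw [coeff_mul_eq_add_erase, coeff_sum_X_mul_pderiv, map_sum] at e
    simp only [coeff_mul_eq_add_erase (Q I _), hQ0, zero_mul, zero_add,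
      coeff_sum_X_mul_pderiv] at e
    have e1 := norm_sum_antidiagonal_erase_le hG (n := n)
      (b := fun m => tdeg m * coeff m (F I)) (B := tdeg n * (M * σ ^ l)) (by positivity) (by
        intro m hm
        rw [norm_mul, Complex.norm_natCast]
        gcongr
        exact ih' m hm I)
    have e2 : ‖∑ K, ∑ x ∈ (antidiagonal n).erase (0, n), coeff x.1 (Q I K) * coeff x.2 (F K)‖
        ≤ (∑ I, ∑ K, ∑' m, ‖coeff m (Q I K)‖) * (tdeg n * (M * σ ^ l)) := by
      have hnn : ∀ I K, 0 ≤ ∑' m, ‖coeff m (Q I K)‖ := fun I K => tsum_nonneg fun _ => norm_nonneg _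
      calc _ ≤ ∑ K, (∑' m, ‖coeff m (Q I K)‖) * (M * σ ^ l) := by
            refine (norm_sum_le _ _).trans (Finset.sum_le_sum fun K _ => ?_)
            exact norm_sum_antidiagonal_erase_le (hQ I K) hB fun m hm => ih' m hm K
        _ = (∑ K, ∑' m, ‖coeff m (Q I K)‖) * (M * σ ^ l) := by rw [Finset.sum_mul]
        _ ≤ _ := by
            refine mul_le_mul ?_ (le_mul_of_one_le_left hB hd) hB
              (Finset.sum_nonneg fun I _ => Finset.sum_nonneg fun K _ => hnn I K)
            exact Finset.single_le_sum (f := fun I => ∑ K, ∑' m, ‖coeff m (Q I K)‖)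
              (fun I _ => Finset.sum_nonneg fun K _ => hnn I K) (Finset.mem_univ I)
    have e3 : ‖constantCoeff G * (tdeg n * coeff n (F I))‖ ≤ S * (tdeg n * (M * σ ^ l)) := by
      rw [eq_sub_of_add_eq e]
      refine (norm_sub_le _ _).trans ?_
      rw [hS, add_mul, add_comm]
      exact add_le_add e1 e2
    rw [norm_mul, norm_mul, Complex.norm_natCast] at e3
    have e4 : (‖constantCoeff G‖ * tdeg n) * ‖coeff n (F I)‖
        ≤ (‖constantCoeff G‖ * tdeg n) * (M * σ ^ (l + 1)) := by
      calc _ = ‖constantCoeff G‖ * (tdeg n * ‖coeff n (F I)‖) := by ring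
        _ ≤ S * (tdeg n * (M * σ ^ l)) := e3
        _ ≤ (σ * ‖constantCoeff G‖) * (tdeg n * (M * σ ^ l)) := by gcongr
        _ = _ := by rw [pow_succ]; ring
    exact le_of_mul_le_mul_left e4 (by positivity)
  exact fun I n => key _ n rfl I

end Convergence

/-! ### Analytic functions as sums of power series -/

section Analytic

open MvPowerSeries Filter Topology

/-- The exponent of the monomial `w_{k(1)} ⋯ w_{k(m)}`. -/
noncomputable def cnt {m : ℕ} (k : Fin m → Fin 3) : Fin 3 →₀ ℕ := ∑ j, Finsupp.single (k j) 1

theorem tdeg_cnt {m : ℕ} (k : Fin m → Fin 3) : tdeg (cnt k) = m := by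
  let φ : (Fin 3 →₀ ℕ) →+ ℕ :=
    { toFun := tdeg, map_zero' := by simp [tdeg], map_add' := tdeg_add }
  change φ (∑ j, Finsupp.single (k j) 1) = m
  rw [map_sum]
  change ∑ j, tdeg (Finsupp.single (k j) 1) = m
  simp [tdeg_single]

theorem mon_cnt {m : ℕ} (k : Fin m → Fin 3) (w : Fin 3 → ℂ) : mon (cnt k) w = ∏ j, w (k j) := by
  have h : ∀ s : Finset (Fin m), mon (∑ j ∈ s, Finsupp.single (k j) 1) w = ∏ j ∈ s, w (k j) := by
    intro s
    induction s using Finset.induction_on with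
    | empty => simp [mon_zero]
    | insert a s ha ih => rw [Finset.sum_insert ha, Finset.prod_insert ha, mon_add, ih, mon_single]
  exact h _

/-- The coefficients of a formal multilinear series on `ℂ³`. -/
noncomputable def ofMultilinearSeries (P : FormalMultilinearSeries ℂ (Fin 3 → ℂ) ℂ) : Series₃ :=
  fun n => ∑ k : Fin (tdeg n) → Fin 3 with cnt k = n, P (tdeg n) fun j => Pi.single (k j) 1

theorem sum_degFinset_ofMultilinearSeries (P : FormalMultilinearSeries ℂ (Fin 3 → ℂ) ℂ) (m : ℕ)
    (y : Fin 3 → ℂ) :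
    ∑ n ∈ degFinset m, coeff n (ofMultilinearSeries P) * mon n y = P m fun _ => y := by
  have h1 : ∀ n ∈ degFinset m, coeff n (ofMultilinearSeries P) * mon n y
      = ∑ k : Fin m → Fin 3 with cnt k = n, (∏ j, y (k j)) * P m fun j => Pi.single (k j) 1 := by
    intro n hn
    obtain rfl := mem_degFinset.mp hn
    change (∑ k : Fin (tdeg n) → Fin 3 with cnt k = n, _) * _ = _
    rw [Finset.sum_mul]
    refine Finset.sum_congr rfl fun k hk => ?_
    rw [← mon_cnt, (Finset.mem_filter.mp hk).2, mul_comm]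
  rw [Finset.sum_congr rfl h1, Finset.sum_fiberwise_of_maps_to (fun k _ =>
    mem_degFinset.mpr (tdeg_cnt k))]
  have h2 : y = ∑ i, y i • (Pi.single i 1 : Fin 3 → ℂ) := by
    funext i
    simp [Finset.sum_apply, Pi.single_apply]
  conv_rhs => rw [h2]
  rw [ContinuousMultilinearMap.map_sum]
  refine Finset.sum_congr rfl fun k _ => ?_
  rw [ContinuousMultilinearMap.map_smul_univ, smul_eq_mul]

theorem geomBdd_ofMultilinearSeries {P : FormalMultilinearSeries ℂ (Fin 3 → ℂ) ℂ}
    (hP : 0 < P.radius) : GeomBdd (ofMultilinearSeries P) := by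
  obtain ⟨r, hr0, hr⟩ := ENNReal.lt_iff_exists_nnreal_btwn.mp hP
  have hr0' : 0 < r := ENNReal.coe_pos.mp hr0
  obtain ⟨K, hK, h⟩ := P.norm_le_div_pow_of_pos_of_lt_radius hr0' hr
  refine ⟨K, max 1 (3 / r), hK.le, le_max_left _ _, fun n => ?_⟩
  have h1 : ∀ k : Fin (tdeg n) → Fin 3,
      ‖P (tdeg n) fun j => (Pi.single (k j) 1 : Fin 3 → ℂ)‖ ≤ K / (r : ℝ) ^ tdeg n := by
    intro k
    refine ((P (tdeg n)).le_opNorm _).trans ((mul_le_of_le_one_right (norm_nonneg _) ?_).trans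
      (h _))
    exact Finset.prod_le_one (fun _ _ => norm_nonneg _) fun j _ => by simp [Pi.norm_single]
  change ‖∑ k : Fin (tdeg n) → Fin 3 with cnt k = n, _‖ ≤ _
  calc _ ≤ ∑ k : Fin (tdeg n) → Fin 3 with cnt k = n, K / (r : ℝ) ^ tdeg n :=
        (norm_sum_le _ _).trans (Finset.sum_le_sum fun k _ => h1 k)
    _ ≤ ∑ k : Fin (tdeg n) → Fin 3, K / (r : ℝ) ^ tdeg n :=
        Finset.sum_le_sum_of_subset_of_nonneg (Finset.filter_subset _ _) fun _ _ _ => by positivity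
    _ = K * (3 / r) ^ tdeg n := by
        simp only [Finset.sum_const, Finset.card_univ, Fintype.card_pi, Fintype.card_fin,
          Finset.prod_const, nsmul_eq_mul, div_pow]
        push_cast
        ring
    _ ≤ _ := by
        gcongr
        exact le_max_right _ _

/-- An analytic function is the sum of its Taylor series. -/
theorem exists_psum_of_analyticAt {p : Fin 3 → ℂ} {g : (Fin 3 → ℂ) → ℂ} (hg : AnalyticAt ℂ g p) :
    ∃ f : Series₃, GeomBdd f ∧ g =ᶠ[𝓝 p] psum p f := by
  obtain ⟨P, r, hP⟩ := hg
  have hf := geomBdd_ofMultilinearSeries (hP.r_pos.trans_le hP.r_le)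
  refine ⟨_, hf, ?_⟩
  have h1 := HasFPowerSeriesAt.eventually_hasSum_sub ⟨r, hP⟩
  have h2 := (hasFPowerSeries_psum hf p).eventually_hasSum_sub
  filter_upwards [h1, h2] with z h1 h2
  refine h1.unique (h2.congr_fun fun m => ?_)
  rw [← sum_degFinset_ofMultilinearSeries, toMultilinearSeries, sum_apply]
  refine Finset.sum_congr rfl fun n hn => ?_
  rw [smul_apply, monMultilinear_apply n m (mem_degFinset.mp hn), smul_eq_mul]

end Analytic

/-! ### The formal Taylor map of a flat connection -/

namespace EulerAction

variable {M N : Type} [AddCommGroup M] [Module Poly₃ M] [AddCommGroup N] [Module Poly₃ N]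
  {T : EulerAction M} {T' : EulerAction N} (φ : M →ₗ[Poly₃] N)

theorem map_lin (hφ : ∀ i m, φ (T.θ i m) = T'.θ i (φ m)) (s : Finset (Fin 3)) (c : ℂ) (m : M) :
    φ (T.lin s c m) = T'.lin s c (φ m) := by
  simp only [lin, map_add, map_smul, map_sum, hφ]

theorem map_horn (hφ : ∀ i m, φ (T.θ i m) = T'.θ i (φ m)) (J : Par → ℂ) (m : M) (j : Fin 3) :
    φ (T.horn J m j) = T'.horn J (φ m) j := by
  fin_cases j
  · change φ (_ - _ • _) = _ - _ • _
    simp only [map_sub, map_smul, map_lin φ hφ]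
  · change φ (_ - _ • _) = _ - _ • _
    simp only [map_sub, map_smul, map_lin φ hφ]
  · change φ (_ - _ • _) = _ - _ • _
    simp only [map_sub, map_smul, map_lin φ hφ]

theorem map_mono (hφ : ∀ i m, φ (T.θ i m) = T'.θ i (φ m)) (K : Idx) (m : M) :
    φ (T.mono K m) = T'.mono K (φ m) := by
  obtain ⟨a, b, c⟩ := K
  cases a <;> cases b <;> cases c <;> simp only [mono, cond_true, cond_false, hφ]

theorem IsSol.map {J : Par → ℂ} {m : M} (h : T.IsSol J m)
    (hφ : ∀ i m, φ (T.θ i m) = T'.θ i (φ m)) : T'.IsSol J (φ m) := fun j => by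
  rw [← map_horn φ hφ, h j, map_zero]

end EulerAction

section Taylor

open MvPowerSeries

variable {M : Type} [AddCommGroup M] (D : Fin 3 → M →+ M) (ev : M →+ ℂ)

/-- The Taylor series `∑ ev(∂^n m) x^n / n!` of a vector `m`. -/
noncomputable def taylor : M →+ Series₃ where
  toFun m n := ((n 0).factorial * (n 1).factorial * (n 2).factorial : ℂ)⁻¹ *
    ev ((D 0)^[n 0] ((D 1)^[n 1] ((D 2)^[n 2] m)))
  map_zero' := by
    funext n
    simp only [iterate_map_zero, map_zero, mul_zero]
    rfl
  map_add' m m' := by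
    funext n
    simp only [iterate_map_add, map_add, mul_add]
    rfl

theorem coeff_taylor (n : Fin 3 →₀ ℕ) (m : M) : coeff n (taylor D ev m) =
    ((n 0).factorial * (n 1).factorial * (n 2).factorial : ℂ)⁻¹ *
      ev ((D 0)^[n 0] ((D 1)^[n 1] ((D 2)^[n 2] m))) := rfl

theorem constantCoeff_taylor (m : M) : constantCoeff (taylor D ev m) = ev m := by
  rw [← coeff_zero_eq_constantCoeff_apply, coeff_taylor]
  simp

variable {D ev}

theorem pderiv_taylor (hD : ∀ i j m, D i (D j m) = D j (D i m)) (i : Fin 3) (m : M) :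
    pderiv ℂ i (taylor D ev m) = taylor D ev (D i m) := by
  have hc : ∀ i j (k : ℕ) (m : M), (D j)^[k] (D i m) = D i ((D j)^[k] m) := fun i j k m =>
    (Function.Commute.iterate_left (fun m => hD j i m) k) m
  ext n
  rw [coeff_pderiv, coeff_taylor, coeff_taylor, mul_comm, ← mul_assoc]
  have hn : ((n i : ℂ) + 1) ≠ 0 := Nat.cast_add_one_ne_zero _
  fin_cases i
  · congr 1
    · simp [Nat.factorial_succ]
      field_simp
    · simp [hc, Function.iterate_succ_apply']
  · congr 1
    · simp [Nat.factorial_succ]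
      field_simp
    · simp [hc, Function.iterate_succ_apply']
  · congr 1
    · simp [Nat.factorial_succ]
      field_simp
    · simp [hc, Function.iterate_succ_apply']

/-- The Taylor map is linear over `ℂ[z]`: the differences of the two sides span a group of power
series that is stable under the partial derivatives and whose members have no constant term. -/
theorem taylor_smul [Module Poly₃ M] {p : Fin 3 → ℂ} (hD : ∀ i j m, D i (D j m) = D j (D i m))
    (hl : ∀ i (q : Poly₃) m, D i (q • m) = q • D i m + MvPolynomial.pderiv i q • m)
    (hev : ∀ (q : Poly₃) m, ev (q • m) = MvPolynomial.eval p q * ev m) (q : Poly₃) (m : M) :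
    taylor D ev (q • m) = polyAt p q * taylor D ev m := by
  refine sub_eq_zero.mp (eq_zero_of_pderiv_closed (P := fun f => f ∈ AddSubgroup.closure
    {f | ∃ (q : Poly₃) (m : M), f = taylor D ev (q • m) - polyAt p q * taylor D ev m})
    (fun f hf => ?_) (fun f i hf => ?_) (AddSubgroup.subset_closure ⟨q, m, rfl⟩))
  · induction hf using AddSubgroup.closure_induction with
    | mem f hf =>
      obtain ⟨q, m, rfl⟩ := hf
      rw [map_sub, map_mul, constantCoeff_taylor, constantCoeff_taylor, constantCoeff_polyAt, hev,
        sub_self]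
    | zero => exact map_zero _
    | add f g _ _ hf hg => rw [map_add, hf, hg, add_zero]
    | neg f _ hf => rw [map_neg, hf, neg_zero]
  · induction hf using AddSubgroup.closure_induction with
    | mem f hf =>
      obtain ⟨q, m, rfl⟩ := hf
      have e : pderiv ℂ i (taylor D ev (q • m) - polyAt p q * taylor D ev m)
          = (taylor D ev (q • D i m) - polyAt p q * taylor D ev (D i m))
            + (taylor D ev (MvPolynomial.pderiv i q • m)
              - polyAt p (MvPolynomial.pderiv i q) * taylor D ev m) := by
        rw [map_sub, pderiv_taylor hD, hl, Derivation.leibniz, pderiv_taylor hD, pderiv_polyAt,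
          map_add, smul_eq_mul, smul_eq_mul]
        ring
      rw [e]
      exact AddSubgroup.add_mem _ (AddSubgroup.subset_closure ⟨q, D i m, rfl⟩)
        (AddSubgroup.subset_closure ⟨_, m, rfl⟩)
    | zero => rw [map_zero]; exact AddSubgroup.zero_mem _
    | add f g _ _ hf hg => rw [map_add]; exact AddSubgroup.add_mem _ hf hg
    | neg f _ hf => rw [map_neg]; exact AddSubgroup.neg_mem _ hf

end Taylor

/-! ### The local solution space -/

section LocalSolutions

open MvPowerSeries PSAt Topology

variable {p : Fin 3 → ℂ}

/-- A polynomial off whose zeros the connection is regular. -/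
noncomputable def singLocus : Poly₃ :=
  connDen * (MvPolynomial.X 0 * MvPolynomial.X 1 * MvPolynomial.X 2)

theorem singLocus_ne_zero : singLocus ≠ 0 :=
  mul_ne_zero connDen_ne_zero
    (mul_ne_zero (mul_ne_zero (MvPolynomial.X_ne_zero _) (MvPolynomial.X_ne_zero _))
      (MvPolynomial.X_ne_zero _))

theorem eval_connDen_ne_zero (hp : MvPolynomial.eval p singLocus ≠ 0) :
    MvPolynomial.eval p connDen ≠ 0 := by
  rw [singLocus, map_mul] at hp
  exact left_ne_zero_of_mul hp

theorem apply_ne_zero_of_singLocus (hp : MvPolynomial.eval p singLocus ≠ 0) (i : Fin 3) :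
    p i ≠ 0 := by
  simp only [singLocus, map_mul, MvPolynomial.eval_X, mul_ne_zero_iff] at hp
  fin_cases i
  · exact hp.2.1.1
  · exact hp.2.1.2
  · exact hp.2.2

theorem PSAt.exists_inv {q : Poly₃} (hq : MvPolynomial.eval p q ≠ 0) :
    ∃ e : PSAt p, algebraMap Poly₃ (PSAt p) q * e = 1 := by
  refine ⟨ser.symm (polyAt p q)⁻¹, ser.injective ?_⟩
  rw [map_mul, ser_algebraMap, RingEquiv.apply_symm_apply, map_one]
  exact MvPowerSeries.mul_inv_cancel _ (by rwa [constantCoeff_polyAt])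

/-- Formal solutions with prescribed values of the eight squarefree monomials exist off the
singular locus: the Taylor map of the connection on `ℂ[[z-p]]⁸`, for the functional that takes
these values on the basis at `p`, commutes with the Euler operators, and the solution is the image
of the first basis vector. -/
theorem exists_formal_solution (J : Par → ℂ) (hp : MvPolynomial.eval p singLocus ≠ 0)
    (c : Idx → ℂ) : ∃ f : PSAt p, (serAction p).IsSol J f ∧
      ∀ K, constantCoeff (ser ((serAction p).mono K f)) = c K := by
  obtain ⟨e, he⟩ := PSAt.exists_inv (eval_connDen_ne_zero hp)
  have hX : ∀ i, ∃ w : PSAt p, algebraMap Poly₃ (PSAt p) (MvPolynomial.X i) * w = 1 := fun i =>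
    PSAt.exists_inv (by rw [MvPolynomial.eval_X]; exact apply_ne_zero_of_singLocus hp i)
  choose w hw using hX
  set T := (PSAt.euler p).conn J he with hT
  have hdw : ∀ i j, i ≠ j → (PSAt.euler p).d i (w j) = 0 := by
    intro i j hij
    have h := congrArg ((PSAt.euler p).d i) (hw j)
    rw [EulerRing.leib, EulerRing.d_algebraMap, eulerDer_X, if_neg hij, map_zero, zero_mul,
      add_zero, EulerRing.d_one] at h
    calc _ = (algebraMap Poly₃ (PSAt p) (MvPolynomial.X j) * w j) * (PSAt.euler p).d i (w j) := by
          rw [hw, one_mul]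
      _ = w j * (algebraMap Poly₃ (PSAt p) (MvPolynomial.X j) * (PSAt.euler p).d i (w j)) := by ring
      _ = 0 := by rw [h, mul_zero]
  -- the derivations `∂_i = z_i⁻¹ θ_i` of the connection
  let D : Fin 3 → (Idx → PSAt p) →+ (Idx → PSAt p) := fun i =>
    (DistribSMul.toAddMonoidHom (Idx → PSAt p) (w i)).comp (T.θ i)
  have hDapp : ∀ i v, D i v = w i • T.θ i v := fun _ _ => rfl
  have hD : ∀ i j v, D i (D j v) = D j (D i v) := by
    intro i j v
    by_cases hij : i = j
    · rw [hij]
    · rw [hDapp, hDapp, hDapp, hDapp, hT, EulerRing.conn_leib, EulerRing.conn_leib, hdw i j hij,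
        hdw j i (Ne.symm hij), zero_smul, zero_smul, add_zero, add_zero, EulerAction.comm,
        smul_comm]
  have hl : ∀ i (q : Poly₃) v, D i (q • v) = q • D i v + MvPolynomial.pderiv i q • v := by
    intro i q v
    rw [hDapp, hDapp, T.leib, smul_add, smul_comm, eulerDer_apply]
    congr 1
    funext N
    simp only [Pi.smul_apply]
    simp only [Algebra.smul_def, map_mul]
    linear_combination (algebraMap Poly₃ (PSAt p) (MvPolynomial.pderiv i q) * v N) * hw i
  let ev : (Idx → PSAt p) →+ ℂ :=
    { toFun := fun v => ∑ K, c K * constantCoeff (ser (v K))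
      map_zero' := by simp
      map_add' := fun v v' => by simp [mul_add, Finset.sum_add_distrib] }
  have hevapp : ∀ v, ev v = ∑ K, c K * constantCoeff (ser (v K)) := fun _ => rfl
  have hev : ∀ (q : Poly₃) v, ev (q • v) = MvPolynomial.eval p q * ev v := by
    intro q v
    rw [hevapp, hevapp, Finset.mul_sum]
    refine Finset.sum_congr rfl fun K _ => ?_
    rw [Pi.smul_apply, ser_smul, map_mul, constantCoeff_polyAt]
    ring
  let φ : (Idx → PSAt p) →ₗ[Poly₃] PSAt p :=
    { toFun := fun v => ser.symm (taylor D ev v)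
      map_add' := fun v v' => by rw [map_add, map_add]
      map_smul' := fun q v => by
        refine ser.injective ?_
        rw [RingEquiv.apply_symm_apply, taylor_smul hD hl hev, RingHom.id_apply, ser_smul,
          RingEquiv.apply_symm_apply] }
  have hser : ∀ v, ser (φ v) = taylor D ev v := fun v => RingEquiv.apply_symm_apply _ _
  have hφ : ∀ i v, φ (T.θ i v) = (serAction p).θ i (φ v) := by
    intro i v
    have h1 : T.θ i v = (MvPolynomial.X i : Poly₃) • D i v := by
      rw [hDapp]
      funext N
      simp only [Pi.smul_apply]
      rw [Algebra.smul_def, smul_eq_mul, ← mul_assoc, hw, one_mul]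
    refine ser.injective ?_
    rw [h1, map_smul, ser_smul, polyAt_X, ser_θ, hser, hser, pderiv_taylor hD]
  refine ⟨φ (Pi.single (false, false, false) 1), ((PSAt.euler p).conn_isSol J he).map φ hφ,
    fun K => ?_⟩
  rw [← EulerAction.map_mono φ hφ, hT, EulerRing.conn_mono, hser, constantCoeff_taylor, hevapp,
    Finset.sum_eq_single K]
  · simp
  · intro L _ hL
    simp [Pi.single_eq_of_ne hL]
  · simp

/-- Formal solutions converge off the singular locus, and are determined by the values of the
eight squarefree monomials. -/
theorem EulerAction.IsSol.bound {J : Par → ℂ} {f : PSAt p} (hf : (serAction p).IsSol J f)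
    (hp : MvPolynomial.eval p singLocus ≠ 0) : ∃ σ : ℝ, 1 ≤ σ ∧ ∀ M, 0 ≤ M →
      (∀ K, ‖constantCoeff (ser ((serAction p).mono K f))‖ ≤ M) →
      ∀ n, ‖coeff n (ser f)‖ ≤ M * σ ^ tdeg n := by
  -- `singLocus • ∂_i = (connDen • Y_i) θ_i`
  let Y : Fin 3 → Poly₃ := ![MvPolynomial.X 1 * MvPolynomial.X 2,
    MvPolynomial.X 0 * MvPolynomial.X 2, MvPolynomial.X 0 * MvPolynomial.X 1]
  have hY : ∀ i, singLocus = connDen * (Y i * MvPolynomial.X i) := by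
    intro i
    fin_cases i <;> simp only [singLocus, Y, Fin.zero_eta, Fin.mk_one, Fin.reduceFinMk,
      Matrix.cons_val] <;> ring
  have hs : ∀ (i : Fin 3) {g : Series₃}, (Summable fun n => ‖coeff n g‖) →
      Summable fun n => ‖coeff n (X i * g)‖ := by
    intro i g hg
    rw [← (add_left_injective (Finsupp.single i 1 : Fin 3 →₀ ℕ)).summable_iff]
    · refine hg.congr fun n => ?_
      rw [Function.comp_apply, GeomBdd.coeff_X_mul, if_pos (le_add_left le_rfl),
        add_tsub_cancel_right]
    · intro n hn
      rw [GeomBdd.coeff_X_mul, if_neg, norm_zero]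
      exact fun hle => hn ⟨n - Finsupp.single i 1, tsub_add_cancel_of_le hle⟩
  have hsys : ∀ K, polyAt p singLocus * ∑ i, X i * pderiv ℂ i (ser ((serAction p).mono K f))
      = ∑ L, (∑ i, X i * polyAt p (Y i * connMat i K L J)) * ser ((serAction p).mono L f) := by
    intro K
    have h1 : ∀ i, polyAt p singLocus * (X i * pderiv ℂ i (ser ((serAction p).mono K f)))
        = ∑ L, X i * polyAt p (Y i * connMat i K L J) * ser ((serAction p).mono L f) := by
      intro i
      have h2 := congrArg ser (connDen_smul_θ_mono hf i K)
      rw [ser_smul, map_sum, ser_θ] at h2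
      simp only [ser_smul] at h2
      simp only [map_mul (polyAt p) (Y i), mul_assoc]
      rw [← Finset.mul_sum, ← Finset.mul_sum, ← h2, hY i, map_mul, map_mul, polyAt_X]
      ring
    rw [Finset.mul_sum, Finset.sum_congr rfl fun i _ => h1 i, Finset.sum_comm]
    simp only [Finset.sum_mul]
  have hQ : ∀ K L, Summable fun n =>
      ‖coeff n (∑ i, X i * polyAt p (Y i * connMat i K L J))‖ := by
    intro K L
    simp only [map_sum]
    exact Summable.of_nonneg_of_le (fun _ => norm_nonneg _) (fun n => norm_sum_le _ _)
      (summable_sum fun i _ => hs i (summable_norm_coeff_polyAt p _))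
  obtain ⟨σ, hσ, h⟩ := exists_norm_coeff_le_of_system (summable_norm_coeff_polyAt p singLocus)
    hQ (by rwa [constantCoeff_polyAt]) (fun K L => by simp) hsys
  exact ⟨σ, hσ, fun M hM h0 n => h M hM h0 (false, false, false) n⟩

theorem EulerAction.IsSol.geomBdd {J : Par → ℂ} {f : PSAt p} (hf : (serAction p).IsSol J f)
    (hp : MvPolynomial.eval p singLocus ≠ 0) : GeomBdd (ser f) := by
  obtain ⟨σ, hσ, h⟩ := hf.bound hp
  have h0 : 0 ≤ ∑ K, ‖constantCoeff (ser ((serAction p).mono K f))‖ :=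
    Finset.sum_nonneg fun _ _ => norm_nonneg _
  exact ⟨_, σ, h0, hσ, h _ h0 fun K => Finset.single_le_sum
    (f := fun K => ‖constantCoeff (ser ((serAction p).mono K f))‖)
    (fun _ _ => norm_nonneg _) (Finset.mem_univ K)⟩

theorem EulerAction.IsSol.eq_zero {J : Par → ℂ} {f : PSAt p} (hf : (serAction p).IsSol J f)
    (hp : MvPolynomial.eval p singLocus ≠ 0)
    (h0 : ∀ K, constantCoeff (ser ((serAction p).mono K f)) = 0) : f = 0 := by
  obtain ⟨σ, -, h⟩ := hf.bound hp
  refine ser.injective ?_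
  rw [map_zero]
  ext n
  have := h 0 le_rfl (fun K => by rw [h0, norm_zero]) n
  rw [zero_mul] at this
  simpa using this

theorem eq_of_psum_eventuallyEq {f g : PSAt p} (hf : GeomBdd (ser f)) (hg : GeomBdd (ser g))
    (h : psum p (ser f) =ᶠ[𝓝 p] psum p (ser g)) : f = g := by
  refine ser.injective (sub_eq_zero.mp (eq_zero_of_psum_eventuallyEq_zero (p := p) (hf.sub hg) ?_))
  filter_upwards [h, psum_sub hf hg p] with z h1 h2
  rw [h2, h1, sub_self, Pi.zero_apply]

theorem exists_formal_of_mem_solutionGerms (J : Par → ℂ) (φ : solutionGerms J p) :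
    ∃ f : PSAt p, GeomBdd (ser f) ∧ (serAction p).IsSol J f ∧
      ((psum p (ser f) : (Fin 3 → ℂ) → ℂ) : Filter.Germ (𝓝 p) ℂ) = φ := by
  obtain ⟨φ, g, hg, rfl⟩ := φ
  obtain ⟨f, hf, he⟩ := exists_psum_of_analyticAt hg.1
  refine ⟨ser.symm f, hf, ?_, Filter.Germ.coe_eq.mpr he.symm⟩
  exact (isLocalSolution_psum_iff (f := ser.symm f) hf J).mp (hg.congr he)

/-- Off the singular locus the solution germs are parametrized by the values of the eight
squarefree monomials. -/
theorem rank_solutionGerms (J : Par → ℂ) (hp : MvPolynomial.eval p singLocus ≠ 0) :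
    Module.rank ℂ (solutionGerms J p) = 8 := by
  -- the Taylor series of the germs
  choose F hFc hFs hF using exists_formal_of_mem_solutionGerms (p := p) J
  have huniq : ∀ (φ : solutionGerms J p) (f : PSAt p), GeomBdd (ser f) →
      ((psum p (ser f) : (Fin 3 → ℂ) → ℂ) : Filter.Germ (𝓝 p) ℂ) = φ → F φ = f := fun φ f hf h =>
    eq_of_psum_eventuallyEq (hFc φ) hf (Filter.Germ.coe_eq.mp ((hF φ).trans h.symm))
  have hadd : ∀ φ ψ, F (φ + ψ) = F φ + F ψ := by
    intro φ ψ
    refine huniq _ _ ((hFc φ).add (hFc ψ)) ?_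
    rw [Submodule.coe_add, ← hF φ, ← hF ψ, ← Filter.Germ.coe_add]
    exact Filter.Germ.coe_eq.mpr (psum_add (hFc φ) (hFc ψ) p)
  have hsmul : ∀ (c : ℂ) φ, F (c • φ) = (MvPolynomial.C c : Poly₃) • F φ := by
    intro c φ
    refine huniq _ _ ((hFc φ).smul _) ?_
    rw [Submodule.coe_smul, ← hF φ, ← Filter.Germ.coe_smul]
    refine Filter.Germ.coe_eq.mpr ?_
    filter_upwards [psum_smul (hFc φ) (MvPolynomial.C c)] with z hz
    rw [hz, MvPolynomial.eval_C, Pi.smul_apply, smul_eq_mul]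
  let Ψ : solutionGerms J p →ₗ[ℂ] (Idx → ℂ) :=
    { toFun := fun φ K => constantCoeff (ser ((serAction p).mono K (F φ)))
      map_add' := fun φ ψ => by
        funext K
        rw [hadd, EulerAction.mono_add, map_add, map_add, Pi.add_apply]
      map_smul' := fun c φ => by
        funext K
        rw [hsmul, EulerAction.mono_C, ser_smul, polyAt_C, map_mul, constantCoeff_C,
          RingHom.id_apply, Pi.smul_apply, smul_eq_mul] }
  have hΨ : ∀ φ K, Ψ φ K = constantCoeff (ser ((serAction p).mono K (F φ))) := fun _ _ => rfl
  have hbij : Function.Bijective Ψ := by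
    refine ⟨(injective_iff_map_eq_zero Ψ).mpr fun φ h => ?_, fun c => ?_⟩
    · have h0 : F φ = 0 := (hFs φ).eq_zero hp fun K => by rw [← hΨ, h, Pi.zero_apply]
      refine Subtype.ext ?_
      rw [← hF φ, h0, map_zero]
      exact Filter.Germ.coe_eq.mpr (Filter.Eventually.of_forall fun z => psum_zero p z)
    · obtain ⟨f, hf, hc⟩ := exists_formal_solution J hp c
      have hfc := hf.geomBdd hp
      refine ⟨⟨_, psum p (ser f), (isLocalSolution_psum_iff hfc J).mpr hf, rfl⟩, ?_⟩
      funext K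
      rw [hΨ, huniq _ f hfc rfl, hc]
  rw [(LinearEquiv.ofBijective Ψ hbij).rank_eq, rank_fun']
  simp

end LocalSolutions

/-! ### The Lauricella–Saran series -/

section Pochhammer

open Filter Topology

theorem poch_zero (x : ℂ) : poch x 0 = 1 := by simp [poch]

theorem poch_succ (x : ℂ) (n : ℕ) : poch x (n + 1) = poch x n * (x + n) :=
  ascPochhammer_succ_eval n x

theorem mul_poch_add_one (x : ℂ) (n : ℕ) : x * poch (x + 1) n = poch x n * (x + n) := by
  induction n with
  | zero => simp [poch_zero]
  | succ n ih =>
    rw [poch_succ, poch_succ, ← mul_assoc, ih]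
    push_cast
    ring

theorem poch_ne_zero {c : ℂ} (hc : ∀ n : ℕ, c ≠ -(n : ℂ)) (n : ℕ) : poch c n ≠ 0 := by
  induction n with
  | zero => rw [poch_zero]; exact one_ne_zero
  | succ n ih =>
    rw [poch_succ]
    exact mul_ne_zero ih fun h => hc n (eq_neg_of_add_eq_zero_left h)

theorem norm_poch_div_factorial_le (x : ℂ) (n : ℕ) :
    ‖poch x n / n.factorial‖ ≤ (‖x‖ + 1) ^ n := by
  induction n with
  | zero => simp [poch_zero]
  | succ n ih =>
    have h1 : poch x (n + 1) / (n + 1).factorial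
        = poch x n / n.factorial * ((x + n) / (n + 1 : ℕ)) := by
      rw [poch_succ, Nat.factorial_succ]
      push_cast
      field_simp
    have h2 : ‖(x + n) / ((n + 1 : ℕ) : ℂ)‖ ≤ ‖x‖ + 1 := by
      rw [norm_div, Complex.norm_natCast, div_le_iff₀ (by positivity)]
      refine (norm_add_le _ _).trans ?_
      rw [Complex.norm_natCast]
      push_cast
      nlinarith [norm_nonneg x, mul_nonneg (norm_nonneg x) (Nat.cast_nonneg (α := ℝ) n)]
    rw [h1, norm_mul, pow_succ]
    exact mul_le_mul ih h2 (norm_nonneg _) (by positivity)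

theorem exists_norm_factorial_div_poch_le {c : ℂ} (hc : ∀ n : ℕ, c ≠ -(n : ℂ)) :
    ∃ R : ℝ, 1 ≤ R ∧ ∀ n : ℕ, ‖(n.factorial : ℂ) / poch c n‖ ≤ R ^ n := by
  have hne : ∀ n : ℕ, c + n ≠ 0 := fun n h => hc n (eq_neg_of_add_eq_zero_left h)
  have ht : Tendsto (fun n : ℕ => ‖((n : ℂ) + 1) / (c + n)‖) atTop (𝓝 ‖(1 : ℂ)‖) := by
    refine Tendsto.norm ?_
    have h1 : Tendsto (fun n : ℕ => 1 + (1 - c) * ((n : ℂ) + c)⁻¹) atTop (𝓝 (1 + (1 - c) * 0)) := by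
      refine tendsto_const_nhds.add (tendsto_const_nhds.mul ?_)
      refine tendsto_inv₀_cobounded.comp ?_
      rw [← tendsto_norm_atTop_iff_cobounded]
      refine tendsto_atTop_mono (f := fun n : ℕ => (n : ℝ) - ‖c‖) (fun n => ?_)
        (tendsto_atTop_add_const_right _ _ tendsto_natCast_atTop_atTop)
      have := norm_sub_le ((n : ℂ) + c) c
      rw [add_sub_cancel_right, Complex.norm_natCast] at this
      linarith
    rw [mul_zero, add_zero] at h1
    refine h1.congr fun n => ?_
    have := hne n
    rw [add_comm] at this
    rw [add_comm c]
    field_simp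
    ring
  obtain ⟨R, hR⟩ := ht.bddAbove_range
  refine ⟨max 1 R, le_max_left _ _, fun n => ?_⟩
  induction n with
  | zero => simp [poch_zero]
  | succ n ih =>
    have h1 : ((n + 1).factorial : ℂ) / poch c (n + 1)
        = (n.factorial : ℂ) / poch c n * (((n : ℂ) + 1) / (c + n)) := by
      rw [poch_succ, Nat.factorial_succ, div_mul_div_comm]
      push_cast
      ring
    rw [h1, norm_mul, pow_succ]
    exact mul_le_mul ih ((hR ⟨n, rfl⟩).trans (le_max_right _ _)) (norm_nonneg _) (by positivity)

end Pochhammer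

/-- Functions of an exponent that grow at most geometrically. -/
def GeomFun (u : (Fin 3 →₀ ℕ) → ℂ) : Prop := ∃ R : ℝ, 1 ≤ R ∧ ∀ n, ‖u n‖ ≤ R ^ tdeg n

namespace GeomFun

theorem mul {u v : (Fin 3 →₀ ℕ) → ℂ} (hu : GeomFun u) (hv : GeomFun v) :
    GeomFun fun n => u n * v n := by
  obtain ⟨R, hR, hu⟩ := hu
  obtain ⟨S, hS, hv⟩ := hv
  refine ⟨R * S, one_le_mul_of_one_le_of_one_le hR hS, fun n => ?_⟩
  rw [norm_mul, mul_pow]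
  exact mul_le_mul (hu n) (hv n) (norm_nonneg _) (by positivity)

theorem comp {g : ℕ → ℂ} {d : (Fin 3 →₀ ℕ) → ℕ} (hd : ∀ n, d n ≤ tdeg n)
    (hg : ∃ R : ℝ, 1 ≤ R ∧ ∀ k, ‖g k‖ ≤ R ^ k) : GeomFun fun n => g (d n) := by
  obtain ⟨R, hR, h⟩ := hg
  exact ⟨R, hR, fun n => (h _).trans (pow_le_pow_right₀ hR (hd n))⟩

theorem poch_div_factorial (x : ℂ) {d : (Fin 3 →₀ ℕ) → ℕ} (hd : ∀ n, d n ≤ tdeg n) :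
    GeomFun fun n => poch x (d n) / (d n).factorial :=
  comp (g := fun k => poch x k / k.factorial) hd
    ⟨‖x‖ + 1, by linarith [norm_nonneg x], norm_poch_div_factorial_le x⟩

end GeomFun

/-- The coefficients of the Lauricella–Saran series. -/
noncomputable def fnCoeff (J : Par → ℂ) (n : Fin 3 →₀ ℕ) : ℂ :=
  poch (J .a₁) (n 0) / (n 0).factorial * (poch (J .a₂) (n 1) / (n 1).factorial) *
    (poch (J .a₃) (n 2) / (n 2).factorial) *
    (poch (J .b₁) (n 0 + n 2) * poch (J .b₂) (n 1) /
      (poch (J .c₁) (n 0) * poch (J .c₂) (n 1 + n 2)))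

theorem geomFun_fnCoeff {J : Par → ℂ} (h₁ : ∀ n : ℕ, J .c₁ ≠ -(n : ℂ))
    (h₂ : ∀ n : ℕ, J .c₂ ≠ -(n : ℂ)) : GeomFun (fnCoeff J) := by
  have hd0 : ∀ n : Fin 3 →₀ ℕ, n 0 ≤ tdeg n := fun n => by simp only [tdeg]; omega
  have hd1 : ∀ n : Fin 3 →₀ ℕ, n 1 ≤ tdeg n := fun n => by simp only [tdeg]; omega
  have hd2 : ∀ n : Fin 3 →₀ ℕ, n 2 ≤ tdeg n := fun n => by simp only [tdeg]; omega
  have hd02 : ∀ n : Fin 3 →₀ ℕ, n 0 + n 2 ≤ tdeg n := fun n => by simp only [tdeg]; omega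
  have hd12 : ∀ n : Fin 3 →₀ ℕ, n 1 + n 2 ≤ tdeg n := fun n => by simp only [tdeg]; omega
  -- the quotient of factorials is a binomial coefficient over a binomial coefficient
  have hfac : GeomFun fun n => ((n 0 + n 2).factorial * (n 1).factorial : ℂ)
      / ((n 0).factorial * (n 1 + n 2).factorial) := by
    refine ⟨2, one_le_two, fun n => ?_⟩
    have e1 := Nat.add_choose_mul_factorial_mul_factorial (n 0) (n 2)
    have e2 : (n 1).factorial * (n 2).factorial ≤ (n 1 + n 2).factorial :=
      Nat.le_of_dvd (Nat.factorial_pos _) (Nat.factorial_mul_factorial_dvd_factorial_add _ _)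
    have e3 : (n 0 + n 2).choose (n 2) ≤ 2 ^ tdeg n :=
      (Nat.choose_le_two_pow _ _).trans (Nat.pow_le_pow_right two_pos (hd02 n))
    have e4 : (n 0 + n 2).factorial * (n 1).factorial
        ≤ 2 ^ tdeg n * ((n 0).factorial * (n 1 + n 2).factorial) := by
      rw [← e1]
      calc _ = (n 0 + n 2).choose (n 2) * ((n 0).factorial
            * ((n 1).factorial * (n 2).factorial)) := by ring
        _ ≤ _ := by gcongr
    rw [norm_div, norm_mul, norm_mul, Complex.norm_natCast, Complex.norm_natCast,
      Complex.norm_natCast, Complex.norm_natCast, div_le_iff₀ (by positivity)]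
    exact_mod_cast e4
  have h := (((((((GeomFun.poch_div_factorial (J .a₁) hd0).mul
    (GeomFun.poch_div_factorial (J .a₂) hd1)).mul
    (GeomFun.poch_div_factorial (J .a₃) hd2)).mul
    (GeomFun.poch_div_factorial (J .b₁) hd02)).mul
    (GeomFun.poch_div_factorial (J .b₂) hd1)).mul
    (GeomFun.comp hd0 (exists_norm_factorial_div_poch_le h₁))).mul
    (GeomFun.comp hd12 (exists_norm_factorial_div_poch_le h₂))).mul hfac
  refine (congrArg GeomFun (funext fun n => ?_)).mp h
  have p1 := poch_ne_zero h₁ (n 0)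
  have p2 := poch_ne_zero h₂ (n 1 + n 2)
  have f := fun k : ℕ => (Nat.cast_ne_zero (R := ℂ)).mpr (Nat.factorial_ne_zero k)
  have f0 := f (n 0)
  have f1 := f (n 1)
  have f2 := f (n 2)
  have f3 := f (n 0 + n 2)
  have f4 := f (n 1 + n 2)
  rw [fnCoeff]
  field_simp

section Series

open MvPowerSeries PSAt Filter Topology

/-- The Lauricella–Saran series as a formal power series at the origin. -/
noncomputable def fnSeries (J : Par → ℂ) : PSAt 0 := ser.symm fun n => fnCoeff J n

theorem coeff_fnSeries (J : Par → ℂ) (n : Fin 3 →₀ ℕ) :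
    coeff n (ser (fnSeries J)) = fnCoeff J n := rfl

theorem geomBdd_fnSeries {J : Par → ℂ} (h₁ : ∀ n : ℕ, J .c₁ ≠ -(n : ℂ))
    (h₂ : ∀ n : ℕ, J .c₂ ≠ -(n : ℂ)) : GeomBdd (ser (fnSeries J)) := by
  obtain ⟨R, hR, h⟩ := geomFun_fnCoeff h₁ h₂
  exact ⟨1, R, zero_le_one, hR, fun n => by rw [one_mul]; exact h n⟩

theorem lauricellaFNTerm_eq (J : Par → ℂ) (z : Fin 3 → ℂ) (n : Fin 3 →₀ ℕ) :
    lauricellaFNTerm J z n = coeff n (ser (fnSeries J)) * mon n (z - 0) := by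
  rw [coeff_fnSeries, fnCoeff, lauricellaFNTerm, mon, sub_zero]
  ring

theorem lauricellaFN_eq_psum (J : Par → ℂ) : lauricellaFN J = psum 0 (ser (fnSeries J)) := by
  funext z
  rw [lauricellaFN, psum, ← Finsupp.equivFunOnFinite.tsum_eq]
  exact tsum_congr fun n => lauricellaFNTerm_eq J z n

theorem eventually_summable_lauricellaFNTerm {J : Par → ℂ} (h₁ : ∀ n : ℕ, J .c₁ ≠ -(n : ℂ))
    (h₂ : ∀ n : ℕ, J .c₂ ≠ -(n : ℂ)) :
    ∀ᶠ z in 𝓝 (0 : Fin 3 → ℂ), Summable (lauricellaFNTerm J z) := by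
  filter_upwards [eventually_summable (geomBdd_fnSeries h₁ h₂) 0] with z hz
  rw [← Finsupp.equivFunOnFinite.summable_iff]
  exact hz.congr fun n => (lauricellaFNTerm_eq J z n).symm

theorem coeff_ser_lin (s : Finset (Fin 3)) (c : ℂ) (f : PSAt 0) (n : Fin 3 →₀ ℕ) :
    coeff n (ser ((serAction 0).lin s c f)) = (c + ∑ j ∈ s, (n j : ℂ)) * coeff n (ser f) := by
  have h : ∀ j, coeff n (ser ((serAction 0).θ j f)) = n j * coeff n (ser f) := by
    intro j
    rw [ser_θ, Pi.zero_apply, map_zero, add_zero, GeomBdd.coeff_X_mul]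
    split_ifs with hn
    · have h1 : 1 ≤ n j := by simpa using hn j
      rw [coeff_pderiv, tsub_add_cancel_of_le hn, Finsupp.tsub_apply, Finsupp.single_eq_same,
        Nat.cast_sub h1]
      push_cast
      ring
    · have h1 : n j = 0 := by
        by_contra hc
        exact hn (Finsupp.single_le_iff.mpr (Nat.one_le_iff_ne_zero.mpr hc))
      simp [h1]
  rw [EulerAction.lin, map_add, map_sum, map_add, map_sum, ser_smul, polyAt_C, coeff_C_mul,
    Finset.sum_congr rfl fun j _ => h j, add_mul, Finset.sum_mul]

theorem coeff_ser_X_smul (i : Fin 3) (f : PSAt 0) (n : Fin 3 →₀ ℕ) :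
    coeff n (ser ((MvPolynomial.X i : Poly₃) • f)) =
      if Finsupp.single i 1 ≤ n then coeff (n - Finsupp.single i 1) (ser f) else 0 := by
  rw [ser_smul, polyAt_X, Pi.zero_apply, map_zero, add_zero, GeomBdd.coeff_X_mul]

/-- A first order recurrence for the coefficients of `f` is a differential equation for `f`. -/
theorem lin_sub_smul_lin_eq_zero {f : PSAt 0} (i : Fin 3) {s t s' t' : Finset (Fin 3)}
    {c d c' d' : ℂ}
    (h0 : ∀ n : Fin 3 →₀ ℕ, n i = 0 →
      (c + ∑ j ∈ s, (n j : ℂ)) * ((d + ∑ j ∈ t, (n j : ℂ)) * coeff n (ser f)) = 0)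
    (h : ∀ n : Fin 3 →₀ ℕ,
      (c + ∑ j ∈ s, ((n + Finsupp.single i 1 : Fin 3 →₀ ℕ) j : ℂ)) *
        ((d + ∑ j ∈ t, ((n + Finsupp.single i 1 : Fin 3 →₀ ℕ) j : ℂ))
        * coeff (n + Finsupp.single i 1) (ser f))
      = (c' + ∑ j ∈ s', (n j : ℂ)) * ((d' + ∑ j ∈ t', (n j : ℂ)) * coeff n (ser f))) :
    (serAction 0).lin s c ((serAction 0).lin t d f)
      - (MvPolynomial.X i : Poly₃) • (serAction 0).lin s' c' ((serAction 0).lin t' d' f) = 0 := by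
  refine ser.injective (MvPowerSeries.ext fun n => ?_)
  rw [map_sub, map_sub, coeff_ser_X_smul, coeff_ser_lin, coeff_ser_lin, map_zero, map_zero,
    sub_eq_zero]
  split_ifs with hn
  · obtain ⟨m, rfl⟩ := exists_add_of_le hn
    rw [add_tsub_cancel_left, add_comm (Finsupp.single i 1), h, coeff_ser_lin, coeff_ser_lin]
  · refine h0 n ?_
    by_contra hc
    exact hn (Finsupp.single_le_iff.mpr (Nat.one_le_iff_ne_zero.mpr hc))

theorem fnCoeff_add_single_zero (J : Par → ℂ) (n : Fin 3 →₀ ℕ) :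
    fnCoeff J (n + Finsupp.single 0 1) = fnCoeff J n * ((J .a₁ + n 0) * (J .b₁ + (n 0 + n 2)))
      * (((n 0 : ℂ) + 1)⁻¹ * (J .c₁ + n 0)⁻¹) := by
  have e0 : (n + Finsupp.single 0 1 : Fin 3 →₀ ℕ) 0 = n 0 + 1 := by simp
  have e1 : (n + Finsupp.single 0 1 : Fin 3 →₀ ℕ) 1 = n 1 := by simp
  have e2 : (n + Finsupp.single 0 1 : Fin 3 →₀ ℕ) 2 = n 2 := by simp
  rw [fnCoeff, fnCoeff, e0, e1, e2, add_right_comm (n 0) 1 (n 2), poch_succ, poch_succ, poch_succ,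
    Nat.factorial_succ]
  push_cast
  simp only [div_eq_mul_inv, mul_inv]
  ring

theorem fnCoeff_add_single_one (J : Par → ℂ) (n : Fin 3 →₀ ℕ) :
    fnCoeff J (n + Finsupp.single 1 1) = fnCoeff J n * ((J .a₂ + n 1) * (J .b₂ + n 1))
      * (((n 1 : ℂ) + 1)⁻¹ * (J .c₂ + (n 1 + n 2))⁻¹) := by
  have e0 : (n + Finsupp.single 1 1 : Fin 3 →₀ ℕ) 0 = n 0 := by simp
  have e1 : (n + Finsupp.single 1 1 : Fin 3 →₀ ℕ) 1 = n 1 + 1 := by simp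
  have e2 : (n + Finsupp.single 1 1 : Fin 3 →₀ ℕ) 2 = n 2 := by simp
  rw [fnCoeff, fnCoeff, e0, e1, e2, add_right_comm (n 1) 1 (n 2), poch_succ, poch_succ, poch_succ,
    Nat.factorial_succ]
  push_cast
  simp only [div_eq_mul_inv, mul_inv]
  ring

theorem fnCoeff_add_single_two (J : Par → ℂ) (n : Fin 3 →₀ ℕ) :
    fnCoeff J (n + Finsupp.single 2 1) = fnCoeff J n * ((J .a₃ + n 2) * (J .b₁ + (n 0 + n 2)))
      * (((n 2 : ℂ) + 1)⁻¹ * (J .c₂ + (n 1 + n 2))⁻¹) := by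
  have e0 : (n + Finsupp.single 2 1 : Fin 3 →₀ ℕ) 0 = n 0 := by simp
  have e1 : (n + Finsupp.single 2 1 : Fin 3 →₀ ℕ) 1 = n 1 := by simp
  have e2 : (n + Finsupp.single 2 1 : Fin 3 →₀ ℕ) 2 = n 2 + 1 := by simp
  rw [fnCoeff, fnCoeff, e0, e1, e2, ← add_assoc, ← add_assoc, poch_succ, poch_succ, poch_succ,
    Nat.factorial_succ]
  push_cast
  simp only [div_eq_mul_inv, mul_inv]
  ring

theorem isSol_fnSeries {J : Par → ℂ} (h₁ : ∀ n : ℕ, J .c₁ ≠ -(n : ℂ))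
    (h₂ : ∀ n : ℕ, J .c₂ ≠ -(n : ℂ)) : (serAction 0).IsSol J (fnSeries J) := by
  have hc₁ : ∀ n : ℕ, J .c₁ + n ≠ 0 := fun n h => h₁ n (eq_neg_of_add_eq_zero_left h)
  have hc₂ : ∀ m n : ℕ, J .c₂ + (m + n) ≠ 0 := fun m n h => h₂ (m + n) (by
    push_cast
    exact eq_neg_of_add_eq_zero_left h)
  have hk : ∀ k : ℕ, (k : ℂ) + 1 ≠ 0 := Nat.cast_add_one_ne_zero
  have h02 : (0 : Fin 3) ∉ ({2} : Finset (Fin 3)) := by decide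
  have h12 : (1 : Fin 3) ∉ ({2} : Finset (Fin 3)) := by decide
  have key : ∀ x y u v X : ℂ, x ≠ 0 → y ≠ 0 → x * (y * (X * (u * v) * (x⁻¹ * y⁻¹))) = u * (v * X) :=
    fun x y u v X hx hy => by field_simp
  intro j
  fin_cases j
  · refine lin_sub_smul_lin_eq_zero 0 (fun n hn => by simp [hn]) fun n => ?_
    rw [coeff_fnSeries, coeff_fnSeries, fnCoeff_add_single_zero]
    have := key _ _ (J .a₁ + n 0) (J .b₁ + (n 0 + n 2)) (fnCoeff J n) (hk (n 0)) (hc₁ (n 0))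
    simp only [Finset.sum_singleton, Finset.sum_insert h02]
    rw [← this]
    simp
  · refine lin_sub_smul_lin_eq_zero 1 (fun n hn => by simp [hn]) fun n => ?_
    rw [coeff_fnSeries, coeff_fnSeries, fnCoeff_add_single_one]
    have := key _ _ (J .a₂ + n 1) (J .b₂ + n 1) (fnCoeff J n) (hk (n 1)) (hc₂ (n 1) (n 2))
    simp only [Finset.sum_singleton, Finset.sum_insert h12]
    rw [← this]
    simp
    refine Or.inl (Or.inl ?_)
    ring
  · refine lin_sub_smul_lin_eq_zero 2 (fun n hn => by simp [hn]) fun n => ?_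
    rw [coeff_fnSeries, coeff_fnSeries, fnCoeff_add_single_two]
    have := key _ _ (J .a₃ + n 2) (J .b₁ + (n 0 + n 2)) (fnCoeff J n) (hk (n 2)) (hc₂ (n 1) (n 2))
    simp only [Finset.sum_singleton, Finset.sum_insert h12, Finset.sum_insert h02]
    rw [← this]
    simp
    refine Or.inl (Or.inl ?_)
    ring

theorem isLocalSolution_lauricellaFN {J : Par → ℂ} (h₁ : ∀ n : ℕ, J .c₁ ≠ -(n : ℂ))
    (h₂ : ∀ n : ℕ, J .c₂ ≠ -(n : ℂ)) : IsLocalSolution J 0 (lauricellaFN J) := by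
  rw [lauricellaFN_eq_psum]
  exact (isLocalSolution_psum_iff (geomBdd_fnSeries h₁ h₂) J).mpr (isSol_fnSeries h₁ h₂)

end Series

/-! ### Saturated spans and torsion-free quotients -/

namespace EulerAction

variable {M : Type} [AddCommGroup M] [Module Poly₃ M] (T : EulerAction M)

/-- The vectors with a nonzero polynomial multiple in the `ℂ[z]`-span of the squarefree monomials
`θ^K u`. -/
noncomputable def satSpan (u : M) : Submodule Poly₃ M where
  carrier := {w | ∃ S : Poly₃, S ≠ 0 ∧ S • w ∈ Submodule.span Poly₃ (Set.range fun K => T.mono K u)}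
  zero_mem' := ⟨1, one_ne_zero, by rw [smul_zero]; exact Submodule.zero_mem _⟩
  add_mem' := by
    rintro v w ⟨S, hS, h⟩ ⟨S', hS', h'⟩
    refine ⟨S * S', mul_ne_zero hS hS', ?_⟩
    rw [smul_add, mul_comm S S', mul_smul, mul_comm S' S, mul_smul]
    exact Submodule.add_mem _ (Submodule.smul_mem _ _ h) (Submodule.smul_mem _ _ h')
  smul_mem' := by
    rintro q w ⟨S, hS, h⟩
    refine ⟨S, hS, ?_⟩
    rw [smul_comm]
    exact Submodule.smul_mem _ _ h

theorem mono_mem_satSpan (u : M) (K : Idx) : T.mono K u ∈ T.satSpan u :=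
  ⟨1, one_ne_zero, by rw [one_smul]; exact Submodule.subset_span ⟨K, rfl⟩⟩

theorem mem_satSpan_self (u : M) : u ∈ T.satSpan u := T.mono_mem_satSpan u (false, false, false)

theorem mem_satSpan_of_smul_mem {u w : M} {q : Poly₃} (hq : q ≠ 0) (h : q • w ∈ T.satSpan u) :
    w ∈ T.satSpan u := by
  obtain ⟨S, hS, h⟩ := h
  exact ⟨S * q, mul_ne_zero hS hq, by rwa [mul_smul]⟩

variable {T}

theorem IsSol.θ_mem_satSpan {J : Par → ℂ} {u : M} (hu : T.IsSol J u) (i : Fin 3) {w : M}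
    (hw : w ∈ T.satSpan u) : T.θ i w ∈ T.satSpan u := by
  have hW : ∀ v ∈ Submodule.span Poly₃ (Set.range fun K => T.mono K u),
      connDen • T.θ i v ∈ Submodule.span Poly₃ (Set.range fun K => T.mono K u) := by
    intro v hv
    induction hv using Submodule.span_induction with
    | mem v hv =>
      obtain ⟨K, rfl⟩ := hv
      simp only
      rw [connDen_smul_θ_mono hu]
      exact Submodule.sum_mem _ fun L _ => Submodule.smul_mem _ _ (Submodule.subset_span ⟨L, rfl⟩)
    | zero => rw [map_zero, smul_zero]; exact Submodule.zero_mem _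
    | add v w _ _ hv hw => rw [map_add, smul_add]; exact Submodule.add_mem _ hv hw
    | smul q v hv h =>
      rw [T.leib, smul_add, smul_comm]
      exact Submodule.add_mem _ (Submodule.smul_mem _ _ h)
        (Submodule.smul_mem _ _ (Submodule.smul_mem _ _ hv))
  obtain ⟨S, hS, h⟩ := hw
  refine ⟨connDen * (S * S), mul_ne_zero connDen_ne_zero (mul_ne_zero hS hS), ?_⟩
  have e : (connDen * (S * S)) • T.θ i w
      = S • (connDen • T.θ i (S • w)) - (connDen * eulerDer i S) • (S • w) := by
    rw [T.leib]
    module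
  rw [e]
  exact Submodule.sub_mem _ (Submodule.smul_mem _ _ (hW _ h)) (Submodule.smul_mem _ _ h)

theorem IsSol.mono_mem_satSpan {J : Par → ℂ} {u : M} (hu : T.IsSol J u) (K : Idx) {w : M}
    (hw : w ∈ T.satSpan u) : T.mono K w ∈ T.satSpan u := by
  obtain ⟨a, b, c⟩ := K
  cases a <;> cases b <;> cases c <;> simp only [mono, cond_true, cond_false] <;>
    repeat' first | exact hw | apply hu.θ_mem_satSpan

theorem IsSol.lin_mem_satSpan {J : Par → ℂ} {u : M} (hu : T.IsSol J u) (s : Finset (Fin 3)) (c : ℂ)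
    {w : M} (hw : w ∈ T.satSpan u) : T.lin s c w ∈ T.satSpan u :=
  Submodule.add_mem _ (Submodule.smul_mem _ _ hw)
    (Submodule.sum_mem _ fun i _ => hu.θ_mem_satSpan i hw)

theorem IsSol.satSpan_le {J : Par → ℂ} {u v : M} (hu : T.IsSol J u) (hv : v ∈ T.satSpan u) :
    T.satSpan v ≤ T.satSpan u := by
  rintro w ⟨S, hS, h⟩
  refine T.mem_satSpan_of_smul_mem hS ?_
  refine (Submodule.span_le.mpr ?_ : Submodule.span Poly₃ (Set.range fun K => T.mono K v) ≤ _) h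
  rintro _ ⟨K, rfl⟩
  exact hu.mono_mem_satSpan K hv

variable (T) in
/-- The Euler operators on the quotient by a stable submodule. -/
noncomputable def quotient (N : Submodule Poly₃ M) (hN : ∀ i, ∀ m ∈ N, T.θ i m ∈ N) :
    EulerAction (M ⧸ N) where
  θ i := QuotientAddGroup.map N.toAddSubgroup N.toAddSubgroup (T.θ i) (hN i)
  leib i q m := by
    obtain ⟨m, rfl⟩ := N.mkQ_surjective m
    exact congrArg N.mkQ (T.leib i q m)
  comm i j m := by
    obtain ⟨m, rfl⟩ := N.mkQ_surjective m
    exact congrArg N.mkQ (T.comm i j m)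

theorem quotient_θ_mkQ (N : Submodule Poly₃ M) (hN : ∀ i, ∀ m ∈ N, T.θ i m ∈ N) (i : Fin 3)
    (m : M) : N.mkQ (T.θ i m) = (T.quotient N hN).θ i (N.mkQ m) := rfl

variable (T) in
/-- The cyclic module generated by a vector `u` over the commutative algebra generated by the
Euler operators and the constants, as a quotient ring of that algebra. -/
theorem exists_cyclic (u : M) : ∃ (R : Type) (_ : CommRing R) (k : ℂ →+* R) (t : Fin 3 → R)
    (φ : R →+ M), Function.Injective φ ∧ φ 1 = u ∧ (∀ i r, φ (t i * r) = T.θ i (φ r)) ∧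
      ∀ c r, φ (k c * r) = (MvPolynomial.C c : Poly₃) • φ r := by
  let σ : ℂ →+* AddMonoid.End M := (Module.toAddMonoidEnd Poly₃ M).comp MvPolynomial.C
  let θ' : Fin 3 → AddMonoid.End M := T.θ
  let s : Set (AddMonoid.End M) := Set.range θ' ∪ Set.range σ
  have hs : ∀ x ∈ s, ∀ y ∈ s, x * y = y * x := by
    have h1 : ∀ i c, θ' i * σ c = σ c * θ' i := fun i c => AddMonoidHom.ext fun m => T.θ_C i c m
    rintro _ (⟨i, rfl⟩ | ⟨c, rfl⟩) _ (⟨j, rfl⟩ | ⟨d, rfl⟩)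
    · exact AddMonoidHom.ext fun m => T.comm i j m
    · exact h1 i d
    · exact (h1 j c).symm
    · rw [← map_mul, ← map_mul, mul_comm]
  have hcomm : IsMulCommutative (Subring.closure s) := Subring.isMulCommutative_closure hs
  let : CommRing (Subring.closure s) :=
    { (inferInstance : Ring (Subring.closure s)) with mul_comm := hcomm.is_comm.comm }
  let ev : Subring.closure s →+ M :=
    { toFun := fun r => (r : AddMonoid.End M) u
      map_zero' := rfl
      map_add' := fun _ _ => rfl }
  let I : Ideal (Subring.closure s) :=
    { carrier := {r | ev r = 0}
      zero_mem' := map_zero ev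
      add_mem' := fun {a b} ha hb => by
        change ev (a + b) = 0
        rw [map_add, show ev a = 0 from ha, show ev b = 0 from hb, add_zero]
      smul_mem' := fun c r hr => by
        change (c : AddMonoid.End M) (ev r) = 0
        rw [show ev r = 0 from hr, map_zero] }
  let k₀ : ℂ →+* Subring.closure s :=
    σ.codRestrict _ fun c => Subring.subset_closure (Or.inr ⟨c, rfl⟩)
  let t₀ : Fin 3 → Subring.closure s := fun i => ⟨θ' i, Subring.subset_closure (Or.inl ⟨i, rfl⟩)⟩
  let φ : (Subring.closure s ⧸ I) →+ M :=
    QuotientAddGroup.lift I.toAddSubgroup ev fun r hr => hr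
  refine ⟨Subring.closure s ⧸ I, inferInstance, (Ideal.Quotient.mk I).comp k₀,
    fun i => Ideal.Quotient.mk I (t₀ i), φ, ?_, rfl, ?_, ?_⟩
  · refine (injective_iff_map_eq_zero φ).mpr fun r hr => ?_
    obtain ⟨r, rfl⟩ := Ideal.Quotient.mk_surjective r
    exact Ideal.Quotient.eq_zero_iff_mem.mpr hr
  · intro i r
    obtain ⟨r, rfl⟩ := Ideal.Quotient.mk_surjective r
    rfl
  · intro c r
    obtain ⟨r, rfl⟩ := Ideal.Quotient.mk_surjective r
    rfl

end EulerAction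

/-! ### Nonresonant parameters -/

/-- The integral linear form with the given coefficients. -/
def linForm (a₁ a₂ a₃ b₁ b₂ c₁ c₂ : ℤ) : Par → ℤ
  | .a₁ => a₁ | .a₂ => a₂ | .a₃ => a₃ | .b₁ => b₁ | .b₂ => b₂ | .c₁ => c₁ | .c₂ => c₂

/-- The linear forms whose integral values are excluded. -/
def resonanceForms : Finset (Par → ℤ) :=
  {linForm 1 0 0 0 0 0 0, linForm 0 1 0 0 0 0 0, linForm 0 0 1 0 0 0 0, linForm 0 0 0 1 0 0 0,
    linForm 0 0 0 0 1 0 0, linForm 0 0 0 0 0 1 0, linForm 0 0 0 0 0 0 1,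
    linForm 1 0 0 0 0 (-1) 0, linForm 0 0 0 1 0 (-1) 0, linForm 0 1 1 0 0 0 (-1),
    linForm 0 0 1 0 1 0 (-1), linForm 0 1 0 1 0 0 (-1), linForm 0 0 0 1 1 0 (-1),
    linForm 0 1 0 1 0 (-1) (-1), linForm 0 0 0 1 1 (-1) (-1)}

theorem ne_zero_of_mem_resonanceForms : ∀ l ∈ resonanceForms, l ≠ 0 := by
  decide

/-- None of the resonance forms takes an integral value at `J`. -/
def NonRes (J : Par → ℂ) : Prop :=
  ∀ l ∈ resonanceForms, ∀ n : ℤ, ∑ i, (l i : ℂ) * J i ≠ (n : ℂ)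

namespace NonRes

variable {J : Par → ℂ}

theorem add_int (h : NonRes J) (m : Par → ℤ) : NonRes fun i => J i + (m i : ℂ) := by
  intro l hl n e
  refine h l hl (n - ∑ i, l i * m i) ?_
  push_cast
  rw [← e, ← Finset.sum_sub_distrib]
  exact Finset.sum_congr rfl fun i _ => by ring

theorem sum_linForm (a₁ a₂ a₃ b₁ b₂ c₁ c₂ : ℤ) :
    ∑ i, (linForm a₁ a₂ a₃ b₁ b₂ c₁ c₂ i : ℂ) * J i = a₁ * J .a₁ + a₂ * J .a₂ + a₃ * J .a₃
      + b₁ * J .b₁ + b₂ * J .b₂ + c₁ * J .c₁ + c₂ * J .c₂ := by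
  have : (Finset.univ : Finset Par) = {.a₁, .a₂, .a₃, .b₁, .b₂, .c₁, .c₂} := rfl
  rw [this]
  simp [linForm]
  ring

theorem form_ne (h : NonRes J) {a₁ a₂ a₃ b₁ b₂ c₁ c₂ : ℤ}
    (hl : linForm a₁ a₂ a₃ b₁ b₂ c₁ c₂ ∈ resonanceForms) (n : ℤ) :
    a₁ * J .a₁ + a₂ * J .a₂ + a₃ * J .a₃ + b₁ * J .b₁ + b₂ * J .b₂ + c₁ * J .c₁ + c₂ * J .c₂
      - (n : ℂ) ≠ 0 := by
  rw [← sum_linForm]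
  exact sub_ne_zero.mpr (h _ hl n)

theorem a₁ (h : NonRes J) (n : ℤ) : J .a₁ - n ≠ 0 := by
  simpa using h.form_ne (show linForm 1 0 0 0 0 0 0 ∈ _ by decide) n

theorem a₂ (h : NonRes J) (n : ℤ) : J .a₂ - n ≠ 0 := by
  simpa using h.form_ne (show linForm 0 1 0 0 0 0 0 ∈ _ by decide) n

theorem a₃ (h : NonRes J) (n : ℤ) : J .a₃ - n ≠ 0 := by
  simpa using h.form_ne (show linForm 0 0 1 0 0 0 0 ∈ _ by decide) n

theorem b₁ (h : NonRes J) (n : ℤ) : J .b₁ - n ≠ 0 := by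
  simpa using h.form_ne (show linForm 0 0 0 1 0 0 0 ∈ _ by decide) n

theorem b₂ (h : NonRes J) (n : ℤ) : J .b₂ - n ≠ 0 := by
  simpa using h.form_ne (show linForm 0 0 0 0 1 0 0 ∈ _ by decide) n

theorem c₁ (h : NonRes J) (n : ℤ) : J .c₁ - n ≠ 0 := by
  simpa using h.form_ne (show linForm 0 0 0 0 0 1 0 ∈ _ by decide) n

theorem c₂ (h : NonRes J) (n : ℤ) : J .c₂ - n ≠ 0 := by
  simpa using h.form_ne (show linForm 0 0 0 0 0 0 1 ∈ _ by decide) n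

theorem a₁c₁ (h : NonRes J) (n : ℤ) : J .a₁ - J .c₁ - n ≠ 0 := by
  simpa [← sub_eq_add_neg] using h.form_ne (show linForm 1 0 0 0 0 (-1) 0 ∈ _ by decide) n

theorem b₁c₁ (h : NonRes J) (n : ℤ) : J .b₁ - J .c₁ - n ≠ 0 := by
  simpa [← sub_eq_add_neg] using h.form_ne (show linForm 0 0 0 1 0 (-1) 0 ∈ _ by decide) n

theorem a₂a₃c₂ (h : NonRes J) (n : ℤ) : J .a₂ + J .a₃ - J .c₂ - n ≠ 0 := by
  simpa [← sub_eq_add_neg] using h.form_ne (show linForm 0 1 1 0 0 0 (-1) ∈ _ by decide) n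

theorem a₃b₂c₂ (h : NonRes J) (n : ℤ) : J .a₃ + J .b₂ - J .c₂ - n ≠ 0 := by
  simpa [← sub_eq_add_neg] using h.form_ne (show linForm 0 0 1 0 1 0 (-1) ∈ _ by decide) n

theorem a₂b₁c₂ (h : NonRes J) (n : ℤ) : J .a₂ + J .b₁ - J .c₂ - n ≠ 0 := by
  simpa [← sub_eq_add_neg] using h.form_ne (show linForm 0 1 0 1 0 0 (-1) ∈ _ by decide) n

theorem b₁b₂c₂ (h : NonRes J) (n : ℤ) : J .b₁ + J .b₂ - J .c₂ - n ≠ 0 := by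
  simpa [← sub_eq_add_neg] using h.form_ne (show linForm 0 0 0 1 1 0 (-1) ∈ _ by decide) n

theorem a₂b₁c₁c₂ (h : NonRes J) (n : ℤ) : J .a₂ + J .b₁ - J .c₁ - J .c₂ - n ≠ 0 := by
  simpa [← sub_eq_add_neg] using h.form_ne (show linForm 0 1 0 1 0 (-1) (-1) ∈ _ by decide) n

theorem b₁b₂c₁c₂ (h : NonRes J) (n : ℤ) : J .b₁ + J .b₂ - J .c₁ - J .c₂ - n ≠ 0 := by
  simpa [← sub_eq_add_neg] using h.form_ne (show linForm 0 0 0 1 1 (-1) (-1) ∈ _ by decide) n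

theorem c₁_ne_neg (h : NonRes J) (n : ℕ) : J .c₁ ≠ -(n : ℂ) := fun e =>
  h.c₁ (-n) (by rw [e]; push_cast; ring)

theorem c₂_ne_neg (h : NonRes J) (n : ℕ) : J .c₂ ≠ -(n : ℂ) := fun e =>
  h.c₂ (-n) (by rw [e]; push_cast; ring)

end NonRes

/-! ### Injectivity of the contiguity operators -/

/-- A triple `x, y, z` in a commutative `ℂ`-algebra that satisfies the Horn system in the weak
sense that for each of its three equations the two sides vanish simultaneously, the factor `z_i` of
the right hand side being dropped. -/
structure WeakHorn {R : Type} [CommRing R] (k : ℂ →+* R) (J : Par → ℂ) (x y z : R) : Prop where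
  h₁ : x * (x + k (J .c₁ - 1)) = 0 ↔ (x + k (J .a₁)) * (x + z + k (J .b₁)) = 0
  h₂ : y * (y + z + k (J .c₂ - 1)) = 0 ↔ (y + k (J .a₂)) * (y + k (J .b₂)) = 0
  h₃ : z * (y + z + k (J .c₂ - 1)) = 0 ↔ (z + k (J .a₃)) * (x + z + k (J .b₁)) = 0

namespace WeakHorn

variable {R : Type} [CommRing R] {k : ℂ →+* R} {J : Par → ℂ} {x y z : R}

theorem eq_zero_of_const_mul {c : ℂ} (hc : c ≠ 0) {r : R} (h : k c * r = 0) : r = 0 := by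
  have h1 : k c⁻¹ * k c = 1 := by rw [← map_mul, inv_mul_cancel₀ hc, map_one]
  calc r = k c⁻¹ * (k c * r) := by rw [← mul_assoc, h1, one_mul]
    _ = 0 := by rw [h, mul_zero]

/-- Two coprime quadratic equations have no common root. -/
theorem one_eq_zero_of_coprime {r₁ r₂ s₁ s₂ : ℂ} (h₁₁ : r₁ - s₁ ≠ 0) (h₁₂ : r₁ - s₂ ≠ 0)
    (h₂₁ : r₂ - s₁ ≠ 0) (h₂₂ : r₂ - s₂ ≠ 0) {t : R} (hr : (t - k r₁) * (t - k r₂) = 0)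
    (hs : (t - k s₁) * (t - k s₂) = 0) : (1 : R) = 0 := by
  have e : t - k r₂ = 0 := by
    refine eq_zero_of_const_mul (k := k) (mul_ne_zero h₁₁ h₁₂) ?_
    simp only [map_mul, map_sub]
    linear_combination (t - k r₂) * hs - (t + k r₁ - k s₁ - k s₂) * hr
  refine eq_zero_of_const_mul (k := k) (mul_ne_zero h₂₁ h₂₂) ?_
  simp only [map_mul, map_sub]
  linear_combination hs - (t + k r₂ - k s₁ - k s₂) * e

/-- A contiguity operator that vanishes makes the left or the right hand side of one of the
equations vanish. Passing back and forth between the two sides, one arrives at equations without a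
common solution, unless a resonance form takes an integral value. -/
theorem one_eq_zero_of_a₁ (H : WeakHorn k J x y z) (hJ : NonRes J)
    (h : x + k (J .a₁) = 0) : (1 : R) = 0 := by
  have e := H.h₁.mpr (by rw [h, zero_mul])
  refine eq_zero_of_const_mul (k := k) (mul_ne_zero (hJ.a₁ 0) (hJ.a₁c₁ (-1))) ?_
  push_cast
  simp only [map_mul, map_sub, map_one, map_neg, map_zero] at e ⊢
  linear_combination e - (x - k (J .a₁) + k (J .c₁) - 1) * h

/-- The cases of the operators `θ₂ + a₂` and `θ₂ + b₂`, which play symmetric roles. -/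
theorem one_eq_zero_of_eq_neg {α β : ℂ} (H : WeakHorn k J x y z)
    (hα : ∀ n : ℤ, α - n ≠ 0) (hα₃ : ∀ n : ℤ, α + J .a₃ - J .c₂ - n ≠ 0)
    (hα₁ : ∀ n : ℤ, α + J .b₁ - J .c₂ - n ≠ 0)
    (hα₁₁ : ∀ n : ℤ, α + J .b₁ - J .c₁ - J .c₂ - n ≠ 0)
    (h₂ : y * (y + z + k (J .c₂ - 1)) = 0 ↔ (y + k α) * (y + k β) = 0)
    (h : y + k α = 0) : (1 : R) = 0 := by
  have e := h₂.mpr (by rw [h, zero_mul])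
  have hz : y + z + k (J .c₂ - 1) = 0 := by
    refine eq_zero_of_const_mul (k := k) (hα 0) ?_
    push_cast
    simp only [map_sub, sub_zero]
    simp only [map_sub] at e
    linear_combination -e + (y + z + k (J .c₂) - k 1) * h
  have e₃ := H.h₃.mp (by rw [hz, mul_zero])
  have hx : x + z + k (J .b₁) = 0 := by
    refine eq_zero_of_const_mul (k := k) (hα₃ (-1)) ?_
    push_cast
    simp only [map_sub, map_add, map_neg, map_one] at e₃ hz ⊢
    linear_combination e₃ + (x + z + k (J .b₁)) * (h - hz)
  have e₁ := H.h₁.mpr (by rw [hx, mul_zero])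
  refine eq_zero_of_const_mul (k := k) (mul_ne_zero (hα₁ (-1)) (hα₁₁ (-2))) ?_
  push_cast
  simp only [map_mul, map_sub, map_add, map_neg, map_one, map_ofNat] at e₁ hz ⊢
  -- `x` equals `-(α + b₁ - c₂ + 1)`
  have hx' : x = -(k α + k (J .b₁) - k (J .c₂) + 1) := by linear_combination hx - hz + h
  rw [hx'] at e₁
  linear_combination e₁

theorem one_eq_zero_of_a₂ (H : WeakHorn k J x y z) (hJ : NonRes J)
    (h : y + k (J .a₂) = 0) : (1 : R) = 0 :=
  H.one_eq_zero_of_eq_neg hJ.a₂ hJ.a₂a₃c₂ hJ.a₂b₁c₂ hJ.a₂b₁c₁c₂ H.h₂ h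

theorem one_eq_zero_of_b₂ (H : WeakHorn k J x y z) (hJ : NonRes J)
    (h : y + k (J .b₂) = 0) : (1 : R) = 0 := by
  refine H.one_eq_zero_of_eq_neg (β := J .a₂) hJ.b₂ (fun n => ?_) (fun n => ?_) (fun n => ?_)
    (by rw [H.h₂, mul_comm]) h
  · rw [add_comm (J .b₂)]; exact hJ.a₃b₂c₂ n
  · rw [add_comm (J .b₂)]; exact hJ.b₁b₂c₂ n
  · rw [add_comm (J .b₂)]; exact hJ.b₁b₂c₁c₂ n

theorem one_eq_zero_of_a₃ (H : WeakHorn k J x y z) (hJ : NonRes J)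
    (h : z + k (J .a₃) = 0) : (1 : R) = 0 := by
  have e := H.h₃.mpr (by rw [h, zero_mul])
  have hy : y + z + k (J .c₂ - 1) = 0 := by
    refine eq_zero_of_const_mul (k := k) (hJ.a₃ 0) ?_
    push_cast
    simp only [map_sub, sub_zero]
    simp only [map_sub] at e
    linear_combination -e + (y + z + k (J .c₂) - k 1) * h
  have e₂ := H.h₂.mp (by rw [hy, mul_zero])
  refine eq_zero_of_const_mul (k := k) (mul_ne_zero (hJ.a₂a₃c₂ (-1)) (hJ.a₃b₂c₂ (-1))) ?_
  push_cast
  simp only [map_mul, map_sub, map_add, map_neg, map_one] at hy ⊢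
  have hy' : y = k (J .a₃) - k (J .c₂) + 1 := by linear_combination hy - h
  rw [hy'] at e₂
  linear_combination e₂

theorem one_eq_zero_of_b₁ (H : WeakHorn k J x y z) (hJ : NonRes J)
    (h : x + z + k (J .b₁) = 0) : (1 : R) = 0 := by
  have e₁ := H.h₁.mpr (by rw [h, mul_zero])
  have e₃ := H.h₃.mpr (by rw [h, mul_zero])
  have hx : x = -(z + k (J .b₁)) := by linear_combination h
  rw [hx] at e₁
  have hy : y + z + k (J .c₂ - 1) = 0 := by
    refine eq_zero_of_const_mul (k := k) (mul_ne_zero (hJ.b₁ 0) (hJ.b₁c₁ (-1))) ?_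
    push_cast
    simp only [map_mul, map_sub, sub_zero, map_neg, map_one] at e₁ e₃ ⊢
    linear_combination (y + z + k (J .c₂) - 1) * e₁ - (z + 2 * k (J .b₁) + 1 - k (J .c₁)) * e₃
  have e₂ := H.h₂.mp (by rw [hy, mul_zero])
  have hy' : y = -(z + k (J .c₂ - 1)) := by linear_combination hy
  rw [hy'] at e₂
  refine one_eq_zero_of_coprime (k := k) (t := z) (r₁ := J .a₂ - J .c₂ + 1)
    (r₂ := J .b₂ - J .c₂ + 1) (s₁ := -J .b₁) (s₂ := J .c₁ - J .b₁ - 1) ?_ ?_ ?_ ?_ ?_ ?_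
  · convert hJ.a₂b₁c₂ (-1) using 1; push_cast; ring
  · convert hJ.a₂b₁c₁c₂ (-2) using 1; push_cast; ring
  · convert hJ.b₁b₂c₂ (-1) using 1; push_cast; ring
  · convert hJ.b₁b₂c₁c₂ (-2) using 1; push_cast; ring
  · simp only [map_sub, map_add, map_one] at e₂ ⊢
    linear_combination e₂
  · simp only [map_sub, map_neg, map_one] at e₁ ⊢
    linear_combination e₁

theorem one_eq_zero_of_c₁ (H : WeakHorn k J x y z) (hJ : NonRes J)
    (h : x + k (J .c₁ - 1) = 0) : (1 : R) = 0 := by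
  have e₁ := H.h₁.mp (by rw [h, mul_zero])
  have hz : x + z + k (J .b₁) = 0 := by
    refine eq_zero_of_const_mul (k := k) (hJ.a₁c₁ (-1)) ?_
    push_cast
    simp only [map_sub, map_neg, map_one] at h ⊢
    linear_combination e₁ - (x + z + k (J .b₁)) * h
  have e₃ := H.h₃.mpr (by rw [hz, mul_zero])
  have hy : y + z + k (J .c₂ - 1) = 0 := by
    refine eq_zero_of_const_mul (k := k) (hJ.b₁c₁ (-1)) ?_
    push_cast
    simp only [map_sub, map_neg, map_one] at h e₃ ⊢
    linear_combination -e₃ + (y + z + k (J .c₂) - 1) * (hz - h)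
  have e₂ := H.h₂.mp (by rw [hy, mul_zero])
  refine eq_zero_of_const_mul (k := k) (mul_ne_zero (hJ.a₂b₁c₁c₂ (-2)) (hJ.b₁b₂c₁c₂ (-2))) ?_
  push_cast
  simp only [map_mul, map_sub, map_add, map_neg, map_one, map_ofNat] at h hy ⊢
  have hy' : y = k (J .b₁) - k (J .c₁) - k (J .c₂) + 2 := by linear_combination hy - hz + h
  rw [hy'] at e₂
  linear_combination e₂

theorem one_eq_zero_of_c₂ (H : WeakHorn k J x y z) (hJ : NonRes J)
    (h : y + z + k (J .c₂ - 1) = 0) : (1 : R) = 0 := by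
  have e₂ := H.h₂.mp (by rw [h, mul_zero])
  have e₃ := H.h₃.mp (by rw [h, mul_zero])
  have hz : z = -(y + k (J .c₂ - 1)) := by linear_combination h
  have hx : x + z + k (J .b₁) = 0 := by
    refine eq_zero_of_const_mul (k := k) (mul_ne_zero (hJ.a₂a₃c₂ (-1)) (hJ.a₃b₂c₂ (-1))) ?_
    push_cast
    simp only [map_mul, map_sub, map_add, map_neg, map_one] at hz ⊢
    rw [hz] at e₃ ⊢
    linear_combination (x - (y + (k (J .c₂) - 1)) + k (J .b₁)) * e₂
      + (y + k (J .a₃) - k (J .c₂) + 1 + k (J .a₂) + k (J .b₂)) * e₃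
  have e₁ := H.h₁.mpr (by rw [hx, mul_zero])
  have hx' : x = y + k (J .c₂ - 1) - k (J .b₁) := by linear_combination hx - hz
  rw [hx'] at e₁
  refine one_eq_zero_of_coprime (k := k) (t := y) (r₁ := -J .a₂)
    (r₂ := -J .b₂) (s₁ := J .b₁ - J .c₂ + 1) (s₂ := J .b₁ - J .c₁ - J .c₂ + 2) ?_ ?_ ?_ ?_ ?_ ?_
  · convert neg_ne_zero.mpr (hJ.a₂b₁c₂ (-1)) using 1; push_cast; ring
  · convert neg_ne_zero.mpr (hJ.a₂b₁c₁c₂ (-2)) using 1; push_cast; ring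
  · convert neg_ne_zero.mpr (hJ.b₁b₂c₂ (-1)) using 1; push_cast; ring
  · convert neg_ne_zero.mpr (hJ.b₁b₂c₁c₂ (-2)) using 1; push_cast; ring
  · simp only [map_neg]
    linear_combination e₂
  · simp only [map_sub, map_add, map_one, map_ofNat] at e₁ ⊢
    linear_combination e₁

end WeakHorn

namespace EulerAction

variable {M : Type} [AddCommGroup M] [Module Poly₃ M] {T : EulerAction M}

/-- On torsion-free modules a solution generates a triple of commuting elements that satisfies the
Horn system in the weak sense, as multiplication by a variable is injective. -/
theorem IsSol.exists_weakHorn (htf : ∀ (q : Poly₃) (m : M), q ≠ 0 → q • m = 0 → m = 0)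
    {J : Par → ℂ} {u : M} (hu : T.IsSol J u) :
    ∃ (R : Type) (_ : CommRing R) (k : ℂ →+* R) (t : Fin 3 → R), WeakHorn k J (t 0) (t 1) (t 2) ∧
      (∀ s c, T.lin s c u = 0 → ∑ i ∈ s, t i + k c = 0) ∧ ((1 : R) = 0 → u = 0) := by
  obtain ⟨R, hR, k, t, φ, hφ, h1, ht, hk⟩ := T.exists_cyclic u
  have hlin : ∀ s c r, T.lin s c (φ r) = φ ((∑ i ∈ s, t i + k c) * r) := by
    intro s c r
    rw [lin, add_mul, Finset.sum_mul, map_add, map_sum, hk, add_comm]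
    simp only [ht]
  have hiff : ∀ {i : Fin 3} {a b : R}, φ a = (MvPolynomial.X i : Poly₃) • φ b →
      (a = 0 ↔ b = 0) := by
    intro i a b h
    constructor
    · rintro rfl
      refine (injective_iff_map_eq_zero φ).mp hφ b (htf _ _ (MvPolynomial.X_ne_zero i) ?_)
      rw [← h, map_zero]
    · rintro rfl
      rw [map_zero, smul_zero] at h
      exact (injective_iff_map_eq_zero φ).mp hφ a h
  have h02 : (0 : Fin 3) ≠ 2 := by decide
  have h12 : (1 : Fin 3) ≠ 2 := by decide
  refine ⟨R, hR, k, t, ⟨?_, ?_, ?_⟩, fun s c h => ?_, fun h => ?_⟩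
  · refine hiff (i := 0) (sub_eq_zero.mp (Eq.trans ?_ (hu 0)))
    rw [← h1, horn, Matrix.cons_val_zero]
    simp only [hlin, Finset.sum_singleton, Finset.sum_pair h02, map_zero, add_zero, mul_one]
  · refine hiff (i := 1) (sub_eq_zero.mp (Eq.trans ?_ (hu 1)))
    rw [← h1, horn, Matrix.cons_val_one, Matrix.cons_val_zero]
    simp only [hlin, Finset.sum_singleton, Finset.sum_pair h12, map_zero, add_zero, mul_one]
  · refine hiff (i := 2) (sub_eq_zero.mp (Eq.trans ?_ (hu 2)))
    rw [← h1, horn, Matrix.cons_val_two, Matrix.tail_cons, Matrix.head_cons]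
    simp only [hlin, Finset.sum_singleton, Finset.sum_pair h02, Finset.sum_pair h12, map_zero,
      add_zero, mul_one]
  · refine (injective_iff_map_eq_zero φ).mp hφ _ ?_
    rw [← h1, hlin, mul_one] at h
    exact h
  · rw [← h1, h, map_zero]

/-- The first order operators that shift one of the parameters: those of the upper parameters raise
them by `1`, those of `c₁` and `c₂` lower them by `1`. -/
inductive IsContiguityOp (J : Par → ℂ) : Finset (Fin 3) → ℂ → Prop
  | a₁ : IsContiguityOp J {0} (J .a₁)
  | a₂ : IsContiguityOp J {1} (J .a₂)
  | a₃ : IsContiguityOp J {2} (J .a₃)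
  | b₁ : IsContiguityOp J {0, 2} (J .b₁)
  | b₂ : IsContiguityOp J {1} (J .b₂)
  | c₁ : IsContiguityOp J {0} (J .c₁ - 1)
  | c₂ : IsContiguityOp J {1, 2} (J .c₂ - 1)

/-- For nonresonant parameters the contiguity operators kill no nonzero solution with values in a
torsion-free module. -/
theorem IsSol.eq_zero_of_contiguity
    (htf : ∀ (q : Poly₃) (m : M), q ≠ 0 → q • m = 0 → m = 0)
    {J : Par → ℂ} (hJ : NonRes J) {u : M} (hu : T.IsSol J u) {s : Finset (Fin 3)} {c : ℂ}
    (hs : IsContiguityOp J s c) (h : T.lin s c u = 0) : u = 0 := by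
  obtain ⟨R, _, k, t, H, hl, h1⟩ := hu.exists_weakHorn htf
  refine h1 ?_
  have h02 : (0 : Fin 3) ≠ 2 := by decide
  have h12 : (1 : Fin 3) ≠ 2 := by decide
  have h := hl s c h
  cases hs <;> simp only [Finset.sum_singleton, Finset.sum_pair h02, Finset.sum_pair h12] at h
  · exact H.one_eq_zero_of_a₁ hJ h
  · exact H.one_eq_zero_of_a₂ hJ h
  · exact H.one_eq_zero_of_a₃ hJ h
  · exact H.one_eq_zero_of_b₁ hJ h
  · exact H.one_eq_zero_of_b₂ hJ h
  · exact H.one_eq_zero_of_c₁ hJ h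
  · exact H.one_eq_zero_of_c₂ hJ h

/-- Two solutions related by a contiguity operator span the same space over `ℂ(z)`: the operator
becomes zero on the class of `u` modulo the saturated span of `v`, so that this class is zero. -/
theorem IsSol.satSpan_eq {J J' : Par → ℂ} (hJ : NonRes J) {u v : M} (hu : T.IsSol J u)
    (hv : T.IsSol J' v) {s : Finset (Fin 3)} {c d : ℂ} (hs : IsContiguityOp J s c) (hd : d ≠ 0)
    (h : T.lin s c u = (MvPolynomial.C d : Poly₃) • v) : T.satSpan u = T.satSpan v := by
  refine le_antisymm (hv.satSpan_le ?_) (hu.satSpan_le ?_)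
  · have hN : ∀ i, ∀ m ∈ T.satSpan v, T.θ i m ∈ T.satSpan v := fun i m hm => hv.θ_mem_satSpan i hm
    refine (Submodule.Quotient.mk_eq_zero _).mp ((hu.map (T.satSpan v).mkQ
      (quotient_θ_mkQ _ hN)).eq_zero_of_contiguity ?_ hJ hs ?_)
    · intro q m hq hm
      obtain ⟨m, rfl⟩ := (T.satSpan v).mkQ_surjective m
      rw [← map_smul] at hm
      exact (Submodule.Quotient.mk_eq_zero _).mpr
        (T.mem_satSpan_of_smul_mem hq ((Submodule.Quotient.mk_eq_zero _).mp hm))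
    · rw [← map_lin _ (quotient_θ_mkQ _ hN), h]
      exact (Submodule.Quotient.mk_eq_zero _).mpr
        (Submodule.smul_mem _ _ (T.mem_satSpan_self v))
  · refine T.mem_satSpan_of_smul_mem (MvPolynomial.C_ne_zero.mpr hd) ?_
    rw [← h]
    exact hu.lin_mem_satSpan s c (T.mem_satSpan_self u)

end EulerAction

/-! ### Integral shifts of the parameters -/

section Shifts

open MvPowerSeries PSAt Filter Topology

theorem lin_fnSeries {J J' : Par → ℂ} {s : Finset (Fin 3)} {c d : ℂ}
    (h : ∀ n : Fin 3 →₀ ℕ, (c + ∑ j ∈ s, (n j : ℂ)) * fnCoeff J n = d * fnCoeff J' n) :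
    (serAction 0).lin s c (fnSeries J) = (MvPolynomial.C d : Poly₃) • fnSeries J' := by
  refine ser.injective (MvPowerSeries.ext fun n => ?_)
  rw [coeff_ser_lin, ser_smul, polyAt_C, coeff_C_mul]
  exact h n

theorem mul_inv_poch_add_one {c : ℂ} (hc : ∀ n : ℕ, c ≠ -(n : ℂ)) (n : ℕ) :
    (c + n) * (poch (c + 1) n)⁻¹ = c * (poch c n)⁻¹ := by
  have h0 : c ≠ 0 := fun h => hc 0 (by simp [h])
  have h := mul_poch_add_one c n
  have h1 := poch_ne_zero hc n
  have h2 : c + n ≠ 0 := fun h => hc n (eq_neg_of_add_eq_zero_left h)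
  have h3 : poch (c + 1) n ≠ 0 := fun h3 => mul_ne_zero h1 h2 (by rw [← h, h3, mul_zero])
  field_simp
  linear_combination -h

/-- The span of the derivatives of `F_N` over `ℂ(z)` does not change when one of the parameters
grows by `1`. -/
theorem satSpan_fnSeries_add_one {J : Par → ℂ} (hJ : NonRes J) (i : Par) :
    (serAction 0).satSpan (fnSeries fun j => J j + ((Pi.single i 1 : Par → ℤ) j : ℂ))
      = (serAction 0).satSpan (fnSeries J) := by
  have hJ' := hJ.add_int (Pi.single i 1)
  obtain ⟨J', hJ'def⟩ : ∃ J' : Par → ℂ, J' = fun j => J j + ((Pi.single i 1 : Par → ℤ) j : ℂ) :=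
    ⟨_, rfl⟩
  rw [← hJ'def] at hJ' ⊢
  have hu := isSol_fnSeries hJ.c₁_ne_neg hJ.c₂_ne_neg
  have hv := isSol_fnSeries hJ'.c₁_ne_neg hJ'.c₂_ne_neg
  have hi : J' i = J i + 1 := by simp [hJ'def]
  have hne : ∀ j, j ≠ i → J' j = J j := fun j hj => by simp [hJ'def, Pi.single_eq_of_ne hj]
  have h02 : (0 : Fin 3) ≠ 2 := by decide
  have h12 : (1 : Fin 3) ≠ 2 := by decide
  clear hJ'def
  cases i
  · refine (hu.satSpan_eq hJ hv .a₁ (by simpa using hJ.a₁ 0)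
      (lin_fnSeries fun n => ?_)).symm
    have h := mul_poch_add_one (J .a₁) (n 0)
    rw [fnCoeff, fnCoeff, hi, hne .a₂ (by decide), hne .a₃ (by decide),
      hne .b₁ (by decide), hne .b₂ (by decide),
      hne .c₁ (by decide), hne .c₂ (by decide), Finset.sum_singleton]
    generalize poch (J .a₁ + 1) (n 0) = q at h ⊢
    generalize poch (J .a₁) (n 0) = p at h ⊢
    grind
  · refine (hu.satSpan_eq hJ hv .a₂ (by simpa using hJ.a₂ 0)
      (lin_fnSeries fun n => ?_)).symm
    have h := mul_poch_add_one (J .a₂) (n 1)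
    rw [fnCoeff, fnCoeff, hi, hne .a₁ (by decide), hne .a₃ (by decide),
      hne .b₁ (by decide), hne .b₂ (by decide),
      hne .c₁ (by decide), hne .c₂ (by decide), Finset.sum_singleton]
    generalize poch (J .a₂ + 1) (n 1) = q at h ⊢
    generalize poch (J .a₂) (n 1) = p at h ⊢
    grind
  · refine (hu.satSpan_eq hJ hv .a₃ (by simpa using hJ.a₃ 0)
      (lin_fnSeries fun n => ?_)).symm
    have h := mul_poch_add_one (J .a₃) (n 2)
    rw [fnCoeff, fnCoeff, hi, hne .a₁ (by decide), hne .a₂ (by decide),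
      hne .b₁ (by decide), hne .b₂ (by decide),
      hne .c₁ (by decide), hne .c₂ (by decide), Finset.sum_singleton]
    generalize poch (J .a₃ + 1) (n 2) = q at h ⊢
    generalize poch (J .a₃) (n 2) = p at h ⊢
    grind
  · refine (hu.satSpan_eq hJ hv .b₁ (by simpa using hJ.b₁ 0)
      (lin_fnSeries fun n => ?_)).symm
    have h := mul_poch_add_one (J .b₁) (n 0 + n 2)
    push_cast at h
    rw [fnCoeff, fnCoeff, hi, hne .a₁ (by decide), hne .a₂ (by decide), hne .a₃ (by decide),
      hne .b₂ (by decide),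
      hne .c₁ (by decide), hne .c₂ (by decide), Finset.sum_pair h02]
    generalize poch (J .b₁ + 1) (n 0 + n 2) = q at h ⊢
    generalize poch (J .b₁) (n 0 + n 2) = p at h ⊢
    grind
  · refine (hu.satSpan_eq hJ hv .b₂ (by simpa using hJ.b₂ 0)
      (lin_fnSeries fun n => ?_)).symm
    have h := mul_poch_add_one (J .b₂) (n 1)
    rw [fnCoeff, fnCoeff, hi, hne .a₁ (by decide), hne .a₂ (by decide), hne .a₃ (by decide),
      hne .b₁ (by decide),
      hne .c₁ (by decide), hne .c₂ (by decide), Finset.sum_singleton]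
    generalize poch (J .b₂ + 1) (n 1) = q at h ⊢
    generalize poch (J .b₂) (n 1) = p at h ⊢
    grind
  · refine hv.satSpan_eq hJ' hu .c₁ (by simpa using hJ.c₁ 0) (lin_fnSeries fun n => ?_)
    have h := mul_inv_poch_add_one hJ.c₁_ne_neg (n 0)
    rw [fnCoeff, fnCoeff, hi, hne .a₁ (by decide), hne .a₂ (by decide), hne .a₃ (by decide),
      hne .b₁ (by decide), hne .b₂ (by decide),
      hne .c₂ (by decide), Finset.sum_singleton,
      add_sub_cancel_right, div_eq_mul_inv _ (poch _ _ * _), div_eq_mul_inv _ (poch _ _ * _),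
      mul_inv, mul_inv]
    generalize (poch (J .c₁ + 1) (n 0))⁻¹ = q at h ⊢
    generalize (poch (J .c₁) (n 0))⁻¹ = p at h ⊢
    grind
  · refine hv.satSpan_eq hJ' hu .c₂ (by simpa using hJ.c₂ 0) (lin_fnSeries fun n => ?_)
    have h := mul_inv_poch_add_one hJ.c₂_ne_neg (n 1 + n 2)
    push_cast at h
    rw [fnCoeff, fnCoeff, hi, hne .a₁ (by decide), hne .a₂ (by decide), hne .a₃ (by decide),
      hne .b₁ (by decide), hne .b₂ (by decide),
      hne .c₁ (by decide), Finset.sum_pair h12,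
      add_sub_cancel_right, div_eq_mul_inv _ (poch _ _ * _), div_eq_mul_inv _ (poch _ _ * _),
      mul_inv, mul_inv]
    generalize (poch (J .c₂ + 1) (n 1 + n 2))⁻¹ = q at h ⊢
    generalize (poch (J .c₂) (n 1 + n 2))⁻¹ = p at h ⊢
    grind

theorem satSpan_fnSeries_add {J : Par → ℂ} (hJ : NonRes J) (m : Par → ℤ) :
    (serAction 0).satSpan (fnSeries fun i => J i + (m i : ℂ))
      = (serAction 0).satSpan (fnSeries J) := by
  -- the shifts that work for all nonresonant parameters form a group
  let G : AddSubgroup (Par → ℤ) :=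
    { carrier := {m | ∀ J : Par → ℂ, NonRes J →
        (serAction 0).satSpan (fnSeries fun i => J i + (m i : ℂ))
          = (serAction 0).satSpan (fnSeries J)}
      zero_mem' := fun J _ => by simp
      add_mem' := fun {m m'} h h' J hJ => by
        rw [← h J hJ, ← h' _ (hJ.add_int m)]
        simp only [Pi.add_apply, Int.cast_add, add_assoc]
      neg_mem' := fun {m} h J hJ => by
        rw [← h _ (hJ.add_int (-m))]
        simp }
  have hm : m ∈ G := by
    rw [← Finset.univ_sum_single m]
    refine G.sum_mem fun i _ => ?_
    have h1 : Pi.single i (m i) = m i • (Pi.single i 1 : Par → ℤ) := by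
      rw [← Pi.single_smul, smul_eq_mul, mul_one]
    rw [h1]
    exact G.zsmul_mem (fun J hJ => satSpan_fnSeries_add_one hJ i) _
  exact hm J hJ

theorem thetaOp_congr {i : Fin 3} {f g : (Fin 3 → ℂ) → ℂ} {p : Fin 3 → ℂ} (h : f =ᶠ[𝓝 p] g) :
    thetaOp i f =ᶠ[𝓝 p] thetaOp i g := by
  filter_upwards [h.fderiv (𝕜 := ℂ)] with z hz
  rw [thetaOp, thetaOp, hz]

/-- The eight squarefree monomials in the operators `θ_i` on functions. -/
noncomputable def thetaMono (K : Idx) (f : (Fin 3 → ℂ) → ℂ) : (Fin 3 → ℂ) → ℂ :=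
  let f₂ := bif K.2.2 then thetaOp 2 f else f
  let f₁ := bif K.2.1 then thetaOp 1 f₂ else f₂
  bif K.1 then thetaOp 0 f₁ else f₁

theorem thetaMono_psum {p : Fin 3 → ℂ} {f : PSAt p} (hf : GeomBdd (ser f)) (K : Idx) :
    thetaMono K (psum p (ser f)) =ᶠ[𝓝 p] psum p (ser ((serAction p).mono K f)) := by
  have h1 : ∀ (i : Fin 3) {g : (Fin 3 → ℂ) → ℂ} {m : PSAt p}, GeomBdd (ser m) →
      g =ᶠ[𝓝 p] psum p (ser m) → thetaOp i g =ᶠ[𝓝 p] psum p (ser ((serAction p).θ i m)) :=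
    fun i _ _ hm hg => (thetaOp_congr hg).trans (thetaOp_psum hm i)
  obtain ⟨a, b, c⟩ := K
  cases a <;> cases b <;> cases c <;>
    simp only [EulerAction.mono, thetaMono, cond_true, cond_false]
  · rfl
  · exact h1 2 hf .rfl
  · exact h1 1 hf .rfl
  · exact h1 1 (hf.θ 2) (h1 2 hf .rfl)
  · exact h1 0 hf .rfl
  · exact h1 0 (hf.θ 2) (h1 2 hf .rfl)
  · exact h1 0 (hf.θ 1) (h1 1 hf .rfl)
  · exact h1 0 ((hf.θ 2).θ 1) (h1 1 (hf.θ 2) (h1 2 hf .rfl))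

/-- Every integral shift of `F_N` is a rational combination of the eight derivatives `θ^K F_N`. -/
theorem exists_shift_eq_sum_thetaMono {J : Par → ℂ} (hJ : NonRes J) (m : Par → ℤ) :
    ∃ (S : Poly₃) (r : Idx → Poly₃), S ≠ 0 ∧ ∀ᶠ z in 𝓝 (0 : Fin 3 → ℂ),
      MvPolynomial.eval z S * lauricellaFN (fun i => J i + (m i : ℂ)) z
        = ∑ K, MvPolynomial.eval z (r K) * thetaMono K (lauricellaFN J) z := by
  have hF := geomBdd_fnSeries hJ.c₁_ne_neg hJ.c₂_ne_neg
  have hJ' := hJ.add_int m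
  have hF' := geomBdd_fnSeries (J := fun i => J i + (m i : ℂ)) hJ'.c₁_ne_neg hJ'.c₂_ne_neg
  have hmem := (serAction 0).mem_satSpan_self (fnSeries fun i => J i + (m i : ℂ))
  rw [satSpan_fnSeries_add hJ m] at hmem
  obtain ⟨S, hS, h⟩ := hmem
  obtain ⟨r, hr⟩ := (Submodule.mem_span_range_iff_exists_fun Poly₃).mp h
  refine ⟨S, r, hS, ?_⟩
  filter_upwards [psum_smul hF' S, psum_sum Finset.univ (fun K _ => (hF.mono K).smul (r K)) 0,
    (eventually_all (l := 𝓝 (0 : Fin 3 → ℂ))).mpr fun K => psum_smul (hF.mono K) (r K),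
    (eventually_all (l := 𝓝 (0 : Fin 3 → ℂ))).mpr fun K => thetaMono_psum hF K]
    with z h1 h2 h3 h4
  rw [lauricellaFN_eq_psum, lauricellaFN_eq_psum, ← h1, ← hr, map_sum, h2]
  exact Finset.sum_congr rfl fun K _ => by rw [h3, h4]

end Shifts

open Filter Topology in
theorem theorem1 :
    -- where the series is defined, `F_N` is holomorphic at the origin and solves the Horn system
    (∀ J : Par → ℂ, (∀ n : ℕ, J .c₁ ≠ -(n : ℂ)) → (∀ n : ℕ, J .c₂ ≠ -(n : ℂ)) →
      (∀ᶠ z in 𝓝 (0 : Fin 3 → ℂ), Summable (lauricellaFNTerm J z)) ∧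
      IsLocalSolution J 0 (lauricellaFN J)) ∧
    -- off a proper algebraic subset of the parameter space, the holonomic rank is 8, and so is
    -- the dimension of the space of solutions near every point off an algebraic hypersurface
    (∃ g : MvPolynomial Par ℂ, g ≠ 0 ∧ ∀ J : Par → ℂ, MvPolynomial.eval J g ≠ 0 →
      holonomicRank J = 8 ∧
      ∃ D : MvPolynomial (Fin 3) ℂ, D ≠ 0 ∧ ∀ p : Fin 3 → ℂ, MvPolynomial.eval p D ≠ 0 →
        Module.rank ℂ (solutionGerms J p) = 8) ∧
    -- when finitely many suitable nonzero integral linear forms take no integer value at the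
    -- parameters, every integral shift of `F_N` is expressed through the eight derivatives
    (∃ Λ : Finset (Par → ℤ), (∀ l ∈ Λ, l ≠ 0) ∧
      ∀ J : Par → ℂ, (∀ l ∈ Λ, ∀ n : ℤ, ∑ i, (l i : ℂ) * J i ≠ (n : ℂ)) →
        ∀ m : Par → ℤ,
          ∃ (S S₀ : MvPolynomial (Fin 3) ℂ) (S₁ : Fin 3 → MvPolynomial (Fin 3) ℂ)
            (S₂ : Fin 3 → Fin 3 → MvPolynomial (Fin 3) ℂ) (S₃ : MvPolynomial (Fin 3) ℂ),
            S ≠ 0 ∧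
            ∀ᶠ z in 𝓝 (0 : Fin 3 → ℂ),
              MvPolynomial.eval z S * lauricellaFN (fun i => J i + (m i : ℂ)) z =
                MvPolynomial.eval z S₀ * lauricellaFN J z
                + ∑ i, MvPolynomial.eval z (S₁ i) * thetaOp i (lauricellaFN J) z
                + ∑ i, ∑ j ∈ Finset.Ioi i,
                    MvPolynomial.eval z (S₂ i j) * thetaOp i (thetaOp j (lauricellaFN J)) z
                + MvPolynomial.eval z S₃ *
                    thetaOp 0 (thetaOp 1 (thetaOp 2 (lauricellaFN J))) z) := by
  -- the rank and the local solution spaces have dimension 8 without any condition on the parameters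
  refine ⟨fun J h₁ h₂ => ⟨eventually_summable_lauricellaFNTerm h₁ h₂,
    isLocalSolution_lauricellaFN h₁ h₂⟩, ⟨1, one_ne_zero, fun J _ => ⟨holonomicRank_eq J,
    singLocus, singLocus_ne_zero, fun p hp => rank_solutionGerms J hp⟩⟩,
    resonanceForms, ne_zero_of_mem_resonanceForms, fun J hJ m => ?_⟩
  obtain ⟨S, r, hS, h⟩ := exists_shift_eq_sum_thetaMono hJ m
  refine ⟨S, r (false, false, false),
    ![r (true, false, false), r (false, true, false), r (false, false, true)],
    fun i j => ![![0, r (true, true, false), r (true, false, true)], ![0, 0, r (false, true, true)],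
      ![0, 0, 0]] i j, r (true, true, true), hS, ?_⟩
  filter_upwards [h] with z hz
  have hI0 : Finset.Ioi (0 : Fin 3) = {1, 2} := by decide
  have hI1 : Finset.Ioi (1 : Fin 3) = {2} := by decide
  have hI2 : Finset.Ioi (2 : Fin 3) = ∅ := by decide
  have h12 : (1 : Fin 3) ≠ 2 := by decide
  rw [hz, Fin.sum_univ_three, Fin.sum_univ_three, hI0, hI1, hI2, Finset.sum_pair h12,
    Finset.sum_singleton, Finset.sum_empty]
  simp only [Fintype.sum_prod_type, Fintype.sum_bool, thetaMono, cond_true, cond_false,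
    Matrix.cons_val]
  ring
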